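/- **Setting.** Let $(\Omega,\mathcal F,\mathbb P)$ be a probability space, $\mathbb T:\Omega\to\Omega$ a bijective bimeasurable transformation preserving $\mathbb P$, and $\epsilon_0\in\mathbb L^2(\Omega)$ a real random variable with $\mathbb E(\epsilon_0)=0$; put $\epsilon_i=\epsilon_0\circ\mathbb T^i$ for $i\in\mathbb Z$. Let $\mathcal F_0\subseteq\mathcal F$ be a $\sigma$-algebra with $\mathcal F_0\subseteq\mathbb T^{-1}(\mathcal F_0)$, and $\mathcal F_i=\mathbb T^{-i}(\mathcal F_0)$. Assume that every event of $\mathcal F_{-\infty}=\bigcap_{i\in\mathbb Z}\mathcal F_i$ has probability $0$ or $1$, and that $\epsilon_0$ is measurable with respect to $\mathcal F_\infty=\sigma\big(\bigcup_{i\in\mathbb Z}\mathcal F_i\big)$. With $P_0(Z)=\mathbb E(Z\mid\mathcal F_0)-\mathbb E(Z\mid\mathcal F_{-1})$, assume Hannan's condition $$\text{(C1)}\qquad \sum_{i\in\mathbb Z}\|P_0(\epsilon_i)\|_{\mathbb L^2}<\infty .$$ Let $(x_{i,j})_{i\ge 1,\,1\le j\le p}$ be real numbers, $X=X_n=(x_{i,j})_{1\le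 i\le n,1\le j\le p}$, and $d_j(n)=\big(\sum_{i=1}^n x_{i,j}^2\big)^{1/2}$. Assume that for all $j,l\in\{1,\dots,p\}$ and all integers $k\ge 0$: - (C2) $d_j(n)\to\infty$ as $n\to\infty$; - (C3) $\sup_{1\le i\le n}|x_{i,j}|/d_j(n)\to 0$ as $n\to\infty$; - (C4) the limit $\rho_{j,l}(k)=\lim_{n\to\infty}\sum_{m=1}^{n-k}\dfrac{x_{m,j}\,x_{m+k,l}}{d_j(n)\,d_l(n)}$ exists; - (C5) the matrix $R(0)=[\rho_{j,l}(0)]_{j,l}$ is positive definite. For $\beta\in\mathbb R^p$ let $Y_i=\sum_{j=1}^p x_{i,j}\beta_j+\epsilon_i$ ($i\ge1$), let $\hat\beta=(X^tX)^{-1}X^tY$ be the least squares estimator based on $Y=(Y_1,\dots,Y_n)^t$ (well defined for all large $n$), and let $\hat\epsilon_i=Y_i-\sum_{j=1}^p x_{i,j}\hat\beta_j$, $1\le i\le n$, be the residuals. Let $K(u)=1$ for $|u|\le1$, $K(u)=2-|u|$ for $1\le|u|\le2$, $K(u)=0$ for $|u|>2$, and $$f_n^*(\lambda)=\frac1{2\pi}\sum_{|k|\le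 n-1}K\Big(\frac{|k|}{c_n}\Big)\hat\gamma_k^*\,e^{ik\lambda},\qquad \hat\gamma_k^*=\frac1n\sum_{j=1}^{n-|k|}\hat\epsilon_j\hat\epsilon_{j+|k|}.$$ **Theorem.** Let $(c_n)$ be a sequence of positive integers such that $c_n\to\infty$ and $$c_n\,\mathbb E\Big(|\epsilon_0|^2\Big(1\wedge\frac{c_n}{n}|\epsilon_0|^2\Big)\Big)\longrightarrow 0\qquad(n\to\infty).$$ Then the process $(\epsilon_i)$ has a continuous spectral density, that is, there is a (necessarily unique) continuous function $f:[-\pi,\pi]\to[0,\infty)$ with $\mathrm{Cov}(\epsilon_m,\epsilon_{m+k})=\int_{-\pi}^{\pi}e^{ik\lambda}f(\lambda)\,d\lambda$ for all $m,k\in\mathbb Z$, and $$\sup_{\lambda\in[-\pi,\pi]}\big\|f_n^*(\lambda)-f(\lambda)\big\|_{\mathbb L^1}\longrightarrow 0\qquad(n\to\infty).$$ -/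

import Mathlib

open MeasureTheory ProbabilityTheory Filter Topology

noncomputable section

namespace HannanRegression

/-- The stationary process `ε i = ε₀ ∘ T ^ i`, `i ∈ ℤ`. -/
def process {Ω : Type*} (T : Equiv.Perm Ω) (ε₀ : Ω → ℝ) (i : ℤ) : Ω → ℝ :=
  fun ω => ε₀ ((T ^ i) ω)

/-- `ℱ i = T⁻ⁱ(ℱ₀)`: the sets `(T ^ i) ⁻¹' A` with `A ∈ ℱ₀`. -/
@[reducible] def filt {Ω : Type*} (F₀ : MeasurableSpace Ω) (T : Equiv.Perm Ω) (i : ℤ) : MeasurableSpace Ω :=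
  F₀.comap (fun ω => (T ^ i) ω)

/-- The projection `P_j(Z) = E(Z | ℱ j) - E(Z | ℱ (j - 1))`. -/
def proj {Ω : Type*} (F : ℤ → MeasurableSpace Ω) [MeasurableSpace Ω] (μ : Measure Ω)
    (j : ℤ) (Z : Ω → ℝ) : Ω → ℝ :=
  μ[Z | F j] - μ[Z | F (j - 1)]

/-- `f` is a spectral density on `[-π, π]` of the (second order stationary) process `ε`:
a nonnegative integrable function with
`Cov(ε_m, ε_{m+k}) = ∫_{-π}^{π} e^{ikλ} f(λ) dλ` for all `m, k ∈ ℤ`. -/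
structure IsSpectralDensity {Ω : Type*} [MeasurableSpace Ω] (μ : Measure Ω) (ε : ℤ → Ω → ℝ)
    (f : ℝ → ℝ) : Prop where
  nonneg : ∀ t ∈ Set.Icc (-Real.pi) Real.pi, 0 ≤ f t
  integrable : IntegrableOn f (Set.Icc (-Real.pi) Real.pi)
  fourier : ∀ m k : ℤ, ((covariance (ε m) (ε (m + k)) μ : ℝ) : ℂ) =
    ∫ t in (-Real.pi)..Real.pi, Complex.exp (Complex.I * (k : ℂ) * (t : ℂ)) * (f t : ℂ)

/-- The `n × p` design matrix. The design is a doubly indexed family `x i j` whose rows are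
numbered `i = 1, 2, …`; the value `x 0 j` is never used. -/
def designMatrix {p : ℕ} (x : ℕ → Fin p → ℝ) (n : ℕ) : Matrix (Fin n) (Fin p) ℝ :=
  Matrix.of fun i j => x (i.val + 1) j

/-- `d_j(n)`, the Euclidean norm of the `j`-th column of the `n × p` design matrix. -/
def colNorm {p : ℕ} (x : ℕ → Fin p → ℝ) (j : Fin p) (n : ℕ) : ℝ :=
  Real.sqrt (∑ i ∈ Finset.Icc 1 n, x i j ^ 2)

/-- The responses `Y_i = ∑_j x_{i,j} β_j + ε_i`. -/
def response {Ω : Type*} {p : ℕ} (x : ℕ → Fin p → ℝ) (β : Fin p → ℝ) (ε : ℤ → Ω → ℝ)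
    (i : ℕ) (ω : Ω) : ℝ :=
  ∑ j, x i j * β j + ε (i : ℤ) ω

/-- The least squares estimator `(XᵗX)⁻¹ Xᵗ Y` based on the responses `Y 1, …, Y n`. -/
def leastSquares {Ω : Type*} {p : ℕ} (x : ℕ → Fin p → ℝ) (Y : ℕ → Ω → ℝ)
    (n : ℕ) (ω : Ω) : Fin p → ℝ :=
  (((designMatrix x n).transpose * designMatrix x n)⁻¹ * (designMatrix x n).transpose).mulVec
    (fun i : Fin n => Y (i.val + 1) ω)

/-- The residual of observation `i` in the regression on the first `n` observations. -/
def residual {Ω : Type*} {p : ℕ} (x : ℕ → Fin p → ℝ) (Y : ℕ → Ω → ℝ)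
    (n i : ℕ) (ω : Ω) : ℝ :=
  Y i ω - ∑ j, x i j * leastSquares x Y n ω j

/-- The flat-top kernel. -/
def kernel (u : ℝ) : ℝ :=
  if |u| ≤ 1 then 1 else if |u| ≤ 2 then 2 - |u| else 0

/-- The empirical autocovariance at lag `k`, `|k| ≤ n - 1`, of the residuals. -/
def residualAutocov {Ω : Type*} {p : ℕ} (x : ℕ → Fin p → ℝ) (Y : ℕ → Ω → ℝ)
    (n : ℕ) (k : ℤ) (ω : Ω) : ℝ :=
  (1 / (n : ℝ)) * ∑ j ∈ Finset.Icc 1 (n - k.natAbs),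
    residual x Y n j ω * residual x Y n (j + k.natAbs) ω

/-- The kernel estimator of the spectral density built on the residuals, with bandwidth `c`. -/
def spectralEstimator {Ω : Type*} {p : ℕ} (x : ℕ → Fin p → ℝ) (Y : ℕ → Ω → ℝ)
    (c n : ℕ) (t : ℝ) (ω : Ω) : ℂ :=
  (1 / (2 * (Real.pi : ℂ))) * ∑ k ∈ Finset.Icc (-((n : ℤ) - 1)) ((n : ℤ) - 1),
    (kernel (|(k : ℝ)| / (c : ℝ)) : ℂ) * (residualAutocov x Y n k ω : ℂ) *
      Complex.exp (Complex.I * (k : ℂ) * (t : ℂ))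

end HannanRegression

end

noncomputable section

namespace HannanRegression

/-! The estimator is `1 / (2πn)` times a Toeplitz quadratic form `Q` in the residuals, with
coefficients `K(|k|/c) cos(kt)`. The flat-top kernel is twice the Bartlett kernel of bandwidth `2c`
minus the one of bandwidth `c`, and a Bartlett form is a sum of squares of window sums
(`quadForm_triangle`). Thus `Q` is a difference of nonnegative forms, and Young's inequality gives
`|Q(u) - Q(v)| ≤ (1 + 1/η) P(u - v) + η P(v)`, where `P` is the corresponding sum
(`abs_quadForm_lagWindow_sub_le`). On a stationary sequence with autocovariances `γ` the mean of `P`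
is at most `3n ∑ |γ(k)|`, whatever the bandwidth and the frequency. A perturbation whose
autocovariances have a small absolute sum is therefore harmless, uniformly in `t`.

Hannan's condition and the triviality of the remote past make `ε₀` a norm convergent sum of
innovations placed at different times (`hasSum_koopman_proj`). Innovations at distinct times are
orthogonal, so `∑ |γ(k)| ≤ (∑ ‖P₀(ε_l)‖)²` (`summable_acov`). This gives the continuous density
`(2π)⁻¹ ∑ γ(k) cos(kt)`. Applied to a difference, it also allows the errors to be replaced by a
finite moving average of bounded innovations (`exists_bounded_approximation`).

For bounded innovations second moments suffice (`eventually_integral_abs_cross_le`): off the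
diagonal the form is a sum of martingale differences with variance `O(cn)`, which is `o(n²)`, and on
the diagonal a weak law of large numbers applies, since covariances of bounded variables vanish at
infinity when the remote past is trivial. The mean of `Q / n` tends to `2πf(t)` uniformly in `t` by
dominated convergence.

Finally the residuals are the errors minus `Hε`, where `H` is an orthogonal projection of rank `p`.
Then `E ‖Hε‖² ≤ p ∑ |γ(k)|` and `P(u) ≤ 12 c ‖u‖²`, so passing to the residuals costs `O(c)`, which
is `o(n)`. The moment condition supplies `c / n → 0`, unless the errors vanish almost surely. -/

/-! ### Bartlett and flat-top kernels. -/

/-- The triangular (Bartlett) kernel with bandwidth `c`, at integer lags. -/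
def triangle (c : ℕ) (k : ℤ) : ℝ := max 0 (1 - |(k : ℝ)| / c)

/-- The quadratic form with Toeplitz coefficients `a (j - i)`, `1 ≤ i, j ≤ n`. -/
def quadForm (a : ℤ → ℝ) (n : ℕ) (u : ℕ → ℝ) : ℝ :=
  ∑ i ∈ Finset.Icc 1 n, ∑ j ∈ Finset.Icc 1 n, a ((j : ℤ) - i) * (u i * u j)

lemma triangle_nonneg (c : ℕ) (k : ℤ) : 0 ≤ triangle c k := le_max_left _ _

lemma triangle_le_one (c : ℕ) (k : ℤ) : triangle c k ≤ 1 :=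
  max_le zero_le_one (by have : 0 ≤ |(k : ℝ)| / c := by positivity
                         linarith)

lemma triangle_eq_zero {c : ℕ} (hc : 0 < c) {k : ℤ} (hk : (c : ℤ) ≤ |k|) : triangle c k = 0 := by
  have hc' : (0 : ℝ) < c := by exact_mod_cast hc
  have hk' : (c : ℝ) ≤ |(k : ℝ)| := by exact_mod_cast hk
  refine max_eq_left ?_
  have := (one_le_div hc').2 hk'
  linarith

/-- The flat-top kernel is not itself positive definite; this writes it through two kernels that
are, so that sums of squares become available. -/
lemma kernel_eq_triangle {c : ℕ} (hc : 0 < c) (k : ℤ) :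
    kernel (|(k : ℝ)| / c) = 2 * triangle (2 * c) k - triangle c k := by
  have hc' : (0 : ℝ) < c := by exact_mod_cast hc
  have h0 : 0 ≤ |(k : ℝ)| / c := by positivity
  have h2 : |(k : ℝ)| / ((2 * c : ℕ) : ℝ) = |(k : ℝ)| / c / 2 := by
    push_cast; field_simp
  unfold kernel triangle
  rw [h2, abs_of_nonneg h0]
  generalize |(k : ℝ)| / (c : ℝ) = u at *
  split_ifs with h1 h3
  · rw [max_eq_right (by linarith), max_eq_right (by linarith)]; ring
  · rw [max_eq_right (by linarith), max_eq_left (by linarith)]; ring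
  · rw [max_eq_left (by linarith), max_eq_left (by linarith)]; ring

lemma abs_kernel_le_one (u : ℝ) : |kernel u| ≤ 1 := by
  unfold kernel
  split_ifs with h1 h2
  · simp
  · rw [abs_le]; constructor <;> linarith
  · simp

lemma kernel_eq_zero {u : ℝ} (hu : 2 ≤ |u|) : kernel u = 0 := by
  unfold kernel
  split_ifs with h1 h2
  · linarith
  · linarith
  · rfl

/-- The number of windows of length `c` containing both `i` and `j`. -/
lemma sum_window {n c : ℕ} (hc : 0 < c) {i j : ℕ} (hi : i ≤ n) (hj : j ≤ n) :
    ∑ s ∈ Finset.range (n + c), (if i ≤ s ∧ s < i + c then (1 : ℝ) else 0) *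
      (if j ≤ s ∧ s < j + c then 1 else 0) = c * triangle c ((j : ℤ) - i) := by
  have hc' : (0 : ℝ) < c := by exact_mod_cast hc
  have h1 : ∀ s, (if i ≤ s ∧ s < i + c then (1 : ℝ) else 0) *
      (if j ≤ s ∧ s < j + c then 1 else 0) =
      if s ∈ Finset.Ico (max i j) (min i j + c) then 1 else 0 := by
    intro s
    simp only [Finset.mem_Ico]
    split_ifs <;> first | omega | norm_num
  simp_rw [h1]
  rw [Finset.sum_ite_mem, Finset.inter_eq_right.2, Finset.sum_const, Nat.card_Ico, nsmul_one]
  · unfold triangle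
    rw [mul_max_of_nonneg _ _ hc'.le, mul_zero, mul_sub, mul_one, mul_div_cancel₀ _ hc'.ne']
    push_cast
    rcases le_total i j with h | h
    · have h' : (i : ℝ) ≤ j := by exact_mod_cast h
      rw [max_eq_right h, min_eq_left h, abs_of_nonneg (by linarith)]
      rcases le_total j (i + c) with h2 | h2
      · have h2' : (j : ℝ) ≤ i + c := by exact_mod_cast h2
        rw [Nat.cast_sub h2, max_eq_right (by linarith)]; push_cast; ring
      · have h2' : (i : ℝ) + c ≤ j := by exact_mod_cast h2
        rw [Nat.sub_eq_zero_of_le h2, max_eq_left (by linarith)]; simp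
    · have h' : (j : ℝ) ≤ i := by exact_mod_cast h
      rw [max_eq_left h, min_eq_right h, abs_of_nonpos (by linarith)]
      rcases le_total i (j + c) with h2 | h2
      · have h2' : (i : ℝ) ≤ j + c := by exact_mod_cast h2
        rw [Nat.cast_sub h2, max_eq_right (by linarith)]; push_cast; ring
      · have h2' : (j : ℝ) + c ≤ i := by exact_mod_cast h2
        rw [Nat.sub_eq_zero_of_le h2, max_eq_left (by linarith)]; simp
  · intro s
    simp only [Finset.mem_Ico, Finset.mem_range]
    omega

/-! ### Nonnegative quadratic forms and their perturbation. -/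

lemma quadForm_const_mul (b : ℝ) (a : ℤ → ℝ) (n : ℕ) (u : ℕ → ℝ) :
    quadForm (fun k => b * a k) n u = b * quadForm a n u := by
  unfold quadForm
  simp_rw [Finset.mul_sum, mul_assoc]

lemma quadForm_sub_coeff (a b : ℤ → ℝ) (n : ℕ) (u : ℕ → ℝ) :
    quadForm (fun k => a k - b k) n u = quadForm a n u - quadForm b n u := by
  unfold quadForm
  simp_rw [sub_mul, Finset.sum_sub_distrib]

/-- The window sums whose squares make up the Bartlett quadratic form. -/
def windowSum (φ : ℝ → ℝ) (c n : ℕ) (t : ℝ) (u : ℕ → ℝ) (s : ℕ) : ℝ :=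
  ∑ i ∈ Finset.Icc 1 n, (if i ≤ s ∧ s < i + c then (1 : ℝ) else 0) * φ (i * t) * u i

lemma windowSum_sub (φ : ℝ → ℝ) (c n : ℕ) (t : ℝ) (u v : ℕ → ℝ) (s : ℕ) :
    windowSum φ c n t (fun i => u i - v i) s = windowSum φ c n t u s - windowSum φ c n t v s := by
  simp only [windowSum, mul_sub, Finset.sum_sub_distrib]

/-- The Bartlett kernel is the autocorrelation of the indicator of a window of length `c`, and
`cos((j - i)t)` splits by the addition formula; each window then contributes a perfect square for
the cosine and one for the sine. -/
lemma quadForm_triangle {c : ℕ} (hc : 0 < c) (n : ℕ) (t : ℝ) (u : ℕ → ℝ) :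
    c * quadForm (fun k => triangle c k * Real.cos (k * t)) n u =
      ∑ s ∈ Finset.range (n + c),
        (windowSum Real.cos c n t u s ^ 2 + windowSum Real.sin c n t u s ^ 2) := by
  have h : ∀ s, windowSum Real.cos c n t u s ^ 2 + windowSum Real.sin c n t u s ^ 2 =
      ∑ i ∈ Finset.Icc 1 n, ∑ j ∈ Finset.Icc 1 n,
        ((if i ≤ s ∧ s < i + c then (1 : ℝ) else 0) * (if j ≤ s ∧ s < j + c then 1 else 0)) *
        (Real.cos ((((j : ℤ) - i : ℤ) : ℝ) * t) * (u i * u j)) := by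
    intro s
    simp only [windowSum, sq, Finset.sum_mul_sum, ← Finset.sum_add_distrib]
    refine Finset.sum_congr rfl fun i _ => Finset.sum_congr rfl fun j _ => ?_
    push_cast
    rw [sub_mul, Real.cos_sub]
    ring
  simp_rw [h]
  rw [Finset.sum_comm, quadForm, Finset.mul_sum]
  refine Finset.sum_congr rfl fun i hi => ?_
  rw [Finset.sum_comm, Finset.mul_sum]
  refine Finset.sum_congr rfl fun j hj => ?_
  rw [← Finset.sum_mul, sum_window hc (Finset.mem_Icc.1 hi).2 (Finset.mem_Icc.1 hj).2]
  push_cast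
  ring

/-- Young's inequality for the cross term in `a² - b² = (a - b)² + 2b(a - b)`; the difference of its
two sides is a square. -/
lemma abs_sq_sub_sq_le {η : ℝ} (hη : 0 < η) (a b : ℝ) :
    |a ^ 2 - b ^ 2| ≤ (1 + 1 / η) * (a - b) ^ 2 + η * b ^ 2 := by
  have h : (1 / η) * (a - b) ^ 2 + η * b ^ 2 - 2 * |b * (a - b)| =
      (1 / η) * (|a - b| - η * |b|) ^ 2 := by
    rw [abs_mul, sub_sq |a - b|, mul_pow, sq_abs, sq_abs]; field_simp; ring
  have h2 : 0 ≤ (1 / η) * (|a - b| - η * |b|) ^ 2 := by positivity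
  have h3 : a ^ 2 - b ^ 2 = (a - b) ^ 2 + 2 * (b * (a - b)) := by ring
  have h4 : |a ^ 2 - b ^ 2| ≤ (a - b) ^ 2 + 2 * |b * (a - b)| := by
    rw [h3]
    refine (abs_add_le _ _).trans ?_
    rw [abs_of_nonneg (sq_nonneg _), abs_mul 2, abs_two]
  linarith

lemma abs_quadForm_triangle_sub_le {c : ℕ} (hc : 0 < c) (n : ℕ) (t : ℝ) (u v : ℕ → ℝ)
    {η : ℝ} (hη : 0 < η) :
    |quadForm (fun k => triangle c k * Real.cos (k * t)) n u -
      quadForm (fun k => triangle c k * Real.cos (k * t)) n v| ≤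
      (1 + 1 / η) * quadForm (fun k => triangle c k * Real.cos (k * t)) n (fun i => u i - v i) +
      η * quadForm (fun k => triangle c k * Real.cos (k * t)) n v := by
  have hc' : (0 : ℝ) < c := by exact_mod_cast hc
  refine le_of_mul_le_mul_left ?_ hc'
  rw [← abs_of_pos hc', ← abs_mul, abs_of_pos hc', mul_sub, mul_add, mul_left_comm _ (1 + 1 / η),
    mul_left_comm _ η, quadForm_triangle hc, quadForm_triangle hc, quadForm_triangle hc,
    ← Finset.sum_sub_distrib, Finset.mul_sum, Finset.mul_sum, ← Finset.sum_add_distrib]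
  refine (Finset.abs_sum_le_sum_abs _ _).trans (Finset.sum_le_sum fun s _ => ?_)
  rw [windowSum_sub, windowSum_sub]
  have h1 := abs_sq_sub_sq_le hη (windowSum Real.cos c n t u s) (windowSum Real.cos c n t v s)
  have h2 := abs_sq_sub_sq_le hη (windowSum Real.sin c n t u s) (windowSum Real.sin c n t v s)
  rw [add_sub_add_comm]
  refine (abs_add_le _ _).trans ((add_le_add h1 h2).trans (le_of_eq ?_))
  ring

/-- The lag window of the estimator. -/
def lagWindow (c : ℕ) (t : ℝ) (k : ℤ) : ℝ := kernel (|(k : ℝ)| / c) * Real.cos (k * t)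

/-- The nonnegative form that controls the perturbations of the form with coefficients
`lagWindow c t`. -/
def dominatingForm (c : ℕ) (t : ℝ) (n : ℕ) (u : ℕ → ℝ) : ℝ :=
  quadForm (fun k => (2 * triangle (2 * c) k + triangle c k) * Real.cos (k * t)) n u

/-- The two Bartlett parts enter the form with opposite signs, but their error bounds add up, which
is why the dominating form carries a plus sign. -/
lemma abs_quadForm_lagWindow_sub_le {c : ℕ} (hc : 0 < c) (n : ℕ) (t : ℝ) (u v : ℕ → ℝ)
    {η : ℝ} (hη : 0 < η) :
    |quadForm (lagWindow c t) n u - quadForm (lagWindow c t) n v| ≤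
      (1 + 1 / η) * dominatingForm c t n (fun i => u i - v i) + η * dominatingForm c t n v := by
  have hK : ∀ w, quadForm (lagWindow c t) n w =
      2 * quadForm (fun k => triangle (2 * c) k * Real.cos (k * t)) n w -
      quadForm (fun k => triangle c k * Real.cos (k * t)) n w := by
    intro w
    rw [← quadForm_const_mul, ← quadForm_sub_coeff]
    congr 1; ext k; rw [lagWindow, kernel_eq_triangle hc]; ring
  have hD : ∀ w, dominatingForm c t n w =
      2 * quadForm (fun k => triangle (2 * c) k * Real.cos (k * t)) n w +
      quadForm (fun k => triangle c k * Real.cos (k * t)) n w := by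
    intro w
    rw [dominatingForm, ← quadForm_const_mul, ← sub_neg_eq_add, ← neg_one_mul,
      ← quadForm_const_mul, ← quadForm_sub_coeff]
    congr 1; ext k; ring
  rw [hK, hK, hD, hD]
  have h1 := abs_le.1 (abs_quadForm_triangle_sub_le (c := 2 * c) (by omega) n t u v hη)
  have h2 := abs_le.1 (abs_quadForm_triangle_sub_le hc n t u v hη)
  rw [abs_le]
  constructor <;> linarith [h1.1, h1.2, h2.1, h2.2]

lemma abs_lagWindow_le_one (c : ℕ) (t : ℝ) (k : ℤ) : |lagWindow c t k| ≤ 1 := by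
  rw [lagWindow, abs_mul]
  exact mul_le_one₀ (abs_kernel_le_one _) (abs_nonneg _) (Real.abs_cos_le_one _)

lemma lagWindow_eq_zero {c : ℕ} (hc : 0 < c) (t : ℝ) {k : ℤ} (hk : 2 * (c : ℤ) ≤ |k|) :
    lagWindow c t k = 0 := by
  have hc' : (0 : ℝ) < c := by exact_mod_cast hc
  have hk' : 2 * (c : ℝ) ≤ |(k : ℝ)| := by exact_mod_cast hk
  rw [lagWindow, kernel_eq_zero, zero_mul]
  rw [abs_of_nonneg (by positivity), le_div_iff₀ hc']
  exact hk'

lemma abs_dominating_coeff_le (c : ℕ) (t : ℝ) (k : ℤ) :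
    |(2 * triangle (2 * c) k + triangle c k) * Real.cos (k * t)| ≤ 3 := by
  rw [abs_mul]
  have h1 := triangle_nonneg (2 * c) k
  have h2 := triangle_nonneg c k
  have h3 := triangle_le_one (2 * c) k
  have h4 := triangle_le_one c k
  rw [abs_of_nonneg (by linarith)]
  have := Real.abs_cos_le_one ((k : ℝ) * t)
  nlinarith [abs_nonneg (Real.cos ((k : ℝ) * t))]

lemma dominating_coeff_eq_zero {c : ℕ} (hc : 0 < c) (t : ℝ) {k : ℤ} (hk : 2 * (c : ℤ) ≤ |k|) :
    (2 * triangle (2 * c) k + triangle c k) * Real.cos (k * t) = 0 := by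
  rw [triangle_eq_zero (c := 2 * c) (by omega) (by push_cast; exact hk),
    triangle_eq_zero hc (by omega)]
  simp

lemma card_near_le (c n i : ℕ) :
    ((Finset.Icc 1 n).filter fun j : ℕ => |(j : ℤ) - i| < 2 * (c : ℤ)).card ≤ 4 * c := by
  rcases Nat.eq_zero_or_pos c with rfl | hc
  · rw [Finset.filter_false_of_mem]
    · simp
    · intro j _ h
      have := abs_nonneg ((j : ℤ) - i)
      push_cast at h
      linarith
  have : ((Finset.Icc 1 n).filter fun j : ℕ => |(j : ℤ) - i| < 2 * (c : ℤ)) ⊆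
      Finset.Ico (i - (2 * c - 1)) (i + 2 * c) := by
    intro j hj
    rw [Finset.mem_filter, abs_lt] at hj
    rw [Finset.mem_Ico]
    omega
  refine (Finset.card_le_card this).trans ?_
  rw [Nat.card_Ico]
  omega

/-- A Schur test: the coefficients are at most `3`, each row has at most `4c` nonzero ones, and `2
u_i u_j ≤ u_i² + u_j²`. This pathwise bound serves for the projected errors, which are not
stationary. -/
lemma dominatingForm_le {c : ℕ} (hc : 0 < c) (t : ℝ) (n : ℕ) (u : ℕ → ℝ) :
    dominatingForm c t n u ≤ 12 * c * ∑ i ∈ Finset.Icc 1 n, u i ^ 2 := by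
  have h : ∀ i j : ℕ, (2 * triangle (2 * c) ((j : ℤ) - i) + triangle c ((j : ℤ) - i)) *
      Real.cos ((((j : ℤ) - i : ℤ) : ℝ) * t) * (u i * u j) ≤
      (if |(j : ℤ) - i| < 2 * (c : ℤ) then 3 / 2 * u i ^ 2 else 0) +
      (if |(i : ℤ) - j| < 2 * (c : ℤ) then 3 / 2 * u j ^ 2 else 0) := by
    intro i j
    rw [abs_sub_comm (i : ℤ) j]
    split_ifs with hij
    · refine (le_abs_self _).trans ?_
      rw [abs_mul]
      refine (mul_le_mul_of_nonneg_right (abs_dominating_coeff_le c t _) (abs_nonneg _)).trans ?_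
      rw [abs_mul, ← sq_abs (u i), ← sq_abs (u j)]
      nlinarith [sq_nonneg (|u i| - |u j|)]
    · rw [dominating_coeff_eq_zero hc t (not_lt.1 hij)]; simp
  have h2 : ∀ i : ℕ, ∑ j ∈ Finset.Icc 1 n,
      (if |(j : ℤ) - i| < 2 * (c : ℤ) then 3 / 2 * u i ^ 2 else 0) ≤ 6 * c * u i ^ 2 := by
    intro i
    rw [← Finset.sum_filter, Finset.sum_const, nsmul_eq_mul]
    have : (((Finset.Icc 1 n).filter fun j : ℕ => |(j : ℤ) - i| < 2 * (c : ℤ)).card : ℝ) ≤ 4 * c := by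
      exact_mod_cast card_near_le c n i
    nlinarith [sq_nonneg (u i)]
  unfold dominatingForm quadForm
  calc _ ≤ _ := Finset.sum_le_sum fun i _ => Finset.sum_le_sum fun j _ => h i j
    _ = ∑ i ∈ Finset.Icc 1 n, ∑ j ∈ Finset.Icc 1 n,
          (if |(j : ℤ) - i| < 2 * (c : ℤ) then 3 / 2 * u i ^ 2 else 0) +
        ∑ i ∈ Finset.Icc 1 n, ∑ j ∈ Finset.Icc 1 n,
          (if |(j : ℤ) - i| < 2 * (c : ℤ) then 3 / 2 * u i ^ 2 else 0) := by
        simp_rw [Finset.sum_add_distrib]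
        congr 1
        rw [Finset.sum_comm]
    _ ≤ ∑ i ∈ Finset.Icc 1 n, 6 * c * u i ^ 2 + ∑ i ∈ Finset.Icc 1 n, 6 * c * u i ^ 2 :=
        add_le_add (Finset.sum_le_sum fun i _ => h2 i) (Finset.sum_le_sum fun i _ => h2 i)
    _ = _ := by rw [← Finset.mul_sum]; ring

/-! ### The estimator as a quadratic form. -/

/-- Summation along the diagonals of a square. -/
lemma sum_diagonals {M : Type*} [NonUnitalNonAssocSemiring M] (n : ℕ) (a : ℤ → M) (g : ℕ → ℕ → M)
    (hg : ∀ i j, g i j = g j i) :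
    ∑ i ∈ Finset.Icc 1 n, ∑ j ∈ Finset.Icc 1 n, a ((j : ℤ) - i) * g i j =
      ∑ k ∈ Finset.Icc (-((n : ℤ) - 1)) ((n : ℤ) - 1),
        a k * ∑ j ∈ Finset.Icc 1 (n - k.natAbs), g j (j + k.natAbs) := by
  rw [← Finset.sum_product', ← Finset.sum_fiberwise_of_maps_to
    (t := Finset.Icc (-((n : ℤ) - 1)) ((n : ℤ) - 1)) (g := fun q : ℕ × ℕ => (q.2 : ℤ) - q.1)]
  · refine Finset.sum_congr rfl fun k hk => ?_
    rw [Finset.mul_sum]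
    symm
    -- A pair on the diagonal `k` is recovered from its smaller index; the sign of `k` tells which
    -- coordinate that is.
    refine Finset.sum_bij' (fun j _ => if 0 ≤ k then (j, j + k.natAbs) else (j + k.natAbs, j))
      (fun q _ => min q.1 q.2) ?_ ?_ ?_ ?_ ?_
    · intro j hj
      rw [Finset.mem_Icc] at hj hk
      simp only [Finset.mem_filter, Finset.mem_product, Finset.mem_Icc]
      split_ifs with h <;> simp only [] <;> omega
    · intro q hq
      simp only [Finset.mem_filter, Finset.mem_product, Finset.mem_Icc] at hq ⊢
      omega
    · intro j hj
      split_ifs with h <;> simp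
    · intro q hq
      simp only [Finset.mem_filter, Finset.mem_product, Finset.mem_Icc] at hq
      split_ifs with h <;> ext <;> simp only [] <;> omega
    · intro j hj
      split_ifs with h
      · have : (((j + k.natAbs : ℕ) : ℤ) - j) = k := by omega
        simp only [this]
      · have : ((j : ℤ) - ((j + k.natAbs : ℕ) : ℤ)) = k := by omega
        simp only [this, hg j]
  · intro q hq
    simp only [Finset.mem_product, Finset.mem_Icc] at hq ⊢
    omega

/-- Regrouping by lags turns the estimator into a sum over pairs `(i, j)`. Its imaginary part is odd
under the exchange of `i` and `j`, hence zero. -/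
lemma spectralEstimator_eq {Ω : Type*} {p : ℕ} (x : ℕ → Fin p → ℝ) (Y : ℕ → Ω → ℝ)
    (c n : ℕ) (t : ℝ) (ω : Ω) :
    spectralEstimator x Y c n t ω =
      ((1 / (2 * Real.pi * n) * quadForm (lagWindow c t) n (fun i => residual x Y n i ω) : ℝ) : ℂ)
      := by
  have h := sum_diagonals n
    (fun k : ℤ => (kernel (|(k : ℝ)| / (c : ℝ)) : ℂ) * Complex.exp (Complex.I * (k : ℂ) * (t : ℂ)))
    (fun i j => ((residual x Y n i ω * residual x Y n j ω : ℝ) : ℂ)) (fun i j => by rw [mul_comm])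
  have h1 : spectralEstimator x Y c n t ω = (1 / (2 * (Real.pi : ℂ) * n)) *
      ∑ i ∈ Finset.Icc 1 n, ∑ j ∈ Finset.Icc 1 n,
        ((kernel (|(((j : ℤ) - i : ℤ) : ℝ)| / (c : ℝ)) : ℂ) *
          Complex.exp (Complex.I * (((j : ℤ) - i : ℤ) : ℂ) * (t : ℂ))) *
        ((residual x Y n i ω * residual x Y n j ω : ℝ) : ℂ) := by
    rw [h, spectralEstimator, Finset.mul_sum, Finset.mul_sum]
    refine Finset.sum_congr rfl fun k _ => ?_
    rw [residualAutocov]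
    push_cast
    rcases eq_or_ne (n : ℂ) 0 with hn | hn
    · simp [hn]
    · field_simp
  have hsin : ∑ i ∈ Finset.Icc 1 n, ∑ j ∈ Finset.Icc 1 n,
      kernel (|(((j : ℤ) - i : ℤ) : ℝ)| / (c : ℝ)) * Real.sin ((((j : ℤ) - i : ℤ) : ℝ) * t) *
        (residual x Y n i ω * residual x Y n j ω) = 0 := by
    have h2 : ∀ z : ℝ, z = -z → z = 0 := fun z hz => by linarith
    refine h2 _ ?_
    conv_rhs => rw [Finset.sum_comm]
    rw [← Finset.sum_neg_distrib]
    refine Finset.sum_congr rfl fun i _ => ?_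
    rw [← Finset.sum_neg_distrib]
    refine Finset.sum_congr rfl fun j _ => ?_
    have h3 : (((i : ℤ) - j : ℤ) : ℝ) = -(((j : ℤ) - i : ℤ) : ℝ) := by push_cast; ring
    rw [h3, abs_neg, neg_mul, Real.sin_neg]
    ring
  rw [h1]
  have h4 : ∀ i j : ℕ, ((kernel (|(((j : ℤ) - i : ℤ) : ℝ)| / (c : ℝ)) : ℂ) *
          Complex.exp (Complex.I * (((j : ℤ) - i : ℤ) : ℂ) * (t : ℂ))) *
        ((residual x Y n i ω * residual x Y n j ω : ℝ) : ℂ) =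
      ((lagWindow c t ((j : ℤ) - i) * (residual x Y n i ω * residual x Y n j ω) : ℝ) : ℂ) +
      ((kernel (|(((j : ℤ) - i : ℤ) : ℝ)| / (c : ℝ)) * Real.sin ((((j : ℤ) - i : ℤ) : ℝ) * t) *
        (residual x Y n i ω * residual x Y n j ω) : ℝ) : ℂ) * Complex.I := by
    intro i j
    rw [mul_assoc Complex.I, mul_comm Complex.I, Complex.exp_mul_I, lagWindow]
    push_cast
    ring
  simp_rw [h4, Finset.sum_add_distrib, ← Finset.sum_mul, ← Complex.ofReal_sum]
  rw [hsin, quadForm]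
  push_cast
  ring

/-! ### Spectral density, bias and nonnegativity. -/

/-- The spectral density `(2π)⁻¹ ∑ₖ γ(k) cos(kt)` attached to an autocovariance `γ`. -/
def densityOf (γ : ℤ → ℝ) (t : ℝ) : ℝ := 1 / (2 * Real.pi) * ∑' k : ℤ, γ k * Real.cos (k * t)

/-- The mean of a quadratic form in a stationary sequence with autocovariance `γ`. -/
def meanForm (a : ℤ → ℝ) (n : ℕ) (γ : ℤ → ℝ) : ℝ :=
  ∑ i ∈ Finset.Icc 1 n, ∑ j ∈ Finset.Icc 1 n, a ((j : ℤ) - i) * γ ((j : ℤ) - i)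

/-- The factor by which `E f_n` damps the lag `k`. -/
def damping (c n : ℕ) (k : ℤ) : ℝ :=
  if k ∈ Finset.Icc (-((n : ℤ) - 1)) ((n : ℤ) - 1) then
    kernel (|(k : ℝ)| / c) * (((n - k.natAbs : ℕ) : ℝ) / n) else 0

lemma summable_mul_cos {γ : ℤ → ℝ} (hγ : Summable fun k => |γ k|) (t : ℝ) :
    Summable fun k : ℤ => γ k * Real.cos (k * t) := by
  refine Summable.of_norm_bounded hγ fun k => ?_
  rw [Real.norm_eq_abs, abs_mul]
  exact mul_le_of_le_one_right (abs_nonneg _) (Real.abs_cos_le_one _)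

lemma continuous_densityOf {γ : ℤ → ℝ} (hγ : Summable fun k => |γ k|) :
    Continuous (densityOf γ) := by
  refine continuous_const.mul (continuous_tsum (u := fun k => |γ k|) (fun k => by fun_prop) hγ ?_)
  intro k t
  rw [Real.norm_eq_abs, abs_mul]
  exact mul_le_of_le_one_right (abs_nonneg _) (Real.abs_cos_le_one _)

lemma meanForm_lagWindow {n : ℕ} (hn : 0 < n) (c : ℕ) (t : ℝ) (γ : ℤ → ℝ) :
    meanForm (lagWindow c t) n γ = n * ∑' k : ℤ, damping c n k * (γ k * Real.cos (k * t)) := by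
  have hn' : (n : ℝ) ≠ 0 := by exact_mod_cast hn.ne'
  have h := sum_diagonals n (fun k => lagWindow c t k * γ k) (fun _ _ => 1) (fun _ _ => rfl)
  simp only [mul_one, Finset.sum_const, Nat.card_Icc, nsmul_eq_mul] at h
  rw [meanForm, h, tsum_eq_sum (s := Finset.Icc (-((n : ℤ) - 1)) ((n : ℤ) - 1)), Finset.mul_sum]
  · refine Finset.sum_congr rfl fun k hk => ?_
    rw [damping, if_pos hk, lagWindow, Nat.add_sub_cancel]
    field_simp
  · intro k hk
    rw [damping, if_neg hk, zero_mul]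

lemma abs_damping_le_one (c n : ℕ) (k : ℤ) : |damping c n k| ≤ 1 := by
  unfold damping
  split_ifs with h
  · rw [abs_mul]
    refine mul_le_one₀ (abs_kernel_le_one _) (abs_nonneg _) ?_
    rw [abs_of_nonneg (by positivity)]
    refine div_le_one_of_le₀ ?_ (by positivity)
    exact_mod_cast Nat.sub_le _ _
  · simp

lemma tendsto_damping {c : ℕ → ℕ} (hc : Tendsto c atTop atTop) (k : ℤ) :
    Tendsto (fun n => damping (c n) n k) atTop (𝓝 1) := by
  have h1 : ∀ᶠ n : ℕ in atTop, 1 - (k.natAbs : ℝ) / n = damping (c n) n k := by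
    filter_upwards [hc.eventually_ge_atTop k.natAbs, eventually_gt_atTop k.natAbs,
      hc.eventually_gt_atTop 0] with n h1 h2 h3
    have h3' : (0 : ℝ) < c n := by exact_mod_cast h3
    have h1' : |(k : ℝ)| ≤ c n := by
      rw [← Int.cast_abs, Int.abs_eq_natAbs]; exact_mod_cast h1
    have hn : (n : ℝ) ≠ 0 := by
      have : 0 < n := by omega
      exact_mod_cast this.ne'
    rw [damping, if_pos (by rw [Finset.mem_Icc]; omega), kernel, if_pos, Nat.cast_sub h2.le]
    · field_simp
    · rw [abs_of_nonneg (by positivity)]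
      exact div_le_one_of_le₀ h1' h3'.le
  refine Tendsto.congr' h1 ?_
  have := (tendsto_const_div_atTop_nhds_zero_nat (k.natAbs : ℝ)).const_sub 1
  simpa using this

/-- Dominated convergence with bound `2|γ(k)|`. The frequency does not appear, so this controls the
bias uniformly in `t`. -/
lemma tendsto_bias {γ : ℤ → ℝ} (hγ : Summable fun k => |γ k|) {c : ℕ → ℕ}
    (hc : Tendsto c atTop atTop) :
    Tendsto (fun n => ∑' k : ℤ, |damping (c n) n k - 1| * |γ k|) atTop (𝓝 0) := by
  have h := tendsto_tsum_of_dominated_convergence (𝓕 := atTop)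
    (f := fun n k => |damping (c n) n k - 1| * |γ k|) (g := fun _ => 0)
    (bound := fun k => 2 * |γ k|) (hγ.mul_left 2) ?_ ?_
  · simpa using h
  · intro k
    have := ((tendsto_damping hc k).sub_const 1).abs.mul_const |γ k|
    simpa using this
  · refine Eventually.of_forall fun n k => ?_
    rw [Real.norm_eq_abs, abs_mul, abs_abs, abs_abs]
    refine mul_le_mul_of_nonneg_right ?_ (abs_nonneg _)
    refine (abs_sub _ _).trans ?_
    rw [abs_one]
    linarith [abs_damping_le_one (c n) n k]

lemma abs_meanForm_sub_le {γ : ℤ → ℝ} (hγ : Summable fun k => |γ k|) {n : ℕ} (hn : 0 < n)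
    (c : ℕ) (t : ℝ) :
    |meanForm (lagWindow c t) n γ - 2 * Real.pi * n * densityOf γ t| ≤
      n * ∑' k : ℤ, |damping c n k - 1| * |γ k| := by
  have hb : ∀ k, ‖damping c n k * (γ k * Real.cos (k * t))‖ ≤ |γ k| := by
    intro k
    rw [Real.norm_eq_abs, abs_mul, abs_mul]
    have h1 := abs_damping_le_one c n k
    have h2 := Real.abs_cos_le_one (k * t)
    calc _ ≤ 1 * (|γ k| * 1) := by gcongr
      _ = _ := by ring
  have hs : Summable fun k : ℤ => damping c n k * (γ k * Real.cos (k * t)) :=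
    Summable.of_norm_bounded hγ hb
  have hs2 : Summable fun k : ℤ => |damping c n k - 1| * |γ k| := by
    refine Summable.of_norm_bounded (hγ.mul_left 2) fun k => ?_
    rw [Real.norm_eq_abs, abs_mul, abs_abs, abs_abs]
    refine mul_le_mul_of_nonneg_right ?_ (abs_nonneg _)
    refine (abs_sub _ _).trans ?_
    rw [abs_one]
    linarith [abs_damping_le_one c n k]
  have h0 : 2 * Real.pi * n * densityOf γ t = n * ∑' k : ℤ, γ k * Real.cos (k * t) := by
    have := Real.pi_ne_zero
    rw [densityOf]
    generalize ∑' k : ℤ, γ k * Real.cos (k * t) = S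
    field_simp
  rw [h0, meanForm_lagWindow hn, ← mul_sub, ← hs.tsum_sub (summable_mul_cos hγ t), abs_mul,
    abs_of_nonneg (Nat.cast_nonneg n)]
  refine mul_le_mul_of_nonneg_left ?_ (Nat.cast_nonneg n)
  have hle : ∀ k : ℤ, ‖damping c n k * (γ k * Real.cos (k * t)) - γ k * Real.cos (k * t)‖ ≤
      |damping c n k - 1| * |γ k| := by
    intro k
    rw [← sub_one_mul, Real.norm_eq_abs, abs_mul, abs_mul]
    exact mul_le_mul_of_nonneg_left (mul_le_of_le_one_right (abs_nonneg _)
      (Real.abs_cos_le_one _)) (abs_nonneg _)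
  have h1 : Summable fun k : ℤ =>
      ‖damping c n k * (γ k * Real.cos (k * t)) - γ k * Real.cos (k * t)‖ :=
    Summable.of_nonneg_of_le (fun _ => norm_nonneg _) hle hs2
  rw [← Real.norm_eq_abs]
  exact (norm_tsum_le_tsum_norm h1).trans (h1.tsum_le_tsum hle hs2)

/-- With bandwidth `n` the kernel equals `1` at every lag met by a sample of size `n`, so the mean
form is that of a periodogram, nonnegative by positive semidefiniteness of `γ`. After division by
`n` it converges to `2πf(t)`. -/
lemma densityOf_nonneg {γ : ℤ → ℝ} (hγ : Summable fun k => |γ k|)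
    (hpos : ∀ (n : ℕ) (b : ℕ → ℝ),
      0 ≤ ∑ i ∈ Finset.Icc 1 n, ∑ j ∈ Finset.Icc 1 n, b i * b j * γ ((j : ℤ) - i)) (t : ℝ) :
    0 ≤ densityOf γ t := by
  have h1 : ∀ n : ℕ, 0 < n → 0 ≤ meanForm (lagWindow n t) n γ := by
    intro n hn
    have hn' : (0 : ℝ) < n := by exact_mod_cast hn
    have h : meanForm (lagWindow n t) n γ =
        ∑ i ∈ Finset.Icc 1 n, ∑ j ∈ Finset.Icc 1 n,
          Real.cos (i * t) * Real.cos (j * t) * γ ((j : ℤ) - i) +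
        ∑ i ∈ Finset.Icc 1 n, ∑ j ∈ Finset.Icc 1 n,
          Real.sin (i * t) * Real.sin (j * t) * γ ((j : ℤ) - i) := by
      simp only [meanForm, ← Finset.sum_add_distrib]
      refine Finset.sum_congr rfl fun i hi => Finset.sum_congr rfl fun j hj => ?_
      rw [Finset.mem_Icc] at hi hj
      have hle : |(((j : ℤ) - i : ℤ) : ℝ)| ≤ n := by
        have : |(j : ℤ) - i| ≤ n := by rw [abs_le]; omega
        exact_mod_cast this
      rw [lagWindow, kernel, if_pos]
      · push_cast
        rw [sub_mul, Real.cos_sub]; ring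
      · rw [abs_of_nonneg (by positivity)]
        exact div_le_one_of_le₀ hle hn'.le
    rw [h]
    exact add_nonneg (hpos n _) (hpos n _)
  have h2 : ∀ᶠ n : ℕ in atTop, -(2 * Real.pi * densityOf γ t) ≤
      ∑' k : ℤ, |damping n n k - 1| * |γ k| := by
    filter_upwards [eventually_gt_atTop 0] with n hn
    have hn' : (0 : ℝ) < n := by exact_mod_cast hn
    have h3 := (abs_le.1 (abs_meanForm_sub_le hγ hn n t)).2
    have h4 := h1 n hn
    refine le_of_mul_le_mul_left ?_ hn'
    linarith
  have h3 := le_of_tendsto_of_tendsto tendsto_const_nhds (tendsto_bias hγ tendsto_id) h2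
  have := Real.pi_pos
  nlinarith

/-! ### Fourier coefficients and uniqueness of the density. -/

lemma integral_exp_int (k : ℤ) :
    ∫ t in (-Real.pi)..Real.pi, Complex.exp (Complex.I * (k : ℂ) * (t : ℂ)) =
      if k = 0 then 2 * (Real.pi : ℂ) else 0 := by
  split_ifs with h
  · simp only [h, Int.cast_zero, mul_zero, zero_mul, Complex.exp_zero]
    rw [intervalIntegral.integral_const, Complex.real_smul]
    push_cast; ring
  · have hk : Complex.I * (k : ℂ) ≠ 0 := mul_ne_zero Complex.I_ne_zero (by exact_mod_cast h)
    rw [integral_exp_mul_complex hk, div_eq_zero_iff, sub_eq_zero]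
    left
    rw [Complex.exp_eq_exp_iff_exists_int]
    exact ⟨k, by push_cast; ring⟩

lemma integral_exp_mul_cos (k m : ℤ) :
    ∫ t in (-Real.pi)..Real.pi,
      Complex.exp (Complex.I * (k : ℂ) * (t : ℂ)) * ((Real.cos (m * t) : ℝ) : ℂ) =
      (if m = -k then (Real.pi : ℂ) else 0) + if m = k then (Real.pi : ℂ) else 0 := by
  have h : ∀ t : ℝ, Complex.exp (Complex.I * (k : ℂ) * (t : ℂ)) * ((Real.cos (m * t) : ℝ) : ℂ) =
      1 / 2 * Complex.exp (Complex.I * ((k + m : ℤ) : ℂ) * (t : ℂ)) +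
      1 / 2 * Complex.exp (Complex.I * ((k - m : ℤ) : ℂ) * (t : ℂ)) := by
    intro t
    push_cast
    rw [Complex.cos]
    have e1 : Complex.I * (k + m : ℂ) * t = Complex.I * k * t + m * t * Complex.I := by ring
    have e2 : Complex.I * (k - m : ℂ) * t = Complex.I * k * t + -(m * t) * Complex.I := by ring
    rw [e1, e2, Complex.exp_add, Complex.exp_add]
    ring
  simp_rw [h]
  rw [intervalIntegral.integral_add, intervalIntegral.integral_const_mul,
    intervalIntegral.integral_const_mul, integral_exp_int, integral_exp_int]
  · have e1 : (k + m = 0) ↔ m = -k := by omega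
    have e2 : (k - m = 0) ↔ m = k := by omega
    simp only [e1, e2]
    split_ifs <;> ring
  · exact Continuous.intervalIntegrable (by fun_prop) _ _
  · exact Continuous.intervalIntegrable (by fun_prop) _ _

/-- Termwise integration leaves the lags `m = k` and `m = -k`, each with `γ(k) / 2` by evenness. For
`k = 0` the two coincide and both halves fall on the same term. -/
lemma integral_exp_mul_densityOf {γ : ℤ → ℝ} (hγ : Summable fun k => |γ k|)
    (heven : ∀ k, γ (-k) = γ k) (k : ℤ) :
    ∫ t in (-Real.pi)..Real.pi,
      Complex.exp (Complex.I * (k : ℂ) * (t : ℂ)) * ((densityOf γ t : ℝ) : ℂ) = (γ k : ℂ) := by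
  have h := intervalIntegral.hasSum_integral_of_dominated_convergence
    (μ := volume) (a := -Real.pi) (b := Real.pi)
    (F := fun (m : ℤ) (t : ℝ) => (γ m / (2 * Real.pi) : ℂ) *
      (Complex.exp (Complex.I * (k : ℂ) * (t : ℂ)) * ((Real.cos (m * t) : ℝ) : ℂ)))
    (f := fun t => Complex.exp (Complex.I * (k : ℂ) * (t : ℂ)) * ((densityOf γ t : ℝ) : ℂ))
    (fun m _ => |γ m|) (fun m => (by fun_prop : Continuous _).aestronglyMeasurable) ?_
    (Eventually.of_forall fun t _ => hγ) (by simp) ?_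
  · refine h.unique ?_
    have h2 : ∀ m : ℤ, ∫ t in (-Real.pi)..Real.pi, (γ m / (2 * Real.pi) : ℂ) *
        (Complex.exp (Complex.I * (k : ℂ) * (t : ℂ)) * ((Real.cos (m * t) : ℝ) : ℂ)) =
        (if m = -k then (γ k / 2 : ℂ) else 0) + if m = k then (γ k / 2 : ℂ) else 0 := by
      intro m
      have hpi : (Real.pi : ℂ) ≠ 0 := by exact_mod_cast Real.pi_ne_zero
      rw [intervalIntegral.integral_const_mul, integral_exp_mul_cos, mul_add]
      congr 1
      · split_ifs with hm
        · rw [hm, heven]; field_simp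
        · simp
      · split_ifs with hm
        · rw [hm]; field_simp
        · simp
    simp_rw [h2]
    have h3 := (hasSum_ite_eq (-k) (γ k / 2 : ℂ)).add (hasSum_ite_eq k (γ k / 2 : ℂ))
    rwa [add_halves] at h3
  · refine fun m => Eventually.of_forall fun t _ => ?_
    have e2 : (γ m / (2 * Real.pi) : ℂ) = ((γ m / (2 * Real.pi) : ℝ) : ℂ) := by push_cast; ring
    rw [show Complex.I * (k : ℂ) * (t : ℂ) = ((t * k : ℝ) : ℂ) * Complex.I by push_cast; ring]
    rw [norm_mul, norm_mul, Complex.norm_exp_ofReal_mul_I, one_mul, e2, Complex.norm_real, Complex.norm_real,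
      Real.norm_eq_abs, Real.norm_eq_abs, abs_div]
    have hpi : 1 ≤ |2 * Real.pi| := by
      rw [abs_of_pos Real.two_pi_pos]; linarith [Real.pi_gt_three]
    calc _ ≤ |γ m| / 1 * 1 := by
          gcongr
          exact Real.abs_cos_le_one _
      _ = _ := by ring
  · refine Eventually.of_forall fun t _ => ?_
    have h3 := ((summable_mul_cos hγ t).hasSum.mul_left (1 / (2 * Real.pi)))
    have h4 : HasSum (fun m : ℤ => ((1 / (2 * Real.pi) * (γ m * Real.cos (m * t)) : ℝ) : ℂ))
        ((densityOf γ t : ℝ) : ℂ) := by exact_mod_cast h3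
    refine (h4.mul_left (Complex.exp (Complex.I * (k : ℂ) * (t : ℂ)))).congr_fun ?_
    intro m
    push_cast
    ring

/-- Continuous functions on `[-π, π]` are determined by their Fourier coefficients. -/
lemma eqOn_of_integral_exp_eq {f g : ℝ → ℝ}
    (hf : ContinuousOn f (Set.Icc (-Real.pi) Real.pi))
    (hg : ContinuousOn g (Set.Icc (-Real.pi) Real.pi))
    (h : ∀ k : ℤ,
      ∫ t in (-Real.pi)..Real.pi, Complex.exp (Complex.I * (k : ℂ) * (t : ℂ)) * (f t : ℂ) =
      ∫ t in (-Real.pi)..Real.pi, Complex.exp (Complex.I * (k : ℂ) * (t : ℂ)) * (g t : ℂ)) :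
    Set.EqOn f g (Set.Icc (-Real.pi) Real.pi) := by
  have hlt : -Real.pi < Real.pi := by linarith [Real.pi_pos]
  set d : ℝ → ℂ := fun t => ((f t - g t : ℝ) : ℂ) with hd
  have hdc : ContinuousOn d (Set.Icc (-Real.pi) Real.pi) :=
    Complex.continuous_ofReal.comp_continuousOn (hf.sub hg)
  have hint : ∀ (φ : ℝ → ℝ), ContinuousOn φ (Set.Icc (-Real.pi) Real.pi) → ∀ k : ℤ,
      IntervalIntegrable (fun t : ℝ => Complex.exp (Complex.I * (k : ℂ) * (t : ℂ)) * (φ t : ℂ))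
        volume (-Real.pi) Real.pi := by
    intro φ hφ k
    refine ContinuousOn.intervalIntegrable ?_
    rw [Set.uIcc_of_le hlt.le]
    exact (by fun_prop : Continuous _).continuousOn.mul
      (Complex.continuous_ofReal.comp_continuousOn hφ)
  have h0 : ∀ k : ℤ,
      ∫ t in (-Real.pi)..Real.pi, Complex.exp (Complex.I * (k : ℂ) * (t : ℂ)) * d t = 0 := by
    intro k
    have e : ∀ t : ℝ, Complex.exp (Complex.I * (k : ℂ) * (t : ℂ)) * d t =
        Complex.exp (Complex.I * (k : ℂ) * (t : ℂ)) * (f t : ℂ) -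
        Complex.exp (Complex.I * (k : ℂ) * (t : ℂ)) * (g t : ℂ) := by
      intro t; simp only [hd]; push_cast; ring
    simp_rw [e]
    rw [intervalIntegral.integral_sub (hint f hf k) (hint g hg k), h k, sub_self]
  have hL2 : MemLp d 2 (volume.restrict (Set.Ioc (-Real.pi) Real.pi)) := by
    have : MemLp d 2 (volume.restrict (Set.Icc (-Real.pi) Real.pi)) := by
      obtain ⟨C, hC⟩ := isCompact_Icc.exists_bound_of_continuousOn hdc
      refine MemLp.of_bound (hdc.aestronglyMeasurable measurableSet_Icc) C ?_
      exact (ae_restrict_iff' measurableSet_Icc).2 (Eventually.of_forall hC)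
    exact this.mono_measure (Measure.restrict_mono Set.Ioc_subset_Icc_self le_rfl)
  -- Parseval: all Fourier coefficients of the difference vanish, hence so does its `L²` norm, and
  -- continuity upgrades almost everywhere equality to equality on the closed interval.
  have hsum := hasSum_sq_fourierCoeffOn hlt hL2
  have hco : ∀ i : ℤ, fourierCoeffOn hlt d i = 0 := by
    intro i
    rw [fourierCoeffOn_eq_integral]
    have : ∫ t in (-Real.pi)..Real.pi, fourier (-i) (t : AddCircle (Real.pi - -Real.pi)) • d t =
        ∫ t in (-Real.pi)..Real.pi, Complex.exp (Complex.I * ((-i : ℤ) : ℂ) * (t : ℂ)) * d t := by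
      refine intervalIntegral.integral_congr fun t _ => ?_
      simp only [smul_eq_mul]
      rw [fourier_coe_apply]
      congr 2
      have hpi : (Real.pi : ℂ) ≠ 0 := by exact_mod_cast Real.pi_ne_zero
      push_cast
      field_simp
      ring
    rw [this, h0, smul_zero]
  simp only [hco, norm_zero, ne_eq, OfNat.ofNat_ne_zero, not_false_eq_true, zero_pow] at hsum
  have hz := hsum.unique hasSum_zero
  have hz' : ∫ t in (-Real.pi)..Real.pi, ‖d t‖ ^ 2 = 0 := by
    rw [smul_eq_mul, mul_eq_zero] at hz
    refine hz.resolve_left (inv_ne_zero ?_)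
    linarith
  rw [intervalIntegral.integral_of_le hlt.le, ← integral_Icc_eq_integral_Ioc,
    setIntegral_eq_zero_iff_of_nonneg_ae (Eventually.of_forall fun t => by positivity)] at hz'
  · refine Measure.eqOn_Icc_of_ae_eq volume hlt.ne ?_ hf hg
    filter_upwards [hz'] with t ht
    have : d t = 0 := by simpa using ht
    have h2 : f t - g t = 0 := Complex.ofReal_eq_zero.1 this
    linarith
  · exact ((hdc.norm.pow 2).integrableOn_Icc)

/-! ### Shifts of variables and σ-algebras. -/

section Shift

variable {Ω : Type*} {F₀ : MeasurableSpace Ω}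

lemma process_process (S : Equiv.Perm Ω) (Z : Ω → ℝ) (i j : ℤ) :
    process S (process S Z i) j = process S Z (i + j) := by
  ext ω
  simp only [process, zpow_add, Equiv.Perm.mul_apply]

lemma process_zero (S : Equiv.Perm Ω) (Z : Ω → ℝ) : process S Z 0 = Z := by
  ext ω; simp [process]

lemma filt_zero (S : Equiv.Perm Ω) : filt F₀ S 0 = F₀ := by
  simp only [filt, zpow_zero, Equiv.Perm.coe_one]
  exact MeasurableSpace.comap_id

lemma filt_comap (S : Equiv.Perm Ω) (i j : ℤ) :
    (filt F₀ S i).comap (fun ω => (S ^ j) ω) = filt F₀ S (i + j) := by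
  rw [filt, MeasurableSpace.comap_comp, filt]
  congr 1
  ext ω
  simp only [zpow_add, Equiv.Perm.mul_apply, Function.comp]

lemma stronglyMeasurable_process (S : Equiv.Perm Ω) {Z : Ω → ℝ} {i : ℤ}
    (hZ : StronglyMeasurable[filt F₀ S i] Z) (j : ℤ) :
    StronglyMeasurable[filt F₀ S (i + j)] (process S Z j) := by
  rw [← filt_comap]
  exact hZ.comp_measurable (comap_measurable _)

end Shift

/-- A square integrable `ℱ₀`-measurable variable whose conditional expectation given the strict
past `ℱ₋₁` vanishes. -/
structure IsInnovation {Ω : Type*} (F₀ : MeasurableSpace Ω) [MeasurableSpace Ω]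
    (S : Equiv.Perm Ω) (μ : Measure Ω) (D : Ω → ℝ) : Prop where
  measurable : StronglyMeasurable[F₀] D
  memLp : MemLp D 2 μ
  condExp : μ[D | filt F₀ S (-1)] =ᵐ[μ] 0

/-! ### Stationarity, orthogonality of innovations, trivial tail. -/

section Stationary

variable {Ω : Type*} {F₀ : MeasurableSpace Ω} [mΩ : MeasurableSpace Ω]
  {μ : Measure Ω} {T : Ω ≃ᵐ Ω}

lemma measurePreserving_zpow (hT : MeasurePreserving T μ μ) (i : ℤ) :
    MeasurePreserving (fun ω => (T.toEquiv ^ i) ω) μ μ := by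
  have h1 : ∀ n : ℕ, MeasurePreserving (fun ω => (T.toEquiv ^ n) ω) μ μ := by
    intro n
    induction n with
    | zero => exact MeasurePreserving.id μ
    | succ n ih =>
      have := ih.comp hT
      rw [pow_succ]
      exact this
  have h2 : ∀ n : ℕ, MeasurePreserving (fun ω => ((T.toEquiv⁻¹) ^ n) ω) μ μ := by
    intro n
    induction n with
    | zero => exact MeasurePreserving.id μ
    | succ n ih =>
      have := ih.comp (hT.symm T)
      rw [pow_succ]
      exact this
  obtain ⟨n, rfl | rfl⟩ := i.eq_nat_or_neg
  · exact_mod_cast h1 n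
  · rw [zpow_neg, zpow_natCast, ← inv_pow]
    exact h2 n

lemma measurableEmbedding_zpow (hT : MeasurePreserving T μ μ) (i : ℤ) :
    MeasurableEmbedding (fun ω => (T.toEquiv ^ i) ω) := by
  have h : (fun ω => (T.toEquiv ^ i).symm ω) = fun ω => (T.toEquiv ^ (-i)) ω := by
    rw [zpow_neg]; rfl
  exact (MeasurableEquiv.mk (T.toEquiv ^ i) (measurePreserving_zpow hT i).measurable
    (by change Measurable fun ω => (T.toEquiv ^ i).symm ω
        rw [h]; exact (measurePreserving_zpow hT (-i)).measurable)).measurableEmbedding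

lemma integral_process (hT : MeasurePreserving T μ μ) (Z : Ω → ℝ) (i : ℤ) :
    ∫ ω, process T.toEquiv Z i ω ∂μ = ∫ ω, Z ω ∂μ :=
  (measurePreserving_zpow hT i).integral_comp (measurableEmbedding_zpow hT i) Z

lemma memLp_process (hT : MeasurePreserving T μ μ) {Z : Ω → ℝ} {q : ENNReal} (hZ : MemLp Z q μ)
    (i : ℤ) : MemLp (process T.toEquiv Z i) q μ :=
  hZ.comp_measurePreserving (measurePreserving_zpow hT i)

lemma ae_process (hT : MeasurePreserving T μ μ) {P : ℝ → Prop} {Z : Ω → ℝ}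
    (hZ : ∀ᵐ ω ∂μ, P (Z ω)) (i : ℤ) : ∀ᵐ ω ∂μ, P (process T.toEquiv Z i ω) :=
  (measurePreserving_zpow hT i).quasiMeasurePreserving.ae hZ

lemma filt_le (hT : MeasurePreserving T μ μ) (hF₀ : F₀ ≤ mΩ) (i : ℤ) :
    filt F₀ T.toEquiv i ≤ mΩ :=
  (MeasurableSpace.comap_mono hF₀).trans (measurePreserving_zpow hT i).measurable.comap_le

lemma filt_mono (hmono : F₀ ≤ F₀.comap T) : Monotone (filt F₀ T.toEquiv) := by
  refine monotone_int_of_le_succ fun i => ?_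
  have h : F₀ ≤ filt F₀ T.toEquiv 1 := by
    rw [filt, zpow_one]; exact hmono
  rw [add_comm, ← filt_comap]
  exact MeasurableSpace.comap_mono h

/-- The sets of `filt F₀ T.toEquiv (i + j)` are exactly the preimages under `T ^ j` of those of
`filt F₀ T.toEquiv i`, so the change of variables by `T ^ j` checks the defining property of the
conditional expectation on the right. -/
lemma condExp_process [IsFiniteMeasure μ] (hT : MeasurePreserving T μ μ) (hF₀ : F₀ ≤ mΩ)
    {Z : Ω → ℝ} (hZ : Integrable Z μ) (i j : ℤ) :
    process T.toEquiv (μ[Z | filt F₀ T.toEquiv i]) j =ᵐ[μ]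
      μ[process T.toEquiv Z j | filt F₀ T.toEquiv (i + j)] := by
  have hmp := measurePreserving_zpow hT j
  have hint : ∀ {W : Ω → ℝ}, Integrable W μ → Integrable (process T.toEquiv W j) μ :=
    fun hW => hmp.integrable_comp_of_integrable hW
  refine ae_eq_condExp_of_forall_setIntegral_eq (filt_le hT hF₀ _) (hint hZ)
    (fun s _ _ => (hint integrable_condExp).integrableOn) ?_
    (stronglyMeasurable_process _ stronglyMeasurable_condExp j).aestronglyMeasurable
  intro s hs _
  rw [← filt_comap] at hs
  obtain ⟨s', hs', rfl⟩ := hs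
  have e1 := hmp.setIntegral_preimage_emb (measurableEmbedding_zpow hT j)
    (μ[Z | filt F₀ T.toEquiv i]) s'
  have e2 := hmp.setIntegral_preimage_emb (measurableEmbedding_zpow hT j) Z s'
  unfold process
  rw [e1, e2, setIntegral_condExp (filt_le hT hF₀ _) hZ hs']

lemma IsInnovation.stronglyMeasurable_process {D : Ω → ℝ} (hD : IsInnovation F₀ T.toEquiv μ D) (i : ℤ) :
    StronglyMeasurable[filt F₀ T.toEquiv i] (process T.toEquiv D i) := by
  have := HannanRegression.stronglyMeasurable_process (F₀ := F₀) T.toEquiv (i := 0)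
    (by rw [filt_zero]; exact hD.measurable) i
  rwa [zero_add] at this

/-- Shifting by `T ^ (-b)` makes `g` measurable with respect to `ℱ₋₁`; it can then be pulled out of
the conditional expectation of `D`, which is zero. All martingale computations below rest on this.
-/
lemma IsInnovation.integral_mul_process [IsFiniteMeasure μ] (hT : MeasurePreserving T μ μ)
    (hF₀ : F₀ ≤ mΩ) {D : Ω → ℝ} (hD : IsInnovation F₀ T.toEquiv μ D) {b : ℤ} {g : Ω → ℝ}
    (hg : StronglyMeasurable[filt F₀ T.toEquiv (b - 1)] g) (hg2 : MemLp g 2 μ) :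
    ∫ ω, g ω * process T.toEquiv D b ω ∂μ = 0 := by
  set h := process T.toEquiv g (-b) with hh
  have hgh : g = process T.toEquiv h b := by
    rw [hh, process_process, neg_add_cancel, process_zero]
  have hm : StronglyMeasurable[filt F₀ T.toEquiv (-1)] h := by
    have := HannanRegression.stronglyMeasurable_process T.toEquiv hg (-b)
    rwa [show b - 1 + -b = (-1 : ℤ) by ring] at this
  have hL : MemLp h 2 μ := memLp_process hT hg2 _
  calc ∫ ω, g ω * process T.toEquiv D b ω ∂μ = ∫ ω, process T.toEquiv (h * D) b ω ∂μ := by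
        rw [hgh]; rfl
    _ = ∫ ω, (h * D) ω ∂μ := integral_process hT _ _
    _ = ∫ ω, (μ[h * D | filt F₀ T.toEquiv (-1)]) ω ∂μ := (integral_condExp (filt_le hT hF₀ _)).symm
    _ = ∫ _, (0 : ℝ) ∂μ := by
        refine integral_congr_ae ?_
        filter_upwards [condExp_mul_of_stronglyMeasurable_left hm (hL.integrable_mul hD.memLp)
          (hD.memLp.integrable (by norm_num)), hD.condExp] with ω h1 h2
        rw [h1, Pi.mul_apply, h2]; simp
    _ = 0 := by simp

lemma IsInnovation.orthogonal [IsFiniteMeasure μ] (hT : MeasurePreserving T μ μ)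
    (hF₀ : F₀ ≤ mΩ) (hmono : F₀ ≤ F₀.comap T) {D E : Ω → ℝ} (hD : IsInnovation F₀ T.toEquiv μ D)
    (hE : IsInnovation F₀ T.toEquiv μ E) {a b : ℤ} (hab : a ≠ b) :
    ∫ ω, process T.toEquiv D a ω * process T.toEquiv E b ω ∂μ = 0 := by
  rcases lt_or_gt_of_ne hab with h | h
  · exact hE.integral_mul_process hT hF₀
      ((hD.stronglyMeasurable_process a).mono (filt_mono hmono (by omega))) (memLp_process hT hD.memLp a)
  · simp_rw [mul_comm (process T.toEquiv D a _)]
    exact hD.integral_mul_process hT hF₀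
      ((hE.stronglyMeasurable_process b).mono (filt_mono hmono (by omega))) (memLp_process hT hE.memLp b)

/-- An `L¹` limit of variables measurable with respect to the more and more remote past is constant
when the remote past is trivial. -/
lemma ae_eq_const_of_tendsto_tail [IsProbabilityMeasure μ] (hT : MeasurePreserving T μ μ)
    (hF₀ : F₀ ≤ mΩ) (hmono : F₀ ≤ F₀.comap T)
    (htail : ∀ s : Set Ω, MeasurableSet[⨅ i : ℤ, filt F₀ T.toEquiv i] s → μ s = 0 ∨ μ s = 1)
    {g : ℕ → Ω → ℝ} (hg : ∀ n : ℕ, StronglyMeasurable[filt F₀ T.toEquiv (-(n : ℤ))] (g n))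
    {W : Ω → ℝ} (hW : Integrable W μ)
    (hlim : Tendsto (fun n => eLpNorm (g n - W) 1 μ) atTop (𝓝 0)) :
    W =ᵐ[μ] fun _ => ∫ ω, W ω ∂μ := by
  have hle : (⨅ i : ℤ, filt F₀ T.toEquiv i) ≤ mΩ := (iInf_le _ 0).trans (filt_le hT hF₀ 0)
  have hmeas : TendstoInMeasure μ g atTop W :=
    tendstoInMeasure_of_tendsto_eLpNorm one_ne_zero
      (fun n => ((hg n).mono (filt_le hT hF₀ _)).aestronglyMeasurable)
      hW.aestronglyMeasurable hlim
  obtain ⟨ns, hns, hae⟩ := hmeas.exists_seq_tendsto_ae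
  -- The limsup does not change when its first `|i|` terms are dropped, and the remaining ones are
  -- measurable with respect to `ℱ i`. Hence `w` is measurable with respect to the whole tail.
  set w : Ω → ℝ := fun ω => limsup (fun k => g (ns k) ω) atTop with hw
  have hWw : W =ᵐ[μ] w := by
    filter_upwards [hae] with ω hω
    exact hω.limsup_eq.symm
  have hwm : Measurable[⨅ i : ℤ, filt F₀ T.toEquiv i] w := by
    intro s hs
    rw [MeasurableSpace.measurableSet_iInf]
    intro i
    have : w = fun ω => limsup (fun k => g (ns (k + i.natAbs)) ω) atTop := by
      ext ω
      exact (limsup_nat_add (fun k => g (ns k) ω) i.natAbs).symm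
    rw [this]
    refine Measurable.limsup (δ := Ω) (mδ := filt F₀ T.toEquiv i) ?_ hs
    intro k
    refine ((hg _).mono (filt_mono hmono ?_)).measurable
    have := hns.id_le (k + i.natAbs)
    simp only [id] at this
    omega
  -- A σ-algebra satisfying a zero-one law is independent of itself, so the conditional expectation
  -- of `w` given the tail is both `w` and its mean.
  have hind : Indep (⨅ i : ℤ, filt F₀ T.toEquiv i) (⨅ i : ℤ, filt F₀ T.toEquiv i) μ := by
    rw [Indep_iff]
    intro s t hs ht
    rcases htail s hs with h | h
    · rw [h, zero_mul]
      exact measure_mono_null Set.inter_subset_left h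
    · rw [h, one_mul, Set.inter_comm]
      refine measure_inter_conull ?_
      rw [prob_compl_eq_zero_iff (hle s hs)]; exact h
  have h1 := condExp_indep_eq hle hle hwm.stronglyMeasurable hind
  rw [condExp_of_stronglyMeasurable hle hwm.stronglyMeasurable (hW.congr hWw)] at h1
  refine hWw.trans (h1.trans ?_)
  rw [integral_congr_ae hWw]

end Stationary

/-! ### Conditional expectations given the remote past and the far future. -/

section Past

variable {Ω : Type*} {F₀ : MeasurableSpace Ω} [mΩ : MeasurableSpace Ω]
  {μ : Measure Ω} {T : Ω ≃ᵐ Ω}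

lemma tendsto_eLpNorm_one_of_two [IsProbabilityMeasure μ] {g : ℕ → Ω → ℝ} {W : Ω → ℝ}
    (hg : ∀ n, AEStronglyMeasurable (g n) μ) (hW : AEStronglyMeasurable W μ)
    (h : Tendsto (fun n => eLpNorm (g n - W) 2 μ) atTop (𝓝 0)) :
    Tendsto (fun n => eLpNorm (g n - W) 1 μ) atTop (𝓝 0) :=
  tendsto_of_tendsto_of_tendsto_of_le_of_le tendsto_const_nhds h (fun _ => zero_le)
    (fun n => eLpNorm_le_eLpNorm_of_exponent_le (by norm_num) ((hg n).sub hW))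

/-- Conditional expectations given a decreasing sequence of σ-algebras converge in `L²`. -/
lemma exists_tendsto_condExp_of_antitone [IsProbabilityMeasure μ] {G : ℕ → MeasurableSpace Ω}
    (hG : ∀ n, G n ≤ mΩ) (hanti : Antitone G) {g : Ω → ℝ} (hg : MemLp g 2 μ) :
    ∃ W : Lp ℝ 2 μ, Tendsto (fun n => eLpNorm (μ[g | G n] - (W : Ω → ℝ)) 2 μ) atTop (𝓝 0) := by
  have : ∀ n, Fact (G n ≤ mΩ) := fun n => ⟨hG n⟩
  -- The subspaces decrease but their orthogonal complements increase, and projections on an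
  -- increasing family converge strongly; the projection on each subspace is the identity minus that
  -- on its complement.
  have hU : Monotone fun n => (lpMeas ℝ ℝ (G n) 2 μ)ᗮ := by
    intro a b hab
    refine Submodule.orthogonal_le fun f hf => ?_
    rw [mem_lpMeas_iff_aestronglyMeasurable] at hf ⊢
    exact hf.mono (hanti hab)
  have h := Submodule.starProjection_tendsto_closure_iSup _ hU (hg.toLp g)
  refine ⟨hg.toLp g - (⨆ n, (lpMeas ℝ ℝ (G n) 2 μ)ᗮ).topologicalClosure.starProjection
    (hg.toLp g), ?_⟩
  have h2 := (Lp.tendsto_Lp_iff_tendsto_eLpNorm' _ _).1 (h.const_sub (hg.toLp g))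
  refine h2.congr fun n => eLpNorm_congr_ae ?_
  refine EventuallyEq.sub ?_ EventuallyEq.rfl
  have h3 : hg.toLp g - (lpMeas ℝ ℝ (G n) 2 μ)ᗮ.starProjection (hg.toLp g) =
      (condExpL2 ℝ ℝ (hG n) (hg.toLp g) : Lp ℝ 2 μ) := by
    rw [Submodule.starProjection_orthogonal_val, sub_sub_cancel]
    rfl
  rw [h3]
  exact hg.condExpL2_ae_eq_condExp (hG n)

/-- The conditional expectations have an `L²` limit, tail triviality makes it constant, and
comparison of means identifies the constant. -/
lemma tendsto_condExp_past [IsProbabilityMeasure μ] (hT : MeasurePreserving T μ μ)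
    (hF₀ : F₀ ≤ mΩ) (hmono : F₀ ≤ F₀.comap T)
    (htail : ∀ s : Set Ω, MeasurableSet[⨅ i : ℤ, filt F₀ T.toEquiv i] s → μ s = 0 ∨ μ s = 1)
    {g : Ω → ℝ} (hg : MemLp g 2 μ) :
    Tendsto (fun n : ℕ => eLpNorm (μ[g | filt F₀ T.toEquiv (-(n : ℤ))] - fun _ => ∫ ω, g ω ∂μ) 1 μ)
      atTop (𝓝 0) := by
  obtain ⟨W, hW⟩ := exists_tendsto_condExp_of_antitone
    (G := fun n : ℕ => filt F₀ T.toEquiv (-(n : ℤ))) (fun n => filt_le hT hF₀ _)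
    (fun a b hab => filt_mono hmono (by omega)) hg
  have hWi : Integrable W μ := (Lp.memLp W).integrable (by norm_num)
  have h1 := tendsto_eLpNorm_one_of_two (fun n => integrable_condExp.aestronglyMeasurable)
    hWi.aestronglyMeasurable hW
  have hc := ae_eq_const_of_tendsto_tail hT hF₀ hmono htail
    (fun n => stronglyMeasurable_condExp) hWi h1
  have hint : Tendsto (fun n : ℕ => ∫ ω, (μ[g | filt F₀ T.toEquiv (-(n : ℤ))]) ω ∂μ) atTop
      (𝓝 (∫ ω, W ω ∂μ)) :=
    tendsto_integral_of_L1' _ hWi.aestronglyMeasurable (Eventually.of_forall fun n => integrable_condExp) h1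
  simp_rw [integral_condExp (filt_le hT hF₀ _)] at hint
  have hEq := tendsto_nhds_unique hint tendsto_const_nhds
  rw [hEq] at hc
  refine h1.congr fun n => eLpNorm_congr_ae (EventuallyEq.rfl.sub hc)

lemma iSup_filt_nat (hmono : F₀ ≤ F₀.comap T) :
    (⨆ i : ℤ, filt F₀ T.toEquiv i) = ⨆ n : ℕ, filt F₀ T.toEquiv (n : ℤ) := by
  refine le_antisymm (iSup_le fun i => ?_) (iSup_le fun n => le_iSup (filt F₀ T.toEquiv) (n : ℤ))
  exact (filt_mono hmono (by omega : i ≤ (i.natAbs : ℤ))).trans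
    (le_iSup (fun n : ℕ => filt F₀ T.toEquiv (n : ℤ)) i.natAbs)

lemma tendsto_condExp_future [IsProbabilityMeasure μ] (hT : MeasurePreserving T μ μ)
    (hF₀ : F₀ ≤ mΩ) (hmono : F₀ ≤ F₀.comap T) {g : Ω → ℝ} (hg : Integrable g μ)
    (hmeas : Measurable[⨆ i : ℤ, filt F₀ T.toEquiv i] g) :
    Tendsto (fun n : ℕ => eLpNorm (μ[g | filt F₀ T.toEquiv (n : ℤ)] - g) 1 μ) atTop (𝓝 0) := by
  rw [iSup_filt_nat hmono] at hmeas
  exact Integrable.tendsto_eLpNorm_condExp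
    (ℱ := ⟨fun n : ℕ => filt F₀ T.toEquiv (n : ℤ),
      fun a b hab => filt_mono hmono (by omega), fun n => filt_le hT hF₀ _⟩)
    hg hmeas.stronglyMeasurable

end Past

/-! ### Absolute summability of autocovariances in a Hilbert space. -/

section Hilbert

variable {H : Type*} [NormedAddCommGroup H] [InnerProductSpace ℝ H]

/-- The autocovariances of a moving average of innovations are absolutely summable. -/
lemma sum_abs_inner_le (V : ℤ → H →ₗᵢ[ℝ] H) (hV : ∀ i j z, V i (V j z) = V (i + j) z)
    (d : ℤ → H) (horth : ∀ l m i j, i ≠ j → inner ℝ (V i (d l)) (V j (d m)) = 0)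
    (hd : Summable fun l => ‖d l‖) {Z : H} (hZ : HasSum (fun l => V l (d l)) Z) (S : Finset ℤ) :
    ∑ k ∈ S, |inner ℝ Z (V k Z)| ≤ (∑' l, ‖d l‖) ^ 2 := by
  have hlim : Tendsto (fun A : Finset ℤ => ∑ k ∈ S, |inner ℝ (∑ l ∈ A, V l (d l))
      (V k (∑ l ∈ A, V l (d l)))|) atTop (𝓝 (∑ k ∈ S, |inner ℝ Z (V k Z)|)) := by
    refine tendsto_finsetSum _ fun k _ => Tendsto.abs ?_
    exact Tendsto.inner hZ (((V k).continuous.tendsto Z).comp hZ)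
  refine le_of_tendsto hlim (Eventually.of_forall fun A => ?_)
  -- By orthogonality the pair `(l, m)` contributes only when `l = k + m`. In the sum over `k` each
  -- pair therefore counts at most once, which leaves the square of the sum of the norms.
  have hk : ∀ k, |inner ℝ (∑ l ∈ A, V l (d l)) (V k (∑ l ∈ A, V l (d l)))| ≤
      ∑ l ∈ A, ∑ m ∈ A, if k = l - m then ‖d l‖ * ‖d m‖ else 0 := by
    intro k
    rw [map_sum, sum_inner]
    simp_rw [inner_sum]
    refine (Finset.abs_sum_le_sum_abs _ _).trans (Finset.sum_le_sum fun l _ => ?_)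
    refine (Finset.abs_sum_le_sum_abs _ _).trans (Finset.sum_le_sum fun m _ => ?_)
    rw [hV]
    split_ifs with h
    · refine (abs_real_inner_le_norm _ _).trans ?_
      rw [LinearIsometry.norm_map, LinearIsometry.norm_map]
    · rw [horth _ _ _ _ (by omega), abs_zero]
  calc _ ≤ ∑ k ∈ S, ∑ l ∈ A, ∑ m ∈ A, (if k = l - m then ‖d l‖ * ‖d m‖ else 0) :=
        Finset.sum_le_sum fun k _ => hk k
    _ = ∑ l ∈ A, ∑ m ∈ A, ∑ k ∈ S, (if k = l - m then ‖d l‖ * ‖d m‖ else 0) := by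
        rw [Finset.sum_comm]
        exact Finset.sum_congr rfl fun l _ => Finset.sum_comm
    _ ≤ ∑ l ∈ A, ∑ m ∈ A, ‖d l‖ * ‖d m‖ := by
        refine Finset.sum_le_sum fun l _ => Finset.sum_le_sum fun m _ => ?_
        rw [Finset.sum_ite_eq']
        split_ifs
        · exact le_rfl
        · positivity
    _ = (∑ l ∈ A, ‖d l‖) ^ 2 := by rw [sq, Finset.sum_mul_sum]
    _ ≤ _ := by
        gcongr
        exact hd.sum_le_tsum _ fun _ _ => norm_nonneg _

end Hilbert

lemma sum_Ioc_telescope {Ω : Type*} (G : ℤ → Ω → ℝ) (N : ℕ) :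
    ∑ l ∈ Finset.Ioc (-(N : ℤ)) N, (G l - G (l - 1)) = G N - G (-(N : ℤ)) := by
  induction N with
  | zero => simp
  | succ N ih =>
    have : Finset.Ioc (-((N + 1 : ℕ) : ℤ)) ((N + 1 : ℕ) : ℤ) =
        insert (-(N : ℤ)) (insert ((N : ℤ) + 1) (Finset.Ioc (-(N : ℤ)) N)) := by
      ext k; simp only [Finset.mem_insert, Finset.mem_Ioc]; omega
    rw [this, Finset.sum_insert, Finset.sum_insert, ih]
    · push_cast
      rw [add_sub_cancel_right, show -(N : ℤ) - 1 = -1 + -N by ring, neg_add_rev]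
      abel
    · simp
    · simp only [Finset.mem_insert, Finset.mem_Ioc]; omega

/-! ### Autocovariances and the innovation expansion. -/

section Autocovariance

variable {Ω : Type*} {F₀ : MeasurableSpace Ω} [mΩ : MeasurableSpace Ω]
  {μ : Measure Ω} {T : Ω ≃ᵐ Ω}

/-- The autocovariance `E(Z · Z ∘ Tᵏ)`. -/
def acov (S : Equiv.Perm Ω) (μ : Measure Ω) (Z : Ω → ℝ) (k : ℤ) : ℝ :=
  ∫ ω, Z ω * process S Z k ω ∂μ

/-- Composition with `Tⁱ` on `L²`. -/
def koopman (hT : MeasurePreserving T μ μ) (i : ℤ) : Lp ℝ 2 μ →ₗᵢ[ℝ] Lp ℝ 2 μ :=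
  Lp.compMeasurePreservingₗᵢ ℝ (fun ω => (T.toEquiv ^ i) ω) (measurePreserving_zpow hT i)

lemma koopman_toLp (hT : MeasurePreserving T μ μ) {Z : Ω → ℝ} (hZ : MemLp Z 2 μ) (i : ℤ) :
    koopman hT i (hZ.toLp Z) = (memLp_process hT hZ i).toLp (process T.toEquiv Z i) := rfl

lemma koopman_koopman (hT : MeasurePreserving T μ μ) (i j : ℤ) (z : Lp ℝ 2 μ) :
    koopman hT i (koopman hT j z) = koopman hT (i + j) z := by
  obtain ⟨Z, hZ, rfl⟩ : ∃ (Z : Ω → ℝ) (hZ : MemLp Z 2 μ), z = hZ.toLp Z :=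
    ⟨z, Lp.memLp z, (Lp.toLp_coeFn z _).symm⟩
  rw [koopman_toLp, koopman_toLp, koopman_toLp]
  congr 1
  rw [process_process, add_comm]

lemma inner_toLp {Z W : Ω → ℝ} (hZ : MemLp Z 2 μ) (hW : MemLp W 2 μ) :
    inner ℝ (hZ.toLp Z) (hW.toLp W) = ∫ ω, Z ω * W ω ∂μ := by
  rw [L2.inner_def]
  refine integral_congr_ae ?_
  filter_upwards [hZ.coeFn_toLp, hW.coeFn_toLp] with ω h1 h2
  rw [h1, h2]
  simp [mul_comm]

lemma integral_process_mul_process (hT : MeasurePreserving T μ μ) (Z W : Ω → ℝ) (i j : ℤ) :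
    ∫ ω, process T.toEquiv Z i ω * process T.toEquiv W j ω ∂μ =
      ∫ ω, Z ω * process T.toEquiv W (j - i) ω ∂μ := by
  rw [← integral_process hT (fun ω => Z ω * process T.toEquiv W (j - i) ω) i]
  refine integral_congr_ae (Eventually.of_forall fun ω => ?_)
  change _ = process T.toEquiv Z i ω * process T.toEquiv (process T.toEquiv W (j - i)) i ω
  rw [process_process, sub_add_cancel]

lemma integral_process_mul_self (hT : MeasurePreserving T μ μ) (Z : Ω → ℝ) (i j : ℤ) :
    ∫ ω, process T.toEquiv Z i ω * process T.toEquiv Z j ω ∂μ = acov T.toEquiv μ Z (j - i) :=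
  integral_process_mul_process hT Z Z i j

lemma acov_neg (hT : MeasurePreserving T μ μ) (Z : Ω → ℝ) (k : ℤ) :
    acov T.toEquiv μ Z (-k) = acov T.toEquiv μ Z k := by
  rw [← zero_sub, ← integral_process_mul_self hT, acov, process_zero]
  simp_rw [mul_comm]

lemma acov_zero (Z : Ω → ℝ) : acov T.toEquiv μ Z 0 = ∫ ω, Z ω ^ 2 ∂μ := by
  rw [acov, process_zero]
  simp_rw [sq]

/-- A moving average with innovations `D l` has absolutely summable autocovariances. -/
lemma summable_acov [IsProbabilityMeasure μ] (hT : MeasurePreserving T μ μ)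
    (hF₀ : F₀ ≤ mΩ) (hmono : F₀ ≤ F₀.comap T) {D : ℤ → Ω → ℝ}
    (hD : ∀ l, IsInnovation F₀ T.toEquiv μ (D l))
    (hs : Summable fun l => ‖(hD l).memLp.toLp (D l)‖) {Z : Ω → ℝ} (hZ : MemLp Z 2 μ)
    (hsum : HasSum (fun l => koopman hT l ((hD l).memLp.toLp (D l))) (hZ.toLp Z)) :
    Summable (fun k => |acov T.toEquiv μ Z k|) ∧
      ∑' k, |acov T.toEquiv μ Z k| ≤ (∑' l, ‖(hD l).memLp.toLp (D l)‖) ^ 2 := by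
  have h := sum_abs_inner_le (koopman hT) (koopman_koopman hT)
    (fun l => (hD l).memLp.toLp (D l)) ?_ hs hsum
  · simp_rw [koopman_toLp, inner_toLp] at h
    have h1 : Summable (fun k => |acov T.toEquiv μ Z k|) :=
      summable_of_sum_le (fun _ => abs_nonneg _) h
    exact ⟨h1, h1.tsum_le_of_sum_le h⟩
  · intro l m i j hij
    rw [koopman_toLp, koopman_toLp, inner_toLp]
    exact (hD l).orthogonal hT hF₀ hmono (hD m) hij

lemma isInnovation_proj [IsProbabilityMeasure μ] (hT : MeasurePreserving T μ μ)
    (hF₀ : F₀ ≤ mΩ) (hmono : F₀ ≤ F₀.comap T) {Z : Ω → ℝ} (hZ : MemLp Z 2 μ) :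
    IsInnovation F₀ T.toEquiv μ (proj (filt F₀ T.toEquiv) μ 0 Z) where
  measurable := by
    have h1 : StronglyMeasurable[filt F₀ T.toEquiv 0] (proj (filt F₀ T.toEquiv) μ 0 Z) :=
      stronglyMeasurable_condExp.sub
        (stronglyMeasurable_condExp.mono (filt_mono hmono (by norm_num)))
    rwa [filt_zero] at h1
  memLp := (hZ.condExp (by norm_num)).sub (hZ.condExp (by norm_num))
  condExp := by
    refine (condExp_sub integrable_condExp integrable_condExp _).trans ?_
    have h1 : μ[μ[Z | filt F₀ T.toEquiv 0] | filt F₀ T.toEquiv (-1)] =ᵐ[μ]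
        μ[Z | filt F₀ T.toEquiv (-1)] :=
      condExp_condExp_of_le (filt_mono hmono (by norm_num)) (filt_le hT hF₀ _)
    have h2 : μ[μ[Z | filt F₀ T.toEquiv (0 - 1)] | filt F₀ T.toEquiv (-1)] =ᵐ[μ]
        μ[Z | filt F₀ T.toEquiv (-1)] :=
      condExp_condExp_of_le (filt_mono hmono (by norm_num)) (filt_le hT hF₀ _)
    filter_upwards [h1, h2] with ω e1 e2
    rw [Pi.sub_apply, e1, e2, sub_self, Pi.zero_apply]

/-- The projections of `Z` on the innovation spaces, transported to time `0`. -/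
lemma process_proj [IsProbabilityMeasure μ] (hT : MeasurePreserving T μ μ) (hF₀ : F₀ ≤ mΩ)
    {Z : Ω → ℝ} (hZ : Integrable Z μ) (l : ℤ) :
    process T.toEquiv (proj (filt F₀ T.toEquiv) μ 0 (process T.toEquiv Z (-l))) l =ᵐ[μ]
      μ[Z | filt F₀ T.toEquiv l] - μ[Z | filt F₀ T.toEquiv (l - 1)] := by
  have hZ' : Integrable (process T.toEquiv Z (-l)) μ :=
    (measurePreserving_zpow hT (-l)).integrable_comp_of_integrable hZ
  have h1 := condExp_process hT hF₀ hZ' 0 l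
  have h2 := condExp_process hT hF₀ hZ' (0 - 1) l
  rw [process_process, neg_add_cancel, process_zero] at h1 h2
  rw [zero_add] at h1
  rw [show (0 - 1 + l : ℤ) = l - 1 by ring] at h2
  exact h1.sub h2

/-- Under Hannan's condition a regular centred variable is the sum of its projections on the
innovation spaces. -/
lemma hasSum_koopman_proj [IsProbabilityMeasure μ] (hT : MeasurePreserving T μ μ)
    (hF₀ : F₀ ≤ mΩ) (hmono : F₀ ≤ F₀.comap T)
    (htail : ∀ s : Set Ω, MeasurableSet[⨅ i : ℤ, filt F₀ T.toEquiv i] s → μ s = 0 ∨ μ s = 1)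
    {Z : Ω → ℝ} (hZ : MemLp Z 2 μ) (hmean : ∫ ω, Z ω ∂μ = 0)
    (hmeas : Measurable[⨆ i : ℤ, filt F₀ T.toEquiv i] Z)
    (hs : Summable fun l : ℤ => ‖(isInnovation_proj hT hF₀ hmono
      (memLp_process hT hZ (-l))).memLp.toLp _‖) :
    HasSum (fun l : ℤ => koopman hT l ((isInnovation_proj hT hF₀ hmono
      (memLp_process hT hZ (-l))).memLp.toLp _)) (hZ.toLp Z) := by
  have hZi : Integrable Z μ := hZ.integrable (by norm_num)
  have hsum : Summable (fun l : ℤ => koopman hT l ((isInnovation_proj hT hF₀ hmono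
      (memLp_process hT hZ (-l))).memLp.toLp _)) :=
    Summable.of_norm (by simpa only [LinearIsometry.norm_map] using hs)
  obtain ⟨W, hW⟩ := hsum
  -- The series has a limit `W`, which may be identified along symmetric intervals: there the
  -- partial sums telescope to `E(Z | ℱ N) - E(Z | ℱ (-N))`, whose `L¹` limit is `Z`, since `Z` is
  -- centred.
  have hI : Tendsto (fun N : ℕ => Finset.Ioc (-(N : ℤ)) N) atTop atTop := by
    refine tendsto_atTop_finset_of_monotone ?_ ?_
    · intro a b hab
      exact Finset.Ioc_subset_Ioc (by omega) (by omega)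
    · intro k
      exact ⟨k.natAbs + 1, by rw [Finset.mem_Ioc]; omega⟩
  have hW2 := (Lp.tendsto_Lp_iff_tendsto_eLpNorm' _ _).1 (hW.comp hI)
  have hae : ∀ N : ℕ, ((∑ l ∈ Finset.Ioc (-(N : ℤ)) N, koopman hT l ((isInnovation_proj hT hF₀ hmono
      (memLp_process hT hZ (-l))).memLp.toLp _) : Lp ℝ 2 μ) : Ω → ℝ) =ᵐ[μ]
      μ[Z | filt F₀ T.toEquiv (N : ℤ)] - μ[Z | filt F₀ T.toEquiv (-(N : ℤ))] := by
    intro N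
    rw [← sum_Ioc_telescope (fun l => μ[Z | filt F₀ T.toEquiv l])]
    refine (Lp.coeFn_finsetSum _ _).trans ?_
    have h : ∀ l ∈ Finset.Ioc (-(N : ℤ)) N, ∀ᵐ ω ∂μ,
        (koopman hT l ((isInnovation_proj hT hF₀ hmono
          (memLp_process hT hZ (-l))).memLp.toLp _)) ω =
        (μ[Z | filt F₀ T.toEquiv l] - μ[Z | filt F₀ T.toEquiv (l - 1)]) ω := fun l _ => by
      rw [koopman_toLp]
      exact (MemLp.coeFn_toLp _).trans (process_proj hT hF₀ hZi l)
    filter_upwards [(Finset.eventually_all _).2 h] with ω hω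
    rw [Finset.sum_apply, Finset.sum_apply]
    exact Finset.sum_congr rfl hω
  have hW1 : Tendsto (fun N : ℕ => eLpNorm ((μ[Z | filt F₀ T.toEquiv (N : ℤ)] -
      μ[Z | filt F₀ T.toEquiv (-(N : ℤ))]) - (W : Ω → ℝ)) 1 μ) atTop (𝓝 0) := by
    refine tendsto_eLpNorm_one_of_two
      (fun n => (integrable_condExp.sub integrable_condExp).aestronglyMeasurable)
      (Lp.aestronglyMeasurable W) ?_
    exact hW2.congr fun N => eLpNorm_congr_ae ((hae N).sub EventuallyEq.rfl)
  have hp := tendsto_condExp_past hT hF₀ hmono htail hZ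
  have hf := tendsto_condExp_future hT hF₀ hmono hZi hmeas
  have hZW : eLpNorm (Z - (W : Ω → ℝ)) 1 μ = 0 := by
    have hlim := (hf.add hp).add hW1
    simp only [add_zero] at hlim
    refine le_antisymm (ge_of_tendsto' hlim fun N => ?_) zero_le
    rw [hmean]
    set A := μ[Z | filt F₀ T.toEquiv (N : ℤ)]
    set B := μ[Z | filt F₀ T.toEquiv (-(N : ℤ))]
    have hA : AEStronglyMeasurable A μ := integrable_condExp.aestronglyMeasurable
    have hB : AEStronglyMeasurable B μ := integrable_condExp.aestronglyMeasurable
    have hWm := Lp.aestronglyMeasurable W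
    have e : Z - (W : Ω → ℝ) = (-(A - Z) + (B - fun _ => (0 : ℝ))) + ((A - B) - (W : Ω → ℝ)) := by
      ext ω; simp only [Pi.add_apply, Pi.sub_apply, Pi.neg_apply]; ring
    rw [e]
    have hx : AEStronglyMeasurable (-(A - Z)) μ := (hA.sub hZ.aestronglyMeasurable).neg
    have hy : AEStronglyMeasurable (B - fun _ => (0 : ℝ)) μ := hB.sub aestronglyMeasurable_const
    refine (eLpNorm_add_le (hx.add hy) ((hA.sub hB).sub hWm) le_rfl).trans ?_
    gcongr
    refine (eLpNorm_add_le hx hy le_rfl).trans ?_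
    rw [eLpNorm_neg]
  rw [eLpNorm_eq_zero_iff (hZ.aestronglyMeasurable.sub (Lp.aestronglyMeasurable W)) one_ne_zero]
    at hZW
  have : hZ.toLp Z = W := by
    refine Lp.ext (hZ.coeFn_toLp.trans ?_)
    filter_upwards [hZW] with ω h
    have h' : Z ω - W ω = 0 := h
    linarith
  rw [this]
  exact hW

end Autocovariance

/-! ### Second moments and essential bounds. -/

section SquareIntegrable

variable {Ω : Type*} [mΩ : MeasurableSpace Ω] {μ : Measure Ω}

/-- Integrating `|R| ≤ R² / (2s) + s / 2`, an equality at `|R| = s`, takes the place of the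
Cauchy-Schwarz inequality. -/
lemma integral_abs_le_of_integral_sq_le [IsProbabilityMeasure μ] {R : Ω → ℝ} (hR : MemLp R 2 μ)
    {s : ℝ} (hs : 0 < s) (h : ∫ ω, R ω ^ 2 ∂μ ≤ s ^ 2) : ∫ ω, |R ω| ∂μ ≤ s := by
  have h1 : ∀ ω, |R ω| ≤ (1 / (2 * s)) * R ω ^ 2 + s / 2 := by
    intro ω
    have : (1 / (2 * s)) * R ω ^ 2 + s / 2 - |R ω| = (1 / (2 * s)) * (|R ω| - s) ^ 2 := by
      rw [sub_sq, sq_abs]; field_simp; ring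
    have h2 : 0 ≤ (1 / (2 * s)) * (|R ω| - s) ^ 2 := by positivity
    linarith
  calc ∫ ω, |R ω| ∂μ ≤ ∫ ω, ((1 / (2 * s)) * R ω ^ 2 + s / 2) ∂μ :=
        integral_mono (hR.integrable (by norm_num)).abs
          ((hR.integrable_sq.const_mul _).add (integrable_const _)) h1
    _ = (1 / (2 * s)) * ∫ ω, R ω ^ 2 ∂μ + s / 2 := by
        rw [integral_add (hR.integrable_sq.const_mul _) (integrable_const _), integral_const_mul]
        simp
    _ ≤ (1 / (2 * s)) * s ^ 2 + s / 2 := by gcongr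
    _ = s := by field_simp; ring

lemma integral_sq_sum {ι : Type*} (I : Finset ι) {R : ι → Ω → ℝ}
    (hR : ∀ i ∈ I, MemLp (R i) 2 μ) :
    ∫ ω, (∑ i ∈ I, R i ω) ^ 2 ∂μ = ∑ i ∈ I, ∑ j ∈ I, ∫ ω, R i ω * R j ω ∂μ := by
  simp_rw [sq, Finset.sum_mul_sum]
  rw [integral_finsetSum]
  · refine Finset.sum_congr rfl fun i hi => ?_
    rw [integral_finsetSum]
    exact fun j hj => (hR i hi).integrable_mul (hR j hj)
  · exact fun i hi => integrable_finsetSum _ fun j hj => (hR i hi).integrable_mul (hR j hj)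

lemma integral_sq_sum_of_orthogonal {ι : Type*} (I : Finset ι) {R : ι → Ω → ℝ}
    (hR : ∀ i ∈ I, MemLp (R i) 2 μ)
    (horth : ∀ i ∈ I, ∀ j ∈ I, i ≠ j → ∫ ω, R i ω * R j ω ∂μ = 0) :
    ∫ ω, (∑ i ∈ I, R i ω) ^ 2 ∂μ = ∑ i ∈ I, ∫ ω, R i ω ^ 2 ∂μ := by
  rw [integral_sq_sum I hR]
  refine Finset.sum_congr rfl fun i hi => ?_
  rw [Finset.sum_eq_single_of_mem i hi fun j hj hji => horth i hi j hj hji.symm]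
  simp_rw [sq]

lemma memLp_top_mul {f g : Ω → ℝ} (hf : MemLp f ⊤ μ) (hg : MemLp g ⊤ μ) : MemLp (f * g) ⊤ μ :=
  hg.mul hf

lemma exists_ae_bound {f : Ω → ℝ} (hf : MemLp f ⊤ μ) : ∃ B : ℝ, 0 < B ∧ ∀ᵐ ω ∂μ, |f ω| ≤ B := by
  refine ⟨(eLpNorm f ⊤ μ).toReal + 1, by positivity, ?_⟩
  filter_upwards [ae_le_eLpNormEssSup (f := f) (μ := μ)] with ω h
  rw [← eLpNorm_exponent_top] at h
  have h2 := ENNReal.toReal_mono hf.eLpNorm_ne_top h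
  rw [toReal_enorm, Real.norm_eq_abs] at h2
  linarith

lemma memLp_two_of_top [IsFiniteMeasure μ] {f : Ω → ℝ} (hf : MemLp f ⊤ μ) : MemLp f 2 μ :=
  hf.mono_exponent le_top

end SquareIntegrable

/-! ### Bounded innovations: approximation, variance bounds, weak law. -/

section BoundedInnovations

variable {Ω : Type*} {F₀ : MeasurableSpace Ω} [mΩ : MeasurableSpace Ω]
  {μ : Measure Ω} {T : Ω ≃ᵐ Ω}

lemma IsInnovation.sub [IsProbabilityMeasure μ] {D E : Ω → ℝ}
    (hD : IsInnovation F₀ T.toEquiv μ D) (hE : IsInnovation F₀ T.toEquiv μ E) :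
    IsInnovation F₀ T.toEquiv μ (D - E) where
  measurable := hD.measurable.sub hE.measurable
  memLp := hD.memLp.sub hE.memLp
  condExp := by
    refine (condExp_sub (hD.memLp.integrable (by norm_num)) (hE.memLp.integrable (by norm_num))
      _).trans ?_
    filter_upwards [hD.condExp, hE.condExp] with ω h1 h2
    rw [Pi.sub_apply, h1, h2, sub_self, Pi.zero_apply]

lemma isInnovation_zero : IsInnovation F₀ T.toEquiv μ 0 where
  measurable := stronglyMeasurable_zero
  memLp := MemLp.zero
  condExp := by rw [condExp_zero]

/-- Innovations can be approximated by bounded innovations. -/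
lemma IsInnovation.exists_bounded [IsProbabilityMeasure μ] (hT : MeasurePreserving T μ μ)
    (hF₀ : F₀ ≤ mΩ) (hmono : F₀ ≤ F₀.comap T) {D : Ω → ℝ}
    (hD : IsInnovation F₀ T.toEquiv μ D) {δ : ENNReal} (hδ : δ ≠ 0) :
    ∃ E, IsInnovation F₀ T.toEquiv μ E ∧ MemLp E ⊤ μ ∧ eLpNorm (D - E) 2 μ ≤ δ := by
  -- Density of simple functions is applied to the measure restricted to `F₀`, so that the
  -- approximant is `F₀`-measurable. Subtracting its conditional expectation then makes it an
  -- innovation.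
  have hD0 : MemLp D 2 (μ.trim hF₀) :=
    ⟨hD.measurable.aestronglyMeasurable, by rw [eLpNorm_trim hF₀ hD.measurable]; exact hD.memLp.2⟩
  obtain ⟨g, hgm, ⟨C, hC⟩, hg⟩ : ∃ g : Ω → ℝ, StronglyMeasurable[F₀] g ∧
      (∃ C, ∀ ω, ‖g ω‖ ≤ C) ∧ eLpNorm (D - g) 2 (μ.trim hF₀) < δ / 2 := by
    obtain ⟨g, hg, -⟩ := @MemLp.exists_simpleFunc_eLpNorm_sub_lt Ω F₀ 2 ℝ _ D (μ.trim hF₀) hD0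
      (by norm_num) (δ / 2) (ENNReal.half_pos hδ).ne'
    exact ⟨g, g.stronglyMeasurable, @SimpleFunc.exists_forall_norm_le Ω ℝ F₀ _ g, hg⟩
  rw [eLpNorm_trim hF₀ (hD.measurable.sub hgm)] at hg
  have hgt : MemLp g ⊤ μ :=
    memLp_top_of_bound (hgm.mono hF₀).aestronglyMeasurable C (Eventually.of_forall hC)
  have hg2 : MemLp g 2 μ := memLp_two_of_top hgt
  have hgi : Integrable g μ := hg2.integrable (by norm_num)
  have hDi : Integrable D μ := hD.memLp.integrable (by norm_num)
  refine ⟨g - μ[g | filt F₀ T.toEquiv (-1)], ⟨?_, ?_, ?_⟩, ?_, ?_⟩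
  · refine hgm.sub (stronglyMeasurable_condExp.mono ?_)
    conv_rhs => rw [← filt_zero (F₀ := F₀) T.toEquiv]
    exact filt_mono hmono (by norm_num)
  · exact hg2.sub (hg2.condExp (by norm_num))
  · refine (condExp_sub hgi integrable_condExp _).trans ?_
    filter_upwards [condExp_condExp_of_le (μ := μ) (f := g) (le_refl (filt F₀ T.toEquiv (-1)))
      (filt_le hT hF₀ _)] with ω h
    rw [Pi.sub_apply, h, sub_self, Pi.zero_apply]
  · exact hgt.sub (hgt.condExp (by norm_num))
  -- As `D` has zero conditional expectation, the error is `D - g` minus its own conditional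
  -- expectation; conditional expectation contracts `L²`, so recentring at most doubles the error `δ
  -- / 2`.
  · have e : D - (g - μ[g | filt F₀ T.toEquiv (-1)]) =ᵐ[μ]
        (D - g) - μ[D - g | filt F₀ T.toEquiv (-1)] := by
      filter_upwards [condExp_sub hDi hgi (filt F₀ T.toEquiv (-1)), hD.condExp] with ω h1 h2
      simp only [Pi.sub_apply] at h1 ⊢
      rw [h1, h2, Pi.zero_apply]
      ring
    rw [eLpNorm_congr_ae e]
    have hm : AEStronglyMeasurable (D - g) μ := (hDi.sub hgi).aestronglyMeasurable
    refine (eLpNorm_sub_le hm integrable_condExp.aestronglyMeasurable (by norm_num)).trans ?_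
    calc _ ≤ δ / 2 + δ / 2 := by
          gcongr
          exact (eLpNorm_condExp_le_eLpNorm _ (by norm_num)).trans hg.le
      _ = δ := ENNReal.add_halves δ

/-- The strictly triangular part of a quadratic form in two bounded sequences of martingale
differences. -/
lemma integral_sq_lower_le [IsProbabilityMeasure μ] (hT : MeasurePreserving T μ μ)
    (hF₀ : F₀ ≤ mΩ) (hmono : F₀ ≤ F₀.comap T) {X Y : Ω → ℝ}
    (hX : IsInnovation F₀ T.toEquiv μ X) (hY : IsInnovation F₀ T.toEquiv μ Y)
    (hXb : MemLp X ⊤ μ) (hYb : MemLp Y ⊤ μ) {B : ℝ} (hXB : ∀ᵐ ω ∂μ, |X ω| ≤ B)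
    (hYB : ∀ᵐ ω ∂μ, |Y ω| ≤ B) (l m : ℤ) (n c : ℕ) {w : ℕ → ℕ → ℝ} (hw : ∀ i j, |w i j| ≤ 1)
    (hw0 : ∀ i j : ℕ, 2 * (c : ℤ) ≤ |(i : ℤ) - j| → w i j = 0) :
    ∫ ω, (∑ j ∈ Finset.Icc 1 n, ∑ i ∈ Finset.Icc 1 n,
      (if (i : ℤ) + l < j + m then w i j else 0) *
        (process T.toEquiv X (i + l) ω * process T.toEquiv Y (j + m) ω)) ^ 2 ∂μ ≤
      4 * c * n * B ^ 4 := by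
  -- The strict inequality between times makes `S j` measurable with respect to the past of time `j
  -- + m`, so the products of `S j` with `Y` at that time are orthogonal martingale differences.
  set S : ℕ → Ω → ℝ := fun j ω => ∑ i ∈ Finset.Icc 1 n,
    (if (i : ℤ) + l < j + m then w i j else 0) * process T.toEquiv X (i + l) ω with hS
  have hXt : ∀ i, MemLp (process T.toEquiv X i) ⊤ μ := fun i => memLp_process hT hXb i
  have hYt : ∀ i, MemLp (process T.toEquiv Y i) ⊤ μ := fun i => memLp_process hT hYb i
  have hSt : ∀ j, MemLp (S j) ⊤ μ := fun j =>
    memLp_finsetSum _ fun i _ => (hXt _).const_mul _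
  have hSm : ∀ j : ℕ, StronglyMeasurable[filt F₀ T.toEquiv (j + m - 1)] (S j) := by
    intro j
    refine Finset.stronglyMeasurable_fun_sum _ fun i _ => ?_
    by_cases h : (i : ℤ) + l < j + m
    · exact ((hX.stronglyMeasurable_process _).mono (filt_mono hmono (by omega))).const_mul _
    · simp only [if_neg h, zero_mul]
      exact stronglyMeasurable_const
  have hR : ∀ j ∈ Finset.Icc 1 n, MemLp (S j * process T.toEquiv Y (j + m)) 2 μ :=
    fun j _ => memLp_two_of_top (memLp_top_mul (hSt j) (hYt _))
  have hlt : ∀ j k : ℕ, j < k → ∫ ω, (S j * process T.toEquiv Y (j + m)) ω *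
      (S k * process T.toEquiv Y (k + m)) ω ∂μ = 0 := by
    intro j k hjk
    have hgm : StronglyMeasurable[filt F₀ T.toEquiv (k + m - 1)]
        (S j * process T.toEquiv Y (j + m) * S k) :=
      (((hSm j).mono (filt_mono hmono (by omega))).mul
        ((hY.stronglyMeasurable_process _).mono (filt_mono hmono (by omega)))).mul (hSm k)
    have := hY.integral_mul_process hT hF₀ hgm
      (memLp_two_of_top (memLp_top_mul (memLp_top_mul (hSt j) (hYt _)) (hSt k)))
    rw [← this]
    refine integral_congr_ae (Eventually.of_forall fun ω => ?_)
    simp only [Pi.mul_apply]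
    ring
  have horth : ∀ j ∈ Finset.Icc 1 n, ∀ k ∈ Finset.Icc 1 n, j ≠ k →
      ∫ ω, (S j * process T.toEquiv Y (j + m)) ω * (S k * process T.toEquiv Y (k + m)) ω ∂μ = 0 := by
    intro j _ k _ hjk
    rcases lt_or_gt_of_ne hjk with h | h
    · exact hlt j k h
    · simp_rw [mul_comm ((S j * process T.toEquiv Y (j + m)) _)]
      exact hlt k j h
  have hform : ∀ ω, ∑ j ∈ Finset.Icc 1 n, ∑ i ∈ Finset.Icc 1 n,
      (if (i : ℤ) + l < j + m then w i j else 0) *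
        (process T.toEquiv X (i + l) ω * process T.toEquiv Y (j + m) ω) =
      ∑ j ∈ Finset.Icc 1 n, (S j * process T.toEquiv Y (j + m)) ω := by
    intro ω
    refine Finset.sum_congr rfl fun j _ => ?_
    rw [Pi.mul_apply, hS, Finset.sum_mul]
    exact Finset.sum_congr rfl fun i _ => by ring
  simp_rw [hform]
  rw [integral_sq_sum_of_orthogonal _ hR horth]
  have hX2 : ∀ i, ∫ ω, process T.toEquiv X i ω ^ 2 ∂μ ≤ B ^ 2 := by
    intro i
    have : ∫ _, B ^ 2 ∂μ = B ^ 2 := by simp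
    rw [← this]
    refine integral_mono_ae (memLp_two_of_top (hXt i)).integrable_sq (integrable_const _) ?_
    filter_upwards [ae_process hT (P := fun z => |z| ≤ B) hXB i] with ω h
    exact sq_le_sq' (abs_le.1 h).1 (abs_le.1 h).2
  -- The variables `X` at distinct times are orthogonal and at most `4c` weights are nonzero.
  have hS2 : ∀ j, ∫ ω, S j ω ^ 2 ∂μ ≤ 4 * c * B ^ 2 := by
    intro j
    have hor := integral_sq_sum_of_orthogonal (μ := μ) (Finset.Icc 1 n)
      (R := fun (i : ℕ) ω => (if (i : ℤ) + l < j + m then w i j else 0) *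
        process T.toEquiv X (i + l) ω) (fun i _ => memLp_two_of_top ((hXt _).const_mul _)) ?_
    · rw [hS, hor]
      have hterm : ∀ i : ℕ, ∫ ω, ((if (i : ℤ) + l < j + m then w i j else 0) *
          process T.toEquiv X (i + l) ω) ^ 2 ∂μ ≤
          if |(i : ℤ) - j| < 2 * (c : ℤ) then B ^ 2 else 0 := by
        intro i
        simp_rw [mul_pow]
        rw [integral_const_mul]
        have h0 : 0 ≤ ∫ ω, process T.toEquiv X (i + l) ω ^ 2 ∂μ :=
          integral_nonneg fun ω => sq_nonneg _
        split_ifs with h1 h2 h2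
        · have hw1 : w i j ^ 2 ≤ 1 := by rw [sq_le_one_iff_abs_le_one]; exact hw i j
          calc _ ≤ 1 * ∫ ω, process T.toEquiv X (i + l) ω ^ 2 ∂μ := by gcongr
            _ ≤ _ := by rw [one_mul]; exact hX2 _
        · rw [hw0 i j (not_lt.1 h2)]; simp
        · simp only [ne_eq, OfNat.ofNat_ne_zero, not_false_eq_true, zero_pow, zero_mul]
          positivity
        · simp
      refine (Finset.sum_le_sum fun i _ => hterm i).trans ?_
      rw [← Finset.sum_filter, Finset.sum_const, nsmul_eq_mul]
      have : (((Finset.Icc 1 n).filter fun i : ℕ => |(i : ℤ) - j| < 2 * (c : ℤ)).card : ℝ) ≤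
          4 * c := by exact_mod_cast card_near_le c n j
      gcongr
    · intro i _ k _ hik
      have := hX.orthogonal hT hF₀ hmono hX (a := (i : ℤ) + l) (b := k + l) (by omega)
      have e : ∀ ω, ((if (i : ℤ) + l < j + m then w i j else 0) * process T.toEquiv X (i + l) ω) *
          ((if (k : ℤ) + l < j + m then w k j else 0) * process T.toEquiv X (k + l) ω) =
          ((if (i : ℤ) + l < j + m then w i j else 0) * (if (k : ℤ) + l < j + m then w k j else 0)) *
          (process T.toEquiv X (i + l) ω * process T.toEquiv X (k + l) ω) := fun ω => by ring
      simp_rw [e]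
      rw [integral_const_mul, this, mul_zero]
  have hj : ∀ j : ℕ, ∫ ω, (S j * process T.toEquiv Y (j + m)) ω ^ 2 ∂μ ≤ 4 * c * B ^ 4 := by
    intro j
    calc ∫ ω, (S j * process T.toEquiv Y (j + m)) ω ^ 2 ∂μ ≤ ∫ ω, B ^ 2 * S j ω ^ 2 ∂μ := by
          refine integral_mono_ae
            (memLp_two_of_top (memLp_top_mul (hSt j) (hYt _))).integrable_sq
            ((memLp_two_of_top (hSt j)).integrable_sq.const_mul _) ?_
          filter_upwards [ae_process hT (P := fun z => |z| ≤ B) hYB (j + m)] with ω h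
          rw [Pi.mul_apply, mul_pow, mul_comm]
          exact mul_le_mul_of_nonneg_right (sq_le_sq' (abs_le.1 h).1 (abs_le.1 h).2) (sq_nonneg _)
      _ = B ^ 2 * ∫ ω, S j ω ^ 2 ∂μ := integral_const_mul _ _
      _ ≤ B ^ 2 * (4 * c * B ^ 2) := by gcongr; exact hS2 j
      _ = _ := by ring
  refine (Finset.sum_le_sum fun j _ => hj j).trans ?_
  rw [Finset.sum_const, Nat.card_Icc, nsmul_eq_mul, Nat.add_sub_cancel]
  exact le_of_eq (by ring)

/-- Autocovariances of a bounded `ℱ₀`-measurable variable vanish at infinity when the remote past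
is trivial. -/
lemma exists_acov_le [IsProbabilityMeasure μ] (hT : MeasurePreserving T μ μ)
    (hF₀ : F₀ ≤ mΩ) (hmono : F₀ ≤ F₀.comap T)
    (htail : ∀ s : Set Ω, MeasurableSet[⨅ i : ℤ, filt F₀ T.toEquiv i] s → μ s = 0 ∨ μ s = 1)
    {g : Ω → ℝ} (hgm : StronglyMeasurable[F₀] g) (hg : MemLp g ⊤ μ) (hmean : ∫ ω, g ω ∂μ = 0)
    {θ : ℝ} (hθ : 0 < θ) :
    ∃ K : ℕ, ∀ k : ℤ, (K : ℤ) ≤ |k| → |acov T.toEquiv μ g k| ≤ θ := by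
  obtain ⟨B, hB, hgB⟩ := exists_ae_bound hg
  have hg2 := memLp_two_of_top hg
  have hlim := tendsto_condExp_past hT hF₀ hmono htail hg2
  have hθB : (0 : ENNReal) < ENNReal.ofReal (θ / B) := by
    rw [ENNReal.ofReal_pos]; positivity
  obtain ⟨K, hK⟩ := eventually_atTop.1 (hlim.eventually_lt_const hθB)
  -- At a negative lag the shifted factor is measurable with respect to `ℱ (-n)`. So `g` may be
  -- replaced by its conditional expectation, which is small in `L¹`, while the shifted factor is
  -- bounded by `B`.
  have hneg : ∀ n : ℕ, K ≤ n → |acov T.toEquiv μ g (-(n : ℤ))| ≤ θ := by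
    intro n hn
    have hsm : StronglyMeasurable[filt F₀ T.toEquiv (-(n : ℤ))] (process T.toEquiv g (-(n : ℤ))) := by
      have := stronglyMeasurable_process (F₀ := F₀) T.toEquiv (i := 0)
        (by rw [filt_zero]; exact hgm) (-(n : ℤ))
      rwa [zero_add] at this
    have hp2 : MemLp (process T.toEquiv g (-(n : ℤ))) 2 μ := memLp_process hT hg2 _
    have h1 : acov T.toEquiv μ g (-(n : ℤ)) =
        ∫ ω, (μ[g | filt F₀ T.toEquiv (-(n : ℤ))]) ω * process T.toEquiv g (-(n : ℤ)) ω ∂μ := by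
      rw [acov, ← integral_condExp (filt_le hT hF₀ (-(n : ℤ)))]
      refine integral_congr_ae ?_
      exact condExp_mul_of_aestronglyMeasurable_right hsm.aestronglyMeasurable
        (hg2.integrable_mul hp2) (hg2.integrable (by norm_num))
    have h2 : ∫ ω, |(μ[g | filt F₀ T.toEquiv (-(n : ℤ))]) ω| ∂μ ≤ θ / B := by
      have h3 := hK n hn
      rw [hmean, eLpNorm_one_eq_lintegral_enorm] at h3
      have h4 := integral_norm_eq_lintegral_enorm
        (integrable_condExp (f := g) (m := filt F₀ T.toEquiv (-(n : ℤ))) (μ := μ)).aestronglyMeasurable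
      simp_rw [Real.norm_eq_abs] at h4
      rw [h4]
      refine ENNReal.toReal_le_of_le_ofReal (by positivity) ?_
      refine le_trans (le_of_eq ?_) h3.le
      simp
    rw [h1]
    refine (abs_integral_le_integral_abs).trans ?_
    calc _ ≤ ∫ ω, |(μ[g | filt F₀ T.toEquiv (-(n : ℤ))]) ω| * B ∂μ := by
          refine integral_mono_ae ?_ (integrable_condExp.abs.mul_const _) ?_
          · exact ((hg2.condExp (by norm_num)).integrable_mul hp2).abs
          · filter_upwards [ae_process hT (P := fun z => |z| ≤ B) hgB (-(n : ℤ))] with ω h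
            rw [abs_mul]
            exact mul_le_mul_of_nonneg_left h (abs_nonneg _)
      _ = (∫ ω, |(μ[g | filt F₀ T.toEquiv (-(n : ℤ))]) ω| ∂μ) * B := integral_mul_const _ _
      _ ≤ θ / B * B := by gcongr
      _ = θ := by field_simp
  refine ⟨K, fun k hk => ?_⟩
  have h := hneg k.natAbs (by have := Int.abs_eq_natAbs k; omega)
  rcases le_total 0 k with h0 | h0
  · rw [show -(k.natAbs : ℤ) = -k by omega, acov_neg hT] at h
    exact h
  · rwa [show -(k.natAbs : ℤ) = k by omega] at h

lemma abs_acov_le_acov_zero [IsProbabilityMeasure μ] (hT : MeasurePreserving T μ μ) {g : Ω → ℝ}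
    (hg : MemLp g 2 μ) (k : ℤ) : |acov T.toEquiv μ g k| ≤ acov T.toEquiv μ g 0 := by
  have hp := memLp_process hT hg k
  have h1 := integral_process hT (fun ω => g ω ^ 2) k
  have h2 : ∫ ω, (1 / 2 * g ω ^ 2 + 1 / 2 * process T.toEquiv g k ω ^ 2) ∂μ =
      acov T.toEquiv μ g 0 := by
    rw [integral_add (hg.integrable_sq.const_mul _) (hp.integrable_sq.const_mul _),
      integral_const_mul, integral_const_mul, acov_zero]
    have : ∫ ω, process T.toEquiv g k ω ^ 2 ∂μ = ∫ ω, g ω ^ 2 ∂μ := h1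
    rw [this]; ring
  rw [← h2, acov]
  refine abs_integral_le_integral_abs.trans (integral_mono (hg.integrable_mul hp).abs
    ((hg.integrable_sq.const_mul _).add (hp.integrable_sq.const_mul _)) fun ω => ?_)
  simp only [abs_mul]
  rw [← sq_abs (g ω), ← sq_abs (process _ _ _ _)]
  nlinarith [sq_nonneg (|g ω| - |process T.toEquiv g k ω|)]

/-- A weak law of large numbers with bounded weights. -/
lemma exists_integral_sq_weighted_le [IsProbabilityMeasure μ] (hT : MeasurePreserving T μ μ)
    (hF₀ : F₀ ≤ mΩ) (hmono : F₀ ≤ F₀.comap T)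
    (htail : ∀ s : Set Ω, MeasurableSet[⨅ i : ℤ, filt F₀ T.toEquiv i] s → μ s = 0 ∨ μ s = 1)
    {g : Ω → ℝ} (hgm : StronglyMeasurable[F₀] g) (hg : MemLp g ⊤ μ) (hmean : ∫ ω, g ω ∂μ = 0)
    {θ : ℝ} (hθ : 0 < θ) :
    ∃ C : ℝ, 0 ≤ C ∧ ∀ (n : ℕ) (m : ℤ) (w : ℕ → ℝ), (∀ j, |w j| ≤ 1) →
      ∫ ω, (∑ j ∈ Finset.Icc 1 n, w j * process T.toEquiv g (j + m) ω) ^ 2 ∂μ ≤ n * (C + θ * n) := by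
  obtain ⟨K, hK⟩ := exists_acov_le hT hF₀ hmono htail hgm hg hmean hθ
  have hg2 := memLp_two_of_top hg
  have h00 : 0 ≤ acov T.toEquiv μ g 0 := (abs_nonneg _).trans (abs_acov_le_acov_zero hT hg2 0)
  refine ⟨4 * K * acov T.toEquiv μ g 0, by positivity, fun n m w hw => ?_⟩
  rw [integral_sq_sum _ fun j _ => (memLp_process hT hg2 _).const_mul _]
  -- Far pairs contribute at most `θ` each. Close pairs, fewer than `2K` apart so that
  -- `card_near_le` applies, number at most `4K` per row and contribute at most the variance.
  have hterm : ∀ i j : ℕ, ∫ ω, w i * process T.toEquiv g (i + m) ω *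
      (w j * process T.toEquiv g (j + m) ω) ∂μ ≤
      (if |(j : ℤ) - i| < 2 * (K : ℤ) then acov T.toEquiv μ g 0 else 0) + θ := by
    intro i j
    have e : ∀ ω, w i * process T.toEquiv g (i + m) ω * (w j * process T.toEquiv g (j + m) ω) =
        (w i * w j) * (process T.toEquiv g (i + m) ω * process T.toEquiv g (j + m) ω) :=
      fun ω => by ring
    simp_rw [e]
    rw [integral_const_mul, integral_process_mul_self hT,
      show (j : ℤ) + m - (i + m) = j - i by ring]
    refine (le_abs_self _).trans ?_
    rw [abs_mul, abs_mul]
    have hww : |w i| * |w j| ≤ 1 := mul_le_one₀ (hw i) (abs_nonneg _) (hw j)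
    refine (mul_le_of_le_one_left (abs_nonneg _) hww).trans ?_
    split_ifs with h
    · linarith [abs_acov_le_acov_zero hT hg2 ((j : ℤ) - i)]
    · rw [zero_add]
      exact hK _ (by omega)
  calc _ ≤ ∑ i ∈ Finset.Icc 1 n, ∑ j ∈ Finset.Icc 1 n,
        ((if |(j : ℤ) - i| < 2 * (K : ℤ) then acov T.toEquiv μ g 0 else 0) + θ) :=
        Finset.sum_le_sum fun i _ => Finset.sum_le_sum fun j _ => hterm i j
    _ ≤ ∑ i ∈ Finset.Icc 1 n, (4 * K * acov T.toEquiv μ g 0 + θ * n) := by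
        refine Finset.sum_le_sum fun i _ => ?_
        rw [Finset.sum_add_distrib, ← Finset.sum_filter, Finset.sum_const, Finset.sum_const,
          nsmul_eq_mul, nsmul_eq_mul, Nat.card_Icc, Nat.add_sub_cancel, mul_comm θ]
        have : (((Finset.Icc 1 n).filter fun j : ℕ => |(j : ℤ) - i| < 2 * (K : ℤ)).card : ℝ) ≤
          4 * K := by exact_mod_cast card_near_le K n i
        gcongr
    _ = _ := by
        rw [Finset.sum_const, Nat.card_Icc, nsmul_eq_mul, Nat.add_sub_cancel]

end BoundedInnovations

/-! ### Concentration of banded quadratic forms. -/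

section Concentration

variable {Ω : Type*} {F₀ : MeasurableSpace Ω} [mΩ : MeasurableSpace Ω]
  {μ : Measure Ω} {T : Ω ≃ᵐ Ω}

/-- The centred contribution of two innovation sequences to a banded quadratic form is negligible. -/
lemma eventually_integral_abs_cross_le [IsProbabilityMeasure μ] (hT : MeasurePreserving T μ μ)
    (hF₀ : F₀ ≤ mΩ) (hmono : F₀ ≤ F₀.comap T)
    (htail : ∀ s : Set Ω, MeasurableSet[⨅ i : ℤ, filt F₀ T.toEquiv i] s → μ s = 0 ∨ μ s = 1)
    {X Y : Ω → ℝ} (hX : IsInnovation F₀ T.toEquiv μ X) (hY : IsInnovation F₀ T.toEquiv μ Y)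
    (hXb : MemLp X ⊤ μ) (hYb : MemLp Y ⊤ μ) (l m : ℤ) {c : ℕ → ℕ}
    (hc : Tendsto (fun n => (c n : ℝ) / n) atTop (𝓝 0)) {θ : ℝ} (hθ : 0 < θ) :
    ∀ᶠ n : ℕ in atTop, ∀ a : ℤ → ℝ, (∀ k, |a k| ≤ 1) → (∀ k, 2 * (c n : ℤ) ≤ |k| → a k = 0) →
      ∫ ω, |∑ i ∈ Finset.Icc 1 n, ∑ j ∈ Finset.Icc 1 n, a ((j : ℤ) - i) *
        (process T.toEquiv X (i + l) ω * process T.toEquiv Y (j + m) ω -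
          ∫ ω', process T.toEquiv X (i + l) ω' * process T.toEquiv Y (j + m) ω' ∂μ)| ∂μ ≤ θ * n := by
  obtain ⟨B₁, hB₁, hXB₁⟩ := exists_ae_bound hXb
  obtain ⟨B₂, hB₂, hYB₂⟩ := exists_ae_bound hYb
  set B := max B₁ B₂ with hBdef
  have hB : 0 < B := lt_max_of_lt_left hB₁
  have hXB : ∀ᵐ ω ∂μ, |X ω| ≤ B := hXB₁.mono fun ω h => h.trans (le_max_left _ _)
  have hYB : ∀ᵐ ω ∂μ, |Y ω| ≤ B := hYB₂.mono fun ω h => h.trans (le_max_right _ _)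
  set e := ∫ ω, X ω * Y ω ∂μ with he
  set g : Ω → ℝ := fun ω => X ω * Y ω - e with hg
  have hgt : MemLp g ⊤ μ := (memLp_top_mul hXb hYb).sub (memLp_const e)
  have hgm : StronglyMeasurable[F₀] g := (hX.measurable.mul hY.measurable).sub stronglyMeasurable_const
  have hg0 : ∫ ω, g ω ∂μ = 0 := by
    have hXY : Integrable (fun ω => X ω * Y ω) μ := hX.memLp.integrable_mul hY.memLp
    simp only [hg]
    rw [integral_sub hXY (integrable_const _)]
    simp [he]
  obtain ⟨C, hC0, hC⟩ := exists_integral_sq_weighted_le hT hF₀ hmono htail hgm hgt hg0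
    (θ := θ ^ 2 / 18) (by positivity)
  have hCn : Tendsto (fun n : ℕ => C / n) atTop (𝓝 0) := tendsto_const_div_atTop_nhds_zero_nat C
  -- Three pieces each receive `θn / 3`. The constant `36` makes `4cnB⁴ ≤ (θn/3)²` for the
  -- triangular pieces; for the diagonal the two terms `θ² / 18` add up to `θ² / 9`.
  filter_upwards [hc.eventually_lt_const (show 0 < θ ^ 2 / (36 * B ^ 4) by positivity),
    hCn.eventually_lt_const (show 0 < θ ^ 2 / 18 by positivity), eventually_gt_atTop 0]
    with n hn1 hn2 hn a ha ha0
  have hn' : (0 : ℝ) < n := by exact_mod_cast hn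
  rw [div_lt_iff₀ hn'] at hn1 hn2
  have hXt : ∀ i, MemLp (process T.toEquiv X i) ⊤ μ := fun i => memLp_process hT hXb i
  have hYt : ∀ i, MemLp (process T.toEquiv Y i) ⊤ μ := fun i => memLp_process hT hYb i
  -- The form is split by the order of the actual times `i + l` and `j + m`. Only equal times have a
  -- nonzero mean `e`, and they produce the centred variable `g`.
  set lower : Ω → ℝ := fun ω => ∑ j ∈ Finset.Icc 1 n, ∑ i ∈ Finset.Icc 1 n,
    (if (i : ℤ) + l < j + m then a ((j : ℤ) - i) else 0) *
      (process T.toEquiv X (i + l) ω * process T.toEquiv Y (j + m) ω) with hlow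
  set upper : Ω → ℝ := fun ω => ∑ i ∈ Finset.Icc 1 n, ∑ j ∈ Finset.Icc 1 n,
    (if (j : ℤ) + m < i + l then a ((j : ℤ) - i) else 0) *
      (process T.toEquiv Y (j + m) ω * process T.toEquiv X (i + l) ω) with hup
  set w : ℕ → ℝ := fun j => ∑ i ∈ Finset.Icc 1 n,
    if (i : ℤ) + l = j + m then a ((j : ℤ) - i) else 0 with hwdef
  set diag : Ω → ℝ := fun ω => ∑ j ∈ Finset.Icc 1 n, w j * process T.toEquiv g (j + m) ω with hdiag
  -- For given `j` at most one `i` satisfies `i + l = j + m`.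
  have hw : ∀ j, |w j| ≤ 1 := by
    intro j
    by_cases h : ∃ i ∈ Finset.Icc 1 n, (i : ℤ) + l = j + m
    · obtain ⟨i, hi, hij⟩ := h
      simp only [hwdef]
      rw [Finset.sum_eq_single_of_mem i hi, if_pos hij]
      · exact ha _
      · intro k _ hk
        rw [if_neg]
        omega
    · push Not at h
      simp only [hwdef]
      rw [Finset.sum_eq_zero]
      · simp
      · intro i hi
        rw [if_neg (h i hi)]
  have hlowL : MemLp lower 2 μ := memLp_two_of_top <| memLp_finsetSum _ fun j _ =>
    memLp_finsetSum _ fun i _ => (memLp_top_mul (hXt _) (hYt _)).const_mul _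
  have hupL : MemLp upper 2 μ := memLp_two_of_top <| memLp_finsetSum _ fun j _ =>
    memLp_finsetSum _ fun i _ => (memLp_top_mul (hYt _) (hXt _)).const_mul _
  have hdiagL : MemLp diag 2 μ := memLp_two_of_top <| memLp_finsetSum _ fun j _ =>
    (memLp_process hT hgt _).const_mul _
  have hbound : 4 * (c n : ℝ) * n * B ^ 4 ≤ (θ / 3 * n) ^ 2 := by
    have h1 : (c n : ℝ) * (36 * B ^ 4) ≤ θ ^ 2 * n := by
      have := mul_le_mul_of_nonneg_right hn1.le (show 0 ≤ 36 * B ^ 4 by positivity)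
      refine this.trans (le_of_eq ?_)
      field_simp
    nlinarith
  have hs : 0 < θ / 3 * n := by positivity
  have h1 : ∫ ω, |lower ω| ∂μ ≤ θ / 3 * n :=
    integral_abs_le_of_integral_sq_le hlowL hs ((integral_sq_lower_le hT hF₀ hmono hX hY hXb hYb
      hXB hYB l m n (c n) (w := fun i j => a ((j : ℤ) - i)) (fun _ _ => ha _)
      (fun i j h => ha0 _ (by rwa [abs_sub_comm]))).trans hbound)
  have h2 : ∫ ω, |upper ω| ∂μ ≤ θ / 3 * n :=
    integral_abs_le_of_integral_sq_le hupL hs ((integral_sq_lower_le hT hF₀ hmono hY hX hYb hXb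
      hYB hXB m l n (c n) (w := fun j i => a ((j : ℤ) - i)) (fun _ _ => ha _)
      (fun j i h => ha0 _ h)).trans hbound)
  have h3 : ∫ ω, |diag ω| ∂μ ≤ θ / 3 * n := by
    refine integral_abs_le_of_integral_sq_le hdiagL hs ((hC n m w hw).trans ?_)
    nlinarith
  have hexp : ∀ i j : ℕ, ∫ ω', process T.toEquiv X (i + l) ω' * process T.toEquiv Y (j + m) ω' ∂μ =
      if (i : ℤ) + l = j + m then e else 0 := by
    intro i j
    split_ifs with h
    · rw [h]
      exact integral_process hT (X * Y) _
    · exact hX.orthogonal hT hF₀ hmono hY h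
  have hsplit : ∀ ω, ∑ i ∈ Finset.Icc 1 n, ∑ j ∈ Finset.Icc 1 n, a ((j : ℤ) - i) *
        (process T.toEquiv X (i + l) ω * process T.toEquiv Y (j + m) ω -
          ∫ ω', process T.toEquiv X (i + l) ω' * process T.toEquiv Y (j + m) ω' ∂μ) =
      lower ω + upper ω + diag ω := by
    intro ω
    have hd : diag ω = ∑ i ∈ Finset.Icc 1 n, ∑ j ∈ Finset.Icc 1 n,
        (if (i : ℤ) + l = j + m then a ((j : ℤ) - i) else 0) * process T.toEquiv g (j + m) ω := by
      rw [Finset.sum_comm]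
      simp only [hdiag, hwdef, Finset.sum_mul]
    have hl : lower ω = ∑ i ∈ Finset.Icc 1 n, ∑ j ∈ Finset.Icc 1 n,
        (if (i : ℤ) + l < j + m then a ((j : ℤ) - i) else 0) *
          (process T.toEquiv X (i + l) ω * process T.toEquiv Y (j + m) ω) := Finset.sum_comm
    rw [hd, hl, hup]
    simp only [← Finset.sum_add_distrib]
    refine Finset.sum_congr rfl fun i _ => Finset.sum_congr rfl fun j _ => ?_
    rw [hexp]
    have hgp : process T.toEquiv g (j + m) ω =
        process T.toEquiv X (j + m) ω * process T.toEquiv Y (j + m) ω - e := rfl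
    rcases lt_trichotomy ((i : ℤ) + l) (j + m) with h | h | h
    · rw [if_neg h.ne, if_pos h, if_neg h.not_gt, if_neg h.ne]; ring
    · rw [if_pos h, if_neg h.not_lt, if_neg h.not_gt, if_pos h, hgp, h]; ring
    · rw [if_neg h.ne', if_neg h.not_gt, if_pos h, if_neg h.ne']; ring
  simp_rw [hsplit]
  have hi : ∀ {R : Ω → ℝ}, MemLp R 2 μ → Integrable (fun ω => |R ω|) μ :=
    fun hR => (hR.integrable (by norm_num)).abs
  calc _ ≤ ∫ ω, (|lower ω| + |upper ω| + |diag ω|) ∂μ := by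
        refine integral_mono (((hlowL.add hupL).add hdiagL).integrable (by norm_num)).abs
          (((hi hlowL).add (hi hupL)).add (hi hdiagL)) fun ω => ?_
        exact (abs_add_le _ _).trans (add_le_add_left (abs_add_le _ _) _)
    _ = ∫ ω, |lower ω| ∂μ + ∫ ω, |upper ω| ∂μ + ∫ ω, |diag ω| ∂μ := by
        have hlu : Integrable (fun ω => |lower ω| + |upper ω|) μ := (hi hlowL).add (hi hupL)
        rw [integral_add hlu (hi hdiagL), integral_add (hi hlowL) (hi hupL)]
    _ ≤ θ / 3 * n + θ / 3 * n + θ / 3 * n := by gcongr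
    _ = θ * n := by ring

/-- Banded quadratic forms in a finite moving average of bounded innovations concentrate around
their means. -/
lemma eventually_integral_abs_quadForm_sub_le [IsProbabilityMeasure μ]
    (hT : MeasurePreserving T μ μ) (hF₀ : F₀ ≤ mΩ) (hmono : F₀ ≤ F₀.comap T)
    (htail : ∀ s : Set Ω, MeasurableSet[⨅ i : ℤ, filt F₀ T.toEquiv i] s → μ s = 0 ∨ μ s = 1)
    {D : ℤ → Ω → ℝ} (hD : ∀ l, IsInnovation F₀ T.toEquiv μ (D l)) (hDb : ∀ l, MemLp (D l) ⊤ μ)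
    (A : Finset ℤ) {c : ℕ → ℕ}
    (hc : Tendsto (fun n => (c n : ℝ) / n) atTop (𝓝 0)) {θ : ℝ} (hθ : 0 < θ) :
    ∀ᶠ n : ℕ in atTop, ∀ a : ℤ → ℝ, (∀ k, |a k| ≤ 1) → (∀ k, 2 * (c n : ℤ) ≤ |k| → a k = 0) →
      ∫ ω, |quadForm a n (fun i => process T.toEquiv (∑ l ∈ A, process T.toEquiv (D l) l) i ω) -
        meanForm a n (acov T.toEquiv μ (∑ l ∈ A, process T.toEquiv (D l) l))| ∂μ ≤ θ * n := by
  set Z := ∑ l ∈ A, process T.toEquiv (D l) l with hZ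
  -- Expanding both factors gives `A.card ^ 2` cross terms; the added `1` covers an empty `A`.
  have hθ' : 0 < θ / ((A.card : ℝ) ^ 2 + 1) := by positivity
  have hev : ∀ᶠ n : ℕ in atTop, ∀ l ∈ A, ∀ m ∈ A, ∀ a : ℤ → ℝ, (∀ k, |a k| ≤ 1) →
      (∀ k, 2 * (c n : ℤ) ≤ |k| → a k = 0) →
      ∫ ω, |∑ i ∈ Finset.Icc 1 n, ∑ j ∈ Finset.Icc 1 n, a ((j : ℤ) - i) *
        (process T.toEquiv (D l) (i + l) ω * process T.toEquiv (D m) (j + m) ω -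
          ∫ ω', process T.toEquiv (D l) (i + l) ω' * process T.toEquiv (D m) (j + m) ω' ∂μ)| ∂μ ≤
        θ / ((A.card : ℝ) ^ 2 + 1) * n :=
    (Finset.eventually_all _).2 fun l _ => (Finset.eventually_all _).2 fun m _ =>
      eventually_integral_abs_cross_le hT hF₀ hmono htail (hD l) (hD m) (hDb l) (hDb m) l m hc hθ'
  have hDt : ∀ l i, MemLp (process T.toEquiv (D l) i) ⊤ μ := fun l i => memLp_process hT (hDb l) i
  have hZp : ∀ (i : ℕ) ω, process T.toEquiv Z i ω =
      ∑ l ∈ A, process T.toEquiv (D l) (i + l) ω := by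
    intro i ω
    have : process T.toEquiv Z i ω = ∑ l ∈ A, process T.toEquiv (process T.toEquiv (D l) l) i ω := by
      simp only [process, hZ, Finset.sum_apply]
    rw [this]
    exact Finset.sum_congr rfl fun l _ => by rw [process_process, add_comm]
  have hcov : ∀ i j : ℕ, acov T.toEquiv μ Z ((j : ℤ) - i) = ∑ l ∈ A, ∑ m ∈ A,
      ∫ ω', process T.toEquiv (D l) (i + l) ω' * process T.toEquiv (D m) (j + m) ω' ∂μ := by
    intro i j
    rw [← integral_process_mul_self hT]
    simp_rw [hZp, Finset.sum_mul_sum]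
    have hint : ∀ l m, Integrable (fun ω => process T.toEquiv (D l) (i + l) ω *
        process T.toEquiv (D m) (j + m) ω) μ := fun l m =>
      (memLp_two_of_top (hDt _ _)).integrable_mul (memLp_two_of_top (hDt _ _))
    rw [integral_finsetSum _ fun l _ => integrable_finsetSum _ fun m _ => hint l m]
    exact Finset.sum_congr rfl fun l _ => integral_finsetSum _ fun m _ => hint l m
  filter_upwards [hev] with n hn a ha ha0
  set R : ℤ → ℤ → Ω → ℝ := fun l m ω => ∑ i ∈ Finset.Icc 1 n, ∑ j ∈ Finset.Icc 1 n,
    a ((j : ℤ) - i) * (process T.toEquiv (D l) (i + l) ω * process T.toEquiv (D m) (j + m) ω -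
      ∫ ω', process T.toEquiv (D l) (i + l) ω' * process T.toEquiv (D m) (j + m) ω' ∂μ) with hR
  have hRi : ∀ l m, Integrable (R l m) μ := fun l m =>
    integrable_finsetSum _ fun i _ => integrable_finsetSum _ fun j _ =>
      (((memLp_two_of_top (hDt _ _)).integrable_mul (memLp_two_of_top (hDt _ _))).sub
        (integrable_const _)).const_mul _
  have hsplit : ∀ ω, quadForm a n (fun i => process T.toEquiv Z i ω) -
      meanForm a n (acov T.toEquiv μ Z) = ∑ l ∈ A, ∑ m ∈ A, R l m ω := by
    intro ω
    have e1 : ∀ i j : ℕ, a ((j : ℤ) - i) * (process T.toEquiv Z i ω * process T.toEquiv Z j ω) -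
        a ((j : ℤ) - i) * acov T.toEquiv μ Z ((j : ℤ) - i) = ∑ l ∈ A, ∑ m ∈ A, a ((j : ℤ) - i) *
        (process T.toEquiv (D l) (i + l) ω * process T.toEquiv (D m) (j + m) ω -
          ∫ ω', process T.toEquiv (D l) (i + l) ω' * process T.toEquiv (D m) (j + m) ω' ∂μ) := by
      intro i j
      rw [hcov, hZp, hZp, Finset.sum_mul_sum, ← mul_sub, ← Finset.sum_sub_distrib, Finset.mul_sum]
      refine Finset.sum_congr rfl fun l _ => ?_
      rw [← Finset.sum_sub_distrib, Finset.mul_sum]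
    simp only [quadForm, meanForm, ← Finset.sum_sub_distrib, e1, hR]
    calc _ = ∑ i ∈ Finset.Icc 1 n, ∑ l ∈ A, ∑ m ∈ A, ∑ j ∈ Finset.Icc 1 n, _ := by
          refine Finset.sum_congr rfl fun i _ => ?_
          rw [Finset.sum_comm]
          exact Finset.sum_congr rfl fun l _ => Finset.sum_comm
      _ = _ := by
          rw [Finset.sum_comm]
          exact Finset.sum_congr rfl fun l _ => Finset.sum_comm
  simp_rw [hsplit]
  calc _ ≤ ∫ ω, ∑ l ∈ A, ∑ m ∈ A, |R l m ω| ∂μ := by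
        refine integral_mono (integrable_finsetSum _ fun l _ => integrable_finsetSum _ fun m _ =>
          hRi l m).abs (integrable_finsetSum _ fun l _ => integrable_finsetSum _ fun m _ =>
          (hRi l m).abs) fun ω => ?_
        exact (Finset.abs_sum_le_sum_abs _ _).trans
          (Finset.sum_le_sum fun l _ => Finset.abs_sum_le_sum_abs _ _)
    _ = ∑ l ∈ A, ∑ m ∈ A, ∫ ω, |R l m ω| ∂μ := by
        rw [integral_finsetSum _ fun l _ => integrable_finsetSum _ fun m _ => (hRi l m).abs]
        exact Finset.sum_congr rfl fun l _ => integral_finsetSum _ fun m _ => (hRi l m).abs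
    _ ≤ ∑ l ∈ A, ∑ m ∈ A, θ / ((A.card : ℝ) ^ 2 + 1) * n :=
        Finset.sum_le_sum fun l hl => Finset.sum_le_sum fun m hm => hn l hl m hm a ha ha0
    _ = (A.card : ℝ) ^ 2 / ((A.card : ℝ) ^ 2 + 1) * (θ * n) := by
        rw [Finset.sum_const, Finset.sum_const, nsmul_eq_mul, nsmul_eq_mul]
        ring
    _ ≤ θ * n := by
        refine mul_le_of_le_one_left (by positivity) ?_
        rw [div_le_one (by positivity)]
        linarith

end Concentration

/-! ### Approximation by bounded moving averages; consistency for the errors. -/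

section Approximation

lemma sum_Icc_abs_le {γ : ℤ → ℝ} (hγ : Summable fun k => |γ k|) (n i : ℕ) :
    ∑ j ∈ Finset.Icc 1 n, |γ ((j : ℤ) - i)| ≤ ∑' k, |γ k| := by
  have h : ∑ j ∈ Finset.Icc 1 n, |γ ((j : ℤ) - i)| =
      ∑ k ∈ (Finset.Icc 1 n).image (fun j : ℕ => (j : ℤ) - i), |γ k| := by
    rw [Finset.sum_image]
    intro a _ b _ hab
    simp only at hab
    omega
  rw [h]
  exact hγ.sum_le_tsum _ fun _ _ => abs_nonneg _

lemma meanForm_le {γ : ℤ → ℝ} (hγ : Summable fun k => |γ k|) {a : ℤ → ℝ} {M : ℝ}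
    (ha : ∀ k, |a k| ≤ M) (n : ℕ) : meanForm a n γ ≤ M * n * ∑' k, |γ k| := by
  have hM : 0 ≤ M := (abs_nonneg _).trans (ha 0)
  calc meanForm a n γ ≤ ∑ i ∈ Finset.Icc 1 n, M * ∑ j ∈ Finset.Icc 1 n, |γ ((j : ℤ) - i)| := by
        refine Finset.sum_le_sum fun i _ => ?_
        rw [Finset.mul_sum]
        refine Finset.sum_le_sum fun j _ => (le_abs_self _).trans ?_
        rw [abs_mul]
        exact mul_le_mul_of_nonneg_right (ha _) (abs_nonneg _)
    _ ≤ ∑ i ∈ Finset.Icc 1 n, M * ∑' k, |γ k| := by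
        refine Finset.sum_le_sum fun i _ => ?_
        gcongr
        exact sum_Icc_abs_le hγ n i
    _ = _ := by rw [Finset.sum_const, Nat.card_Icc, nsmul_eq_mul, Nat.add_sub_cancel]; ring

variable {Ω : Type*} {F₀ : MeasurableSpace Ω} [mΩ : MeasurableSpace Ω]
  {μ : Measure Ω} {T : Ω ≃ᵐ Ω}

lemma integrable_quadForm {u : ℕ → Ω → ℝ} {n : ℕ} (hu : ∀ i ∈ Finset.Icc 1 n, MemLp (u i) 2 μ)
    (a : ℤ → ℝ) : Integrable (fun ω => quadForm a n (fun i => u i ω)) μ :=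
  integrable_finsetSum _ fun i hi => integrable_finsetSum _ fun j hj =>
    ((hu i hi).integrable_mul (hu j hj)).const_mul _

lemma integral_quadForm (hT : MeasurePreserving T μ μ) {Z : Ω → ℝ} (hZ : MemLp Z 2 μ)
    (a : ℤ → ℝ) (n : ℕ) :
    ∫ ω, quadForm a n (fun i => process T.toEquiv Z i ω) ∂μ =
      meanForm a n (acov T.toEquiv μ Z) := by
  have hint : ∀ i j : ℕ, Integrable (fun ω => a ((j : ℤ) - i) * (process T.toEquiv Z i ω *
      process T.toEquiv Z j ω)) μ := fun i j =>
    ((memLp_process hT hZ i).integrable_mul (memLp_process hT hZ j)).const_mul _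
  unfold quadForm meanForm
  rw [integral_finsetSum _ fun i _ => integrable_finsetSum _ fun j _ => hint i j]
  refine Finset.sum_congr rfl fun i _ => ?_
  rw [integral_finsetSum _ fun j _ => hint i j]
  refine Finset.sum_congr rfl fun j _ => ?_
  rw [integral_const_mul, integral_process_mul_self hT]

/-- Summability of the autocovariances bounds each row by a constant free of `c` and `t`; the
pathwise estimate would lose a factor `c` here. -/
lemma integral_dominatingForm_le (hT : MeasurePreserving T μ μ) {Z : Ω → ℝ} (hZ : MemLp Z 2 μ)
    (hγ : Summable fun k => |acov T.toEquiv μ Z k|) (c : ℕ) (t : ℝ) (n : ℕ) :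
    ∫ ω, dominatingForm c t n (fun i => process T.toEquiv Z i ω) ∂μ ≤
      3 * n * ∑' k, |acov T.toEquiv μ Z k| := by
  unfold dominatingForm
  rw [integral_quadForm hT hZ]
  exact meanForm_le hγ (abs_dominating_coeff_le c t) n

/-- The quadratic forms of two stationary sequences are close when the autocovariances of their
difference are small. -/
lemma integral_abs_quadForm_lagWindow_sub_le (hT : MeasurePreserving T μ μ) {Z W : Ω → ℝ}
    (hZ : MemLp Z 2 μ) (hW : MemLp W 2 μ) (hγ : Summable fun k => |acov T.toEquiv μ Z k|)
    (hδ : Summable fun k => |acov T.toEquiv μ (W - Z) k|) {c : ℕ} (hc : 0 < c) (t : ℝ) (n : ℕ)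
    {η : ℝ} (hη : 0 < η) :
    ∫ ω, |quadForm (lagWindow c t) n (fun i => process T.toEquiv W i ω) -
      quadForm (lagWindow c t) n (fun i => process T.toEquiv Z i ω)| ∂μ ≤
      3 * n * ((1 + 1 / η) * ∑' k, |acov T.toEquiv μ (W - Z) k| +
        η * ∑' k, |acov T.toEquiv μ Z k|) := by
  have hWZ : MemLp (W - Z) 2 μ := hW.sub hZ
  have i1 : Integrable (fun ω => dominatingForm c t n (fun i => process T.toEquiv (W - Z) i ω)) μ :=
    integrable_quadForm (fun i _ => memLp_process hT hWZ i) _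
  have i2 : Integrable (fun ω => dominatingForm c t n (fun i => process T.toEquiv Z i ω)) μ :=
    integrable_quadForm (fun i _ => memLp_process hT hZ i) _
  calc _ ≤ ∫ ω, ((1 + 1 / η) * dominatingForm c t n (fun i => process T.toEquiv (W - Z) i ω) +
        η * dominatingForm c t n (fun i => process T.toEquiv Z i ω)) ∂μ := by
        refine integral_mono_of_nonneg (Eventually.of_forall fun ω => abs_nonneg _)
          ((i1.const_mul _).add (i2.const_mul _)) (Eventually.of_forall fun ω => ?_)
        exact abs_quadForm_lagWindow_sub_le hc n t _ _ hη
    _ = (1 + 1 / η) * ∫ ω, dominatingForm c t n (fun i => process T.toEquiv (W - Z) i ω) ∂μ +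
        η * ∫ ω, dominatingForm c t n (fun i => process T.toEquiv Z i ω) ∂μ := by
        rw [integral_add (i1.const_mul _) (i2.const_mul _), integral_const_mul, integral_const_mul]
    _ ≤ (1 + 1 / η) * (3 * n * ∑' k, |acov T.toEquiv μ (W - Z) k|) +
        η * (3 * n * ∑' k, |acov T.toEquiv μ Z k|) := by
        gcongr
        · exact integral_dominatingForm_le hT hWZ hδ c t n
        · exact integral_dominatingForm_le hT hZ hγ c t n
    _ = _ := by ring

lemma acov_neg_fun (Z : Ω → ℝ) (k : ℤ) : acov T.toEquiv μ (-Z) k = acov T.toEquiv μ Z k := by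
  refine integral_congr_ae (Eventually.of_forall fun ω => ?_)
  simp only [process, Pi.neg_apply, neg_mul_neg]

/-- A moving average with absolutely summable innovations is approximated, in the sense of
autocovariances, by finite moving averages of bounded innovations. -/
lemma exists_bounded_approximation [IsProbabilityMeasure μ] (hT : MeasurePreserving T μ μ)
    (hF₀ : F₀ ≤ mΩ) (hmono : F₀ ≤ F₀.comap T) {D : ℤ → Ω → ℝ}
    (hD : ∀ l, IsInnovation F₀ T.toEquiv μ (D l))
    (hs : Summable fun l => ‖(hD l).memLp.toLp (D l)‖) {Z : Ω → ℝ} (hZ : MemLp Z 2 μ)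
    (hsum : HasSum (fun l => koopman hT l ((hD l).memLp.toLp (D l))) (hZ.toLp Z))
    {δ : ℝ} (hδ : 0 < δ) :
    ∃ (E : ℤ → Ω → ℝ) (A : Finset ℤ), (∀ l, IsInnovation F₀ T.toEquiv μ (E l)) ∧
      (∀ l, MemLp (E l) ⊤ μ) ∧
      (Summable fun k => |acov T.toEquiv μ ((∑ l ∈ A, process T.toEquiv (E l) l) - Z) k|) ∧
      ∑' k, |acov T.toEquiv μ ((∑ l ∈ A, process T.toEquiv (E l) l) - Z) k| ≤ δ := by
  -- The autocovariances of the difference sum to at most the square of the total innovation norm,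
  -- so that norm must be at most `√δ`: one half for the tail outside `A`, the other shared among
  -- the indices of `A`.
  set r := Real.sqrt δ / 2 with hr
  have hr0 : 0 < r := by positivity
  obtain ⟨A, hA⟩ := ((tendsto_tsum_compl_atTop_zero
    (fun l => ‖(hD l).memLp.toLp (D l)‖)).eventually_lt_const hr0).exists
  have hq : 0 < r / (A.card + 1) := by positivity
  choose E₀ hE₀ hE₀b hE₀d using fun l =>
    (hD l).exists_bounded hT hF₀ hmono (δ := ENNReal.ofReal (r / (A.card + 1)))
      (by rw [Ne, ENNReal.ofReal_eq_zero, not_le]; exact hq)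
  set E : ℤ → Ω → ℝ := fun l => if l ∈ A then E₀ l else 0 with hE
  have hEi : ∀ l, IsInnovation F₀ T.toEquiv μ (E l) := by
    intro l
    simp only [hE]
    split_ifs
    · exact hE₀ l
    · exact isInnovation_zero
  have hEb : ∀ l, MemLp (E l) ⊤ μ := by
    intro l
    simp only [hE]
    split_ifs
    · exact hE₀b l
    · exact MemLp.zero
  have hG : ∀ l, IsInnovation F₀ T.toEquiv μ (D l - E l) := fun l => (hD l).sub (hEi l)
  have hGin : ∀ l ∈ A, ‖(hG l).memLp.toLp (D l - E l)‖ ≤ r / (A.card + 1) := by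
    intro l hl
    rw [Lp.norm_toLp]
    refine ENNReal.toReal_le_of_le_ofReal hq.le ?_
    simp only [hE, if_pos hl]
    exact hE₀d l
  have hGout : ∀ l, l ∉ A → ‖(hG l).memLp.toLp (D l - E l)‖ = ‖(hD l).memLp.toLp (D l)‖ := by
    intro l hl
    rw [Lp.norm_toLp, Lp.norm_toLp]
    simp only [hE, if_neg hl, sub_zero]
  have hGs : Summable fun l => ‖(hG l).memLp.toLp (D l - E l)‖ := by
    rw [← A.summable_compl_iff]
    have h1 := A.summable_compl_iff.2 hs
    exact h1.congr fun l => (hGout l l.2).symm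
  have hGt : ∑' l, ‖(hG l).memLp.toLp (D l - E l)‖ ≤ Real.sqrt δ := by
    rw [← hGs.sum_add_tsum_subtype_compl A]
    have h1 : ∑ l ∈ A, ‖(hG l).memLp.toLp (D l - E l)‖ ≤ r := by
      refine (Finset.sum_le_sum hGin).trans ?_
      rw [Finset.sum_const, nsmul_eq_mul, mul_div_assoc', div_le_iff₀ (by positivity)]
      nlinarith
    have h2 : ∑' l : {l // l ∉ A}, ‖(hG l).memLp.toLp (D l - E l)‖ ≤ r := by
      rw [tsum_congr fun l : {l // l ∉ A} => hGout l l.2]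
      exact hA.le
    linarith
  set W := ∑ l ∈ A, process T.toEquiv (E l) l with hW
  have hWL : MemLp W 2 μ := memLp_finsetSum' _ fun l _ => memLp_process hT (hEi l).memLp l
  have hWsum : HasSum (fun l => koopman hT l ((hEi l).memLp.toLp (E l))) (hWL.toLp W) := by
    have h1 : hWL.toLp W = ∑ l ∈ A, koopman hT l ((hEi l).memLp.toLp (E l)) := by
      refine Lp.ext (hWL.coeFn_toLp.trans ?_)
      refine EventuallyEq.trans ?_ (Lp.coeFn_finsetSum _ _).symm
      have h2 : ∀ l ∈ A, ∀ᵐ ω ∂μ, koopman hT l ((hEi l).memLp.toLp (E l)) ω =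
          process T.toEquiv (E l) l ω := fun l _ => by
        rw [koopman_toLp]; exact MemLp.coeFn_toLp _
      filter_upwards [(Finset.eventually_all _).2 h2] with ω hω
      rw [hW, Finset.sum_apply, Finset.sum_apply]
      exact (Finset.sum_congr rfl hω).symm
    rw [h1]
    refine hasSum_sum_of_ne_finset_zero fun l hl => ?_
    have h0 : (hEi l).memLp.toLp (E l) = 0 := by
      rw [← norm_eq_zero, Lp.norm_toLp]
      simp [hE, hl]
    rw [h0, map_zero]
  have hsub : HasSum (fun l => koopman hT l ((hG l).memLp.toLp (D l - E l)))
      ((hZ.sub hWL).toLp (Z - W)) := by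
    rw [MemLp.toLp_sub hZ hWL]
    refine (hsum.sub hWsum).congr_fun fun l => ?_
    rw [← map_sub, MemLp.toLp_sub (hD l).memLp (hEi l).memLp]
  have hfin := summable_acov hT hF₀ hmono hG hGs (hZ.sub hWL) hsub
  have hneg : ∀ k, acov T.toEquiv μ (W - Z) k = acov T.toEquiv μ (Z - W) k := by
    intro k
    rw [← neg_sub, acov_neg_fun]
  refine ⟨E, A, hEi, hEb, ?_, ?_⟩
  · change Summable fun k => |acov T.toEquiv μ (W - Z) k|
    simp_rw [hneg]
    exact hfin.1
  · change ∑' k, |acov T.toEquiv μ (W - Z) k| ≤ δ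
    simp_rw [hneg]
    refine hfin.2.trans ?_
    calc _ ≤ Real.sqrt δ ^ 2 := by gcongr
      _ = δ := Real.sq_sqrt hδ.le

/-- Consistency of the lag window form based on the errors themselves. -/
lemma eventually_integral_abs_quadForm_errors_le [IsProbabilityMeasure μ]
    (hT : MeasurePreserving T μ μ) (hF₀ : F₀ ≤ mΩ) (hmono : F₀ ≤ F₀.comap T)
    (htail : ∀ s : Set Ω, MeasurableSet[⨅ i : ℤ, filt F₀ T.toEquiv i] s → μ s = 0 ∨ μ s = 1)
    {D : ℤ → Ω → ℝ} (hD : ∀ l, IsInnovation F₀ T.toEquiv μ (D l))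
    (hs : Summable fun l => ‖(hD l).memLp.toLp (D l)‖) {Z : Ω → ℝ} (hZ : MemLp Z 2 μ)
    (hsum : HasSum (fun l => koopman hT l ((hD l).memLp.toLp (D l))) (hZ.toLp Z))
    {c : ℕ → ℕ} (hcpos : ∀ n, 0 < c n) (hc : Tendsto c atTop atTop)
    (hcn : Tendsto (fun n => (c n : ℝ) / n) atTop (𝓝 0)) {θ : ℝ} (hθ : 0 < θ) :
    ∀ᶠ n : ℕ in atTop, ∀ t : ℝ,
      ∫ ω, |quadForm (lagWindow (c n) t) n (fun i => process T.toEquiv Z i ω) -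
        2 * Real.pi * n * densityOf (acov T.toEquiv μ Z) t| ∂μ ≤ θ * n := by
  have hγ := (summable_acov hT hF₀ hmono hD hs hZ hsum).1
  set Γ := ∑' k, |acov T.toEquiv μ Z k| with hΓ
  have hΓ0 : 0 ≤ Γ := tsum_nonneg fun _ => abs_nonneg _
  -- With `ηΓ ≤ θ / 24`, and the approximation term also at most `θ / 24`, the perturbation bound is
  -- `3n(θ/24 + θ/24) = θn / 4`.
  set η := θ / (24 * (Γ + 1)) with hη
  have hη0 : 0 < η := by positivity
  obtain ⟨E, A, hEi, hEb, hδ, hδle⟩ := exists_bounded_approximation hT hF₀ hmono hD hs hZ hsum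
    (δ := θ / (24 * (1 + 1 / η))) (by positivity)
  set W := ∑ l ∈ A, process T.toEquiv (E l) l with hW
  have hWL : MemLp W 2 μ := memLp_finsetSum' _ fun l _ => memLp_process hT (hEi l).memLp l
  have happ : ∀ (n : ℕ) (t : ℝ),
      ∫ ω, |quadForm (lagWindow (c n) t) n (fun i => process T.toEquiv W i ω) -
        quadForm (lagWindow (c n) t) n (fun i => process T.toEquiv Z i ω)| ∂μ ≤ θ / 4 * n := by
    intro n t
    refine (integral_abs_quadForm_lagWindow_sub_le hT hZ hWL hγ hδ (hcpos n) t n hη0).trans ?_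
    have h1 : (1 + 1 / η) * ∑' k, |acov T.toEquiv μ (W - Z) k| ≤ θ / 24 := by
      calc _ ≤ (1 + 1 / η) * (θ / (24 * (1 + 1 / η))) := by gcongr
        _ = θ / 24 := by
          have : 1 + 1 / η ≠ 0 := by positivity
          field_simp
    have h2 : η * Γ ≤ θ / 24 := by
      rw [hη, div_mul_eq_mul_div, div_le_div_iff₀ (by positivity) (by positivity)]
      nlinarith
    have hn : (0 : ℝ) ≤ n := Nat.cast_nonneg n
    calc _ ≤ 3 * (n : ℝ) * (θ / 24 + θ / 24) := by gcongr
      _ = θ / 4 * n := by ring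
  have hconc := eventually_integral_abs_quadForm_sub_le hT hF₀ hmono htail hEi hEb A hcn
    (θ := θ / 4) (by positivity)
  have hbias := (tendsto_bias hγ hc).eventually_lt_const (show 0 < θ / 4 by positivity)
  filter_upwards [hconc, hbias, eventually_gt_atTop 0] with n h1 h2 hn t
  have hn' : (0 : ℝ) ≤ n := Nat.cast_nonneg n
  set a := lagWindow (c n) t with ha
  set qZ : Ω → ℝ := fun ω => quadForm a n (fun i => process T.toEquiv Z i ω) with hqZ
  set qW : Ω → ℝ := fun ω => quadForm a n (fun i => process T.toEquiv W i ω) with hqW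
  set mZ := meanForm a n (acov T.toEquiv μ Z) with hmZ
  set mW := meanForm a n (acov T.toEquiv μ W) with hmW
  have iZ : Integrable qZ μ := integrable_quadForm (fun i _ => memLp_process hT hZ i) _
  have iW : Integrable qW μ := integrable_quadForm (fun i _ => memLp_process hT hWL i) _
  have eWZ : ∫ ω, |qW ω - qZ ω| ∂μ ≤ θ / 4 * n := happ n t
  have eW : ∫ ω, |qW ω - mW| ∂μ ≤ θ / 4 * n :=
    h1 a (abs_lagWindow_le_one _ _) fun k hk => lagWindow_eq_zero (hcpos n) t hk
  -- The means differ by no more than the `L¹` distance of the forms. The four errors of `θ / 4` are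
  -- thus approximation, concentration, difference of means and bias.
  have em : |mW - mZ| ≤ θ / 4 * n := by
    rw [hmW, hmZ, ← integral_quadForm hT hWL, ← integral_quadForm hT hZ, ← integral_sub iW iZ]
    exact abs_integral_le_integral_abs.trans eWZ
  have eb : |mZ - 2 * Real.pi * n * densityOf (acov T.toEquiv μ Z) t| ≤ θ / 4 * n := by
    refine (abs_meanForm_sub_le hγ hn (c n) t).trans ?_
    rw [mul_comm]
    gcongr
  have iWZ : Integrable (fun ω => |qW ω - qZ ω|) μ := (iW.sub iZ).abs
  have iWm : Integrable (fun ω => |qW ω - mW|) μ := (iW.sub (integrable_const _)).abs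
  have isum : Integrable (fun ω => |qW ω - qZ ω| + |qW ω - mW|) μ := iWZ.add iWm
  calc _ ≤ ∫ ω, ((|qW ω - qZ ω| + |qW ω - mW|) + (θ / 4 * n + θ / 4 * n)) ∂μ := by
        refine integral_mono_of_nonneg (Eventually.of_forall fun ω => abs_nonneg _)
          (isum.add (integrable_const _)) (Eventually.of_forall fun ω => ?_)
        simp only
        have a1 := abs_le.1 (le_refl |qW ω - qZ ω|)
        have a2 := abs_le.1 (le_refl |qW ω - mW|)
        have a3 := abs_le.1 em
        have a4 := abs_le.1 eb
        change |qZ ω - _| ≤ _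
        rw [abs_le]
        constructor <;> linarith [a1.1, a1.2, a2.1, a2.2, a3.1, a3.2, a4.1, a4.2]
    _ = ∫ ω, |qW ω - qZ ω| ∂μ + ∫ ω, |qW ω - mW| ∂μ + (θ / 4 * n + θ / 4 * n) := by
        rw [integral_add isum (integrable_const _), integral_add iWZ iWm]
        simp
    _ ≤ θ / 4 * n + θ / 4 * n + (θ / 4 * n + θ / 4 * n) := by gcongr
    _ = θ * n := by ring

end Approximation

/-! ### Least squares residuals. -/

section Residuals

open Matrix

lemma sum_Icc_one_eq_sum_fin {M : Type*} [AddCommMonoid M] (n : ℕ) (f : ℕ → M) :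
    ∑ i ∈ Finset.Icc 1 n, f i = ∑ a : Fin n, f (a.val + 1) := by
  rw [← Finset.sum_range fun i => f (i + 1), Finset.range_eq_Ico, Finset.sum_Ico_add' f 0 n 1]
  rfl

lemma gram_apply {p : ℕ} (x : ℕ → Fin p → ℝ) (n : ℕ) (j l : Fin p) :
    ((designMatrix x n)ᵀ * designMatrix x n) j l = ∑ m ∈ Finset.Icc 1 n, x m j * x m l := by
  rw [sum_Icc_one_eq_sum_fin, Matrix.mul_apply]
  rfl

/-- After rescaling by the column norms the Gram matrix converges to `R(0)`, whose determinant is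
positive. A singular Gram matrix would give a singular rescaled one, so column norms need not be
known to be nonzero. -/
lemma eventually_isUnit_det_gram {p : ℕ} (x : ℕ → Fin p → ℝ) (ρ : Fin p → Fin p → ℕ → ℝ)
    (hC4 : ∀ j l k, Tendsto
      (fun n : ℕ => ∑ m ∈ Finset.Icc 1 (n - k), x m j * x (m + k) l / (colNorm x j n * colNorm x l n))
      atTop (𝓝 (ρ j l k)))
    (hC5 : (Matrix.of fun j l => ρ j l 0).PosDef) :
    ∀ᶠ n in atTop, IsUnit ((designMatrix x n)ᵀ * designMatrix x n).det := by
  set N : ℕ → Matrix (Fin p) (Fin p) ℝ := fun n =>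
    Matrix.diagonal (fun j => (colNorm x j n)⁻¹) * ((designMatrix x n)ᵀ * designMatrix x n) *
      Matrix.diagonal (fun j => (colNorm x j n)⁻¹) with hN
  have hlim : Tendsto N atTop (𝓝 (Matrix.of fun j l => ρ j l 0)) := by
    refine tendsto_pi_nhds.2 fun j => tendsto_pi_nhds.2 fun l => ?_
    refine (hC4 j l 0).congr fun n => ?_
    simp only [hN, Matrix.mul_diagonal, Matrix.diagonal_mul, gram_apply, Nat.sub_zero, add_zero]
    rw [← Finset.sum_div, div_eq_mul_inv, mul_inv]
    ring
  have hdet : Tendsto (fun n => (N n).det) atTop (𝓝 (Matrix.of fun j l => ρ j l 0).det) :=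
    ((Continuous.matrix_det continuous_id).tendsto _).comp hlim
  filter_upwards [hdet.eventually_const_lt hC5.det_pos] with n hn
  rw [isUnit_iff_ne_zero]
  intro h0
  simp only [hN] at hn
  rw [Matrix.det_mul, Matrix.det_mul, h0, mul_zero, zero_mul] at hn
  exact lt_irrefl _ hn

/-- The orthogonal projection on the column space of the design matrix. -/
def hatMatrix {p : ℕ} (x : ℕ → Fin p → ℝ) (n : ℕ) : Matrix (Fin n) (Fin n) ℝ :=
  designMatrix x n * ((designMatrix x n)ᵀ * designMatrix x n)⁻¹ * (designMatrix x n)ᵀ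

lemma hatMatrix_transpose_mul_self {p : ℕ} {x : ℕ → Fin p → ℝ} {n : ℕ}
    (h : IsUnit ((designMatrix x n)ᵀ * designMatrix x n).det) :
    (hatMatrix x n)ᵀ * hatMatrix x n = hatMatrix x n := by
  set X := designMatrix x n with hX
  have hsymm : (hatMatrix x n)ᵀ = hatMatrix x n := by
    simp only [hatMatrix, Matrix.transpose_mul, Matrix.transpose_transpose,
      Matrix.transpose_nonsing_inv, Matrix.mul_assoc]
  rw [hsymm]
  calc hatMatrix x n * hatMatrix x n = X * ((Xᵀ * X)⁻¹ * (Xᵀ * X)) * (Xᵀ * X)⁻¹ * Xᵀ := by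
        simp only [hatMatrix, ← hX, Matrix.mul_assoc]
    _ = hatMatrix x n := by rw [Matrix.nonsing_inv_mul _ h, Matrix.mul_one]; rfl

lemma trace_hatMatrix {p : ℕ} {x : ℕ → Fin p → ℝ} {n : ℕ}
    (h : IsUnit ((designMatrix x n)ᵀ * designMatrix x n).det) : (hatMatrix x n).trace = p := by
  rw [hatMatrix, Matrix.mul_assoc, Matrix.trace_mul_comm, Matrix.mul_assoc,
    Matrix.nonsing_inv_mul _ h, Matrix.trace_one, Fintype.card_fin]

/-- The residuals are the errors minus their projection on the column space of the design. -/
lemma residual_eq {Ω : Type*} {p : ℕ} {x : ℕ → Fin p → ℝ} (β : Fin p → ℝ) (ε : ℤ → Ω → ℝ) {n : ℕ}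
    (h : IsUnit ((designMatrix x n)ᵀ * designMatrix x n).det) (a : Fin n) (ω : Ω) :
    residual x (response x β ε) n (a.val + 1) ω =
      ε ((a.val + 1 : ℕ) : ℤ) ω - (hatMatrix x n *ᵥ fun b : Fin n => ε ((b.val + 1 : ℕ) : ℤ) ω) a := by
  set X := designMatrix x n with hX
  set e : Fin n → ℝ := fun b => ε ((b.val + 1 : ℕ) : ℤ) ω with he
  have hrow : ∀ v : Fin p → ℝ, ∑ j, x (a.val + 1) j * v j = (X *ᵥ v) a := fun v => rfl
  have hY : (fun i : Fin n => response x β ε (i.val + 1) ω) = X *ᵥ β + e := rfl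
  have hls : leastSquares x (response x β ε) n ω = β + ((Xᵀ * X)⁻¹ * Xᵀ) *ᵥ e := by
    rw [leastSquares, hY, Matrix.mulVec_add, Matrix.mulVec_mulVec, ← hX, Matrix.mul_assoc,
      Matrix.nonsing_inv_mul _ h, Matrix.one_mulVec]
  rw [residual, hrow, hls, Matrix.mulVec_add, Pi.add_apply, Matrix.mulVec_mulVec, response, hrow,
    ← Matrix.mul_assoc]
  change _ + e a - _ = e a - (hatMatrix x n *ᵥ e) a
  rw [hatMatrix]
  ring

variable {Ω : Type*} [mΩ : MeasurableSpace Ω] {μ : Measure Ω} {T : Ω ≃ᵐ Ω}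

/-- The mean squared length of the image of a stationary vector under an orthogonal projection is at
most its rank times the total mass of the autocovariances. -/
lemma integral_sum_sq_mulVec_le (hT : MeasurePreserving T μ μ) {Z : Ω → ℝ} (hZ : MemLp Z 2 μ)
    (hγ : Summable fun k => |acov T.toEquiv μ Z k|) {n : ℕ} {M : Matrix (Fin n) (Fin n) ℝ}
    (hM : Mᵀ * M = M) :
    ∫ ω, ∑ a, (M *ᵥ fun b : Fin n => process T.toEquiv Z ((b.val + 1 : ℕ) : ℤ) ω) a ^ 2 ∂μ ≤
      M.trace * ∑' k, |acov T.toEquiv μ Z k| := by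
  set γ := acov T.toEquiv μ Z with hγdef
  set Γ := ∑' k, |γ k| with hΓ
  have hentry : ∀ k l, M k l = ∑ a, M a k * M a l := by
    intro k l
    conv_lhs => rw [← hM, Matrix.mul_apply]
    rfl
  have hdiag : ∀ k, 0 ≤ M k k := fun k => by
    rw [hentry]
    exact Finset.sum_nonneg fun a _ => mul_self_nonneg _
  -- An entry of `M` is an inner product of two columns, hence at most the average of two diagonal
  -- entries. Together with the row sums of `|γ|` this leaves the trace times `Γ`.
  have habs : ∀ k l, |M k l| ≤ (M k k + M l l) / 2 := by
    intro k l
    rw [hentry k l, hentry k k, hentry l l, ← Finset.sum_add_distrib, Finset.sum_div]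
    refine (Finset.abs_sum_le_sum_abs _ _).trans (Finset.sum_le_sum fun a _ => ?_)
    rw [abs_le]
    constructor <;> nlinarith [sq_nonneg (M a k - M a l), sq_nonneg (M a k + M a l)]
  have hform : ∀ e : Fin n → ℝ, ∑ a, (M *ᵥ e) a ^ 2 = ∑ k, ∑ l, M k l * (e k * e l) := by
    intro e
    simp only [Matrix.mulVec, dotProduct, sq, Finset.sum_mul_sum]
    rw [Finset.sum_comm]
    refine Finset.sum_congr rfl fun k _ => ?_
    rw [Finset.sum_comm]
    refine Finset.sum_congr rfl fun l _ => ?_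
    rw [hentry k l, Finset.sum_mul]
    exact Finset.sum_congr rfl fun a _ => by ring
  have hrow : ∀ k : Fin n, ∑ l : Fin n, |γ (((l.val + 1 : ℕ) : ℤ) - ((k.val + 1 : ℕ) : ℤ))| ≤ Γ := by
    intro k
    have := sum_Icc_abs_le hγ n (k.val + 1)
    rwa [sum_Icc_one_eq_sum_fin] at this
  have hint : ∀ k l : Fin n, Integrable (fun ω => M k l *
      (process T.toEquiv Z ((k.val + 1 : ℕ) : ℤ) ω * process T.toEquiv Z ((l.val + 1 : ℕ) : ℤ) ω)) μ :=
    fun k l => ((memLp_process hT hZ _).integrable_mul (memLp_process hT hZ _)).const_mul _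
  simp_rw [hform]
  rw [integral_finsetSum _ fun k _ => integrable_finsetSum _ fun l _ => hint k l]
  simp_rw [integral_finsetSum _ fun l _ => hint _ l, integral_const_mul,
    integral_process_mul_self hT]
  calc _ ≤ ∑ k : Fin n, ∑ l : Fin n,
        (M k k / 2 * |γ (((l.val + 1 : ℕ) : ℤ) - ((k.val + 1 : ℕ) : ℤ))| +
          M l l / 2 * |γ (((k.val + 1 : ℕ) : ℤ) - ((l.val + 1 : ℕ) : ℤ))|) := by
        refine Finset.sum_le_sum fun k _ => Finset.sum_le_sum fun l _ => (le_abs_self _).trans ?_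
        have e1 : γ (((k.val + 1 : ℕ) : ℤ) - ((l.val + 1 : ℕ) : ℤ)) =
            γ (((l.val + 1 : ℕ) : ℤ) - ((k.val + 1 : ℕ) : ℤ)) := by
          rw [hγdef, ← acov_neg hT, neg_sub]
        rw [e1, abs_mul, ← add_mul, ← add_div]
        exact mul_le_mul_of_nonneg_right (habs k l) (abs_nonneg _)
    _ = ∑ k : Fin n, M k k * ∑ l : Fin n,
          |γ (((l.val + 1 : ℕ) : ℤ) - ((k.val + 1 : ℕ) : ℤ))| := by
        simp_rw [Finset.sum_add_distrib]
        rw [Finset.sum_comm (f := fun k l : Fin n =>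
          M l l / 2 * |γ (((k.val + 1 : ℕ) : ℤ) - ((l.val + 1 : ℕ) : ℤ))|), ← Finset.sum_add_distrib]
        refine Finset.sum_congr rfl fun k _ => ?_
        rw [← Finset.mul_sum]
        ring
    _ ≤ ∑ k : Fin n, M k k * Γ :=
        Finset.sum_le_sum fun k _ => mul_le_mul_of_nonneg_left (hrow k) (hdiag k)
    _ = M.trace * Γ := by rw [← Finset.sum_mul]; rfl

lemma memLp_residual (hT : MeasurePreserving T μ μ) {Z : Ω → ℝ} (hZ : MemLp Z 2 μ) {p : ℕ}
    {x : ℕ → Fin p → ℝ} (β : Fin p → ℝ) {n : ℕ}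
    (h : IsUnit ((designMatrix x n)ᵀ * designMatrix x n).det) {i : ℕ} (hi : i ∈ Finset.Icc 1 n) :
    MemLp (residual x (response x β (process T.toEquiv Z)) n i) 2 μ := by
  rw [Finset.mem_Icc] at hi
  obtain ⟨a, rfl⟩ : ∃ a : Fin n, i = a.val + 1 := ⟨⟨i - 1, by omega⟩, by simp only; omega⟩
  have e : residual x (response x β (process T.toEquiv Z)) n (a.val + 1) = fun ω =>
      process T.toEquiv Z ((a.val + 1 : ℕ) : ℤ) ω -
        ∑ b, hatMatrix x n a b * process T.toEquiv Z ((b.val + 1 : ℕ) : ℤ) ω :=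
    funext fun ω => residual_eq β _ h a ω
  rw [e]
  exact (memLp_process hT hZ _).sub (memLp_finsetSum _ fun b _ =>
    (memLp_process hT hZ _).const_mul _)

/-- Replacing the errors by the residuals does not change the lag window form asymptotically. -/
lemma eventually_integral_abs_quadForm_residual_le (hT : MeasurePreserving T μ μ) {Z : Ω → ℝ}
    (hZ : MemLp Z 2 μ) (hγ : Summable fun k => |acov T.toEquiv μ Z k|) {p : ℕ}
    {x : ℕ → Fin p → ℝ} (β : Fin p → ℝ)
    (hdet : ∀ᶠ n in atTop, IsUnit ((designMatrix x n)ᵀ * designMatrix x n).det)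
    {c : ℕ → ℕ} (hcpos : ∀ n, 0 < c n)
    (hcn : Tendsto (fun n => (c n : ℝ) / n) atTop (𝓝 0)) {θ : ℝ} (hθ : 0 < θ) :
    ∀ᶠ n : ℕ in atTop, ∀ t : ℝ,
      ∫ ω, |quadForm (lagWindow (c n) t) n
          (fun i => residual x (response x β (process T.toEquiv Z)) n i ω) -
        quadForm (lagWindow (c n) t) n (fun i => process T.toEquiv Z i ω)| ∂μ ≤ θ * n := by
  set Γ := ∑' k, |acov T.toEquiv μ Z k| with hΓ
  have hΓ0 : 0 ≤ Γ := tsum_nonneg fun _ => abs_nonneg _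
  -- The term `η · 3nΓ` then takes at most half of `θn`. The other half pays for the projection,
  -- whose cost `(1 + 1/η) · 12 c · pΓ` equals `C * c`.
  set η := θ / (6 * (Γ + 1)) with hη
  have hη0 : 0 < η := by positivity
  set C := (1 + 1 / η) * (12 * (p * Γ)) with hC
  have hC0 : 0 ≤ C := by positivity
  have hlim : Tendsto (fun n => C * ((c n : ℝ) / n)) atTop (𝓝 0) := by
    simpa using hcn.const_mul C
  filter_upwards [hdet, hlim.eventually_lt_const (show 0 < θ / 2 by positivity),
    eventually_gt_atTop 0] with n hu hn1 hn t
  have hn' : (0 : ℝ) < n := by exact_mod_cast hn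
  set u : ℕ → Ω → ℝ := fun i => residual x (response x β (process T.toEquiv Z)) n i with hudef
  set s : Ω → ℝ := fun ω => ∑ i ∈ Finset.Icc 1 n, (u i ω - process T.toEquiv Z i ω) ^ 2 with hs
  have hsi : Integrable s μ := integrable_finsetSum _ fun i hi =>
    ((memLp_residual hT hZ β hu hi).sub (memLp_process hT hZ i)).integrable_sq
  have hse : ∀ ω, s ω = ∑ a, (hatMatrix x n *ᵥ fun b : Fin n =>
      process T.toEquiv Z ((b.val + 1 : ℕ) : ℤ) ω) a ^ 2 := by
    intro ω
    simp only [hs, hudef]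
    rw [sum_Icc_one_eq_sum_fin]
    refine Finset.sum_congr rfl fun a _ => ?_
    rw [residual_eq β _ hu a ω]
    ring
  have hsint : ∫ ω, s ω ∂μ ≤ p * Γ := by
    simp_rw [hse]
    have := integral_sum_sq_mulVec_le hT hZ hγ (hatMatrix_transpose_mul_self hu)
    rwa [trace_hatMatrix hu] at this
  have idom : Integrable (fun ω => dominatingForm (c n) t n (fun i => process T.toEquiv Z i ω)) μ :=
    integrable_quadForm (fun i _ => memLp_process hT hZ i) _
  have hcp : 0 < c n := hcpos n
  calc _ ≤ ∫ ω, ((1 + 1 / η) * (12 * c n) * s ω +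
        η * dominatingForm (c n) t n (fun i => process T.toEquiv Z i ω)) ∂μ := by
        refine integral_mono_of_nonneg (Eventually.of_forall fun ω => abs_nonneg _)
          ((hsi.const_mul _).add (idom.const_mul _)) (Eventually.of_forall fun ω => ?_)
        refine (abs_quadForm_lagWindow_sub_le hcp n t _ _ hη0).trans ?_
        have := dominatingForm_le hcp t n (fun i => u i ω - process T.toEquiv Z i ω)
        refine add_le_add_left ?_ _
        rw [mul_assoc]
        exact mul_le_mul_of_nonneg_left this (by positivity)
    _ = (1 + 1 / η) * (12 * c n) * ∫ ω, s ω ∂μ +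
        η * ∫ ω, dominatingForm (c n) t n (fun i => process T.toEquiv Z i ω) ∂μ := by
        rw [integral_add (hsi.const_mul _) (idom.const_mul _), integral_const_mul, integral_const_mul]
    _ ≤ (1 + 1 / η) * (12 * c n) * (p * Γ) + η * (3 * n * Γ) := by
        gcongr
        exact integral_dominatingForm_le hT hZ hγ (c n) t n
    _ = C * (c n / n) * n + 3 * (η * Γ) * n := by rw [hC]; field_simp
    _ ≤ θ / 2 * n + 3 * (θ / 6) * n := by
        have h2 : η * Γ ≤ θ / 6 := by
          rw [hη, div_mul_eq_mul_div, div_le_div_iff₀ (by positivity) (by positivity)]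
          nlinarith
        gcongr
    _ = θ * n := by ring

end Residuals

/-! ### The bandwidth, the spectral density and consistency for the residuals. -/

section Consistency

variable {Ω : Type*} {F₀ : MeasurableSpace Ω} [mΩ : MeasurableSpace Ω]
  {μ : Measure Ω} {T : Ω ≃ᵐ Ω}

/-- The moment condition forces the bandwidth to be negligible with respect to the sample size. -/
lemma tendsto_bandwidth_div [IsProbabilityMeasure μ] {Z : Ω → ℝ} (hZ : MemLp Z 2 μ)
    (hZ0 : ¬ Z =ᵐ[μ] 0) {c : ℕ → ℕ} (hcpos : ∀ n, 0 < c n)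
    (hmoment : Tendsto
      (fun n : ℕ => (c n : ℝ) * ∫ ω, |Z ω| ^ 2 * min 1 ((c n : ℝ) / (n : ℝ) * |Z ω| ^ 2) ∂μ)
      atTop (𝓝 0)) :
    Tendsto (fun n => (c n : ℝ) / n) atTop (𝓝 0) := by
  have hint : ∀ b : ℝ, 0 ≤ b → Integrable (fun ω => |Z ω| ^ 2 * min 1 (b * |Z ω| ^ 2)) μ := by
    intro b hb
    refine hZ.integrable_sq.mono ?_ (Eventually.of_forall fun ω => ?_)
    · have hm := hZ.aestronglyMeasurable.norm.pow 2
      exact hm.mul (aestronglyMeasurable_const.inf (hm.const_mul b))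
    · have h1 : 0 ≤ min 1 (b * |Z ω| ^ 2) := le_min zero_le_one (by positivity)
      rw [Real.norm_eq_abs, Real.norm_eq_abs, abs_mul, abs_of_nonneg h1, abs_of_nonneg (by positivity),
        abs_of_nonneg (sq_nonneg (Z ω)), sq_abs]
      exact mul_le_of_le_one_right (sq_nonneg _) (min_le_left _ _)
  have hpos : ∀ δ : ℝ, 0 < δ → 0 < ∫ ω, |Z ω| ^ 2 * min 1 (δ * |Z ω| ^ 2) ∂μ := by
    intro δ hδ
    have h0 : ∀ ω, 0 ≤ |Z ω| ^ 2 * min 1 (δ * |Z ω| ^ 2) := fun ω =>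
      mul_nonneg (sq_nonneg _) (le_min zero_le_one (by positivity))
    refine lt_of_le_of_ne (integral_nonneg h0) fun h => hZ0 ?_
    have h2 := (integral_eq_zero_iff_of_nonneg h0 (hint δ hδ.le)).1 h.symm
    filter_upwards [h2] with ω hω
    by_contra hne
    have hp : 0 < |Z ω| := abs_pos.2 hne
    have : 0 < |Z ω| ^ 2 * min 1 (δ * |Z ω| ^ 2) :=
      mul_pos (by positivity) (lt_min one_pos (by positivity))
    exact this.ne' hω
  rw [Metric.tendsto_atTop']
  intro δ hδ
  obtain ⟨N, hN⟩ := eventually_atTop.1 (hmoment.eventually_lt_const (hpos δ hδ))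
  refine ⟨N, fun n hn => ?_⟩
  have hlt := hN n hn.le
  have hc1 : (1 : ℝ) ≤ c n := by exact_mod_cast hcpos n
  rw [Real.dist_eq, sub_zero, abs_of_nonneg (by positivity)]
  -- If `c n / n ≥ δ`, the integral is at least its positive value at `δ`, and the prefactor `c n ≥
  -- 1` keeps the product above the threshold chosen for `N`.
  by_contra hge
  rw [not_lt] at hge
  have h1 : ∫ ω, |Z ω| ^ 2 * min 1 (δ * |Z ω| ^ 2) ∂μ ≤
      ∫ ω, |Z ω| ^ 2 * min 1 ((c n : ℝ) / n * |Z ω| ^ 2) ∂μ := by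
    refine integral_mono (hint δ hδ.le) (hint _ (by positivity)) fun ω => ?_
    simp only
    gcongr
  have h2 := hpos δ hδ
  nlinarith

lemma covariance_process [IsProbabilityMeasure μ] (hT : MeasurePreserving T μ μ) {Z : Ω → ℝ}
    (hZ : MemLp Z 2 μ) (hmean : ∫ ω, Z ω ∂μ = 0) (m k : ℤ) :
    covariance (process T.toEquiv Z m) (process T.toEquiv Z (m + k)) μ = acov T.toEquiv μ Z k := by
  rw [covariance_eq_sub (memLp_process hT hZ _) (memLp_process hT hZ _), integral_process hT,
    hmean, zero_mul, sub_zero]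
  have := integral_process_mul_self hT Z m (m + k)
  rw [add_sub_cancel_left] at this
  exact this

/-- Nonnegativity comes from `E (∑ b_i Z_i)² ≥ 0`, the positive semidefiniteness of the
autocovariances. -/
lemma isSpectralDensity_densityOf [IsProbabilityMeasure μ] (hT : MeasurePreserving T μ μ)
    {Z : Ω → ℝ} (hZ : MemLp Z 2 μ) (hmean : ∫ ω, Z ω ∂μ = 0)
    (hγ : Summable fun k => |acov T.toEquiv μ Z k|) :
    IsSpectralDensity μ (process T.toEquiv Z) (densityOf (acov T.toEquiv μ Z)) where
  nonneg t _ := by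
    refine densityOf_nonneg hγ (fun n b => ?_) t
    have h := integral_sq_sum (μ := μ) (Finset.Icc 1 n)
      (R := fun (i : ℕ) ω => b i * process T.toEquiv Z i ω)
      (fun i _ => (memLp_process hT hZ i).const_mul _)
    have e : ∀ i j : ℕ, ∫ ω, b i * process T.toEquiv Z i ω * (b j * process T.toEquiv Z j ω) ∂μ =
        b i * b j * acov T.toEquiv μ Z ((j : ℤ) - i) := by
      intro i j
      rw [← integral_process_mul_self hT, ← integral_const_mul]
      exact integral_congr_ae (Eventually.of_forall fun ω => by ring)
    simp_rw [e] at h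
    rw [← h]
    exact integral_nonneg fun ω => sq_nonneg _
  integrable := (continuous_densityOf hγ).continuousOn.integrableOn_Icc
  fourier m k := by
    rw [covariance_process hT hZ hmean, integral_exp_mul_densityOf hγ (acov_neg hT Z)]

/-- Consistency of the lag window form based on the residuals. -/
lemma eventually_integral_abs_quadForm_residual_sub_density_le [IsProbabilityMeasure μ]
    (hT : MeasurePreserving T μ μ) (hF₀ : F₀ ≤ mΩ) (hmono : F₀ ≤ F₀.comap T)
    (htail : ∀ s : Set Ω, MeasurableSet[⨅ i : ℤ, filt F₀ T.toEquiv i] s → μ s = 0 ∨ μ s = 1)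
    {D : ℤ → Ω → ℝ} (hD : ∀ l, IsInnovation F₀ T.toEquiv μ (D l))
    (hs : Summable fun l => ‖(hD l).memLp.toLp (D l)‖) {Z : Ω → ℝ} (hZ : MemLp Z 2 μ)
    (hsum : HasSum (fun l => koopman hT l ((hD l).memLp.toLp (D l))) (hZ.toLp Z))
    {p : ℕ} {x : ℕ → Fin p → ℝ} (β : Fin p → ℝ)
    (hdet : ∀ᶠ n in atTop, IsUnit ((designMatrix x n).transpose * designMatrix x n).det)
    {c : ℕ → ℕ} (hcpos : ∀ n, 0 < c n) (hc : Tendsto c atTop atTop)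
    (hmoment : Tendsto
      (fun n : ℕ => (c n : ℝ) * ∫ ω, |Z ω| ^ 2 * min 1 ((c n : ℝ) / (n : ℝ) * |Z ω| ^ 2) ∂μ)
      atTop (𝓝 0)) {θ : ℝ} (hθ : 0 < θ) :
    ∀ᶠ n : ℕ in atTop, ∀ t : ℝ,
      ∫ ω, |quadForm (lagWindow (c n) t) n
          (fun i => residual x (response x β (process T.toEquiv Z)) n i ω) -
        2 * Real.pi * n * densityOf (acov T.toEquiv μ Z) t| ∂μ ≤ θ * n := by
  by_cases hZ0 : Z =ᵐ[μ] 0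
  -- For vanishing errors the moment condition says nothing about `c n / n`, but then residuals and
  -- density are zero as well.
  · have hp : ∀ᵐ ω ∂μ, ∀ i : ℤ, process T.toEquiv Z i ω = 0 :=
      ae_all_iff.2 fun i => ae_process hT (P := fun z => z = 0) hZ0 i
    have hγ0 : ∀ k, acov T.toEquiv μ Z k = 0 := by
      intro k
      rw [acov]
      refine integral_eq_zero_of_ae ?_
      filter_upwards [hp] with ω h
      rw [h k, mul_zero, Pi.zero_apply]
    filter_upwards [hdet] with n hu t
    have h0 : ∀ᵐ ω ∂μ, |quadForm (lagWindow (c n) t) n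
          (fun i => residual x (response x β (process T.toEquiv Z)) n i ω) -
        2 * Real.pi * n * densityOf (acov T.toEquiv μ Z) t| = 0 := by
      filter_upwards [hp] with ω h
      have hr : ∀ i ∈ Finset.Icc 1 n,
          residual x (response x β (process T.toEquiv Z)) n i ω = 0 := by
        intro i hi
        rw [Finset.mem_Icc] at hi
        obtain ⟨a, rfl⟩ : ∃ a : Fin n, i = a.val + 1 := ⟨⟨i - 1, by omega⟩, by simp only; omega⟩
        rw [residual_eq β _ hu a ω]
        simp [h, Matrix.mulVec, dotProduct]
      have hq : quadForm (lagWindow (c n) t) n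
          (fun i => residual x (response x β (process T.toEquiv Z)) n i ω) = 0 := by
        unfold quadForm
        refine Finset.sum_eq_zero fun i hi => Finset.sum_eq_zero fun j _ => ?_
        simp only [hr i hi, zero_mul, mul_zero]
      rw [hq, densityOf]
      simp [hγ0]
    rw [integral_eq_zero_of_ae h0]
    positivity
  · have hcn := tendsto_bandwidth_div hZ hZ0 hcpos hmoment
    have hγ := (summable_acov hT hF₀ hmono hD hs hZ hsum).1
    filter_upwards [hdet,
      eventually_integral_abs_quadForm_residual_le hT hZ hγ β hdet hcpos hcn (half_pos hθ),
      eventually_integral_abs_quadForm_errors_le hT hF₀ hmono htail hD hs hZ hsum hcpos hc hcn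
        (half_pos hθ)] with n hu h1 h2 t
    have i1 : Integrable (fun ω => quadForm (lagWindow (c n) t) n
        (fun i => residual x (response x β (process T.toEquiv Z)) n i ω)) μ :=
      integrable_quadForm (fun i hi => memLp_residual hT hZ β hu hi) _
    have i2 : Integrable (fun ω => quadForm (lagWindow (c n) t) n
        (fun i => process T.toEquiv Z i ω)) μ :=
      integrable_quadForm (fun i _ => memLp_process hT hZ i) _
    have i12 := (i1.sub i2).abs
    have i23 := (i2.sub (integrable_const (2 * Real.pi * n * densityOf (acov T.toEquiv μ Z) t))).abs
    refine (integral_mono_of_nonneg (Eventually.of_forall fun ω => abs_nonneg _) (i12.add i23)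
      (Eventually.of_forall fun ω => abs_sub_le _
        (quadForm (lagWindow (c n) t) n (fun i => process T.toEquiv Z i ω)) _)).trans ?_
    refine (integral_add i12 i23).le.trans ?_
    have := add_le_add (h1 t) (h2 t)
    refine this.trans (le_of_eq (by ring))

end Consistency

end HannanRegression

end

/-! ### The theorem. -/

theorem theorem3p1 {Ω : Type*} (F₀ : MeasurableSpace Ω) [mΩ : MeasurableSpace Ω]
    (μ : Measure Ω) [IsProbabilityMeasure μ]
    -- the error process and the filtration
    (T : Ω ≃ᵐ Ω) (hT : MeasurePreserving T μ μ)
    (ε₀ : Ω → ℝ) (hL2 : MemLp ε₀ 2 μ) (hmean : ∫ ω, ε₀ ω ∂μ = 0)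
    (hF₀ : F₀ ≤ mΩ) (hmono : F₀ ≤ F₀.comap T)
    (htail : ∀ s : Set Ω,
      MeasurableSet[⨅ i : ℤ, HannanRegression.filt F₀ T.toEquiv i] s → μ s = 0 ∨ μ s = 1)
    (hmeas : Measurable[⨆ i : ℤ, HannanRegression.filt F₀ T.toEquiv i] ε₀)
    -- (C1)
    (hC1 : ∑' i : ℤ, eLpNorm (HannanRegression.proj (HannanRegression.filt F₀ T.toEquiv) μ 0
      (HannanRegression.process T.toEquiv ε₀ i)) 2 μ < ⊤)
    -- the design
    {p : ℕ} (x : ℕ → Fin p → ℝ) (β : Fin p → ℝ)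
    -- (C2)
    (hC2 : ∀ j, Tendsto (fun n => HannanRegression.colNorm x j n) atTop atTop)
    -- (C3)
    (hC3 : ∀ j, Tendsto
      (fun n : ℕ => (⨆ i : Fin n, |x (i.val + 1) j|) / HannanRegression.colNorm x j n)
      atTop (𝓝 0))
    -- (C4)
    (ρ : Fin p → Fin p → ℕ → ℝ)
    (hC4 : ∀ j l k, Tendsto
      (fun n : ℕ => ∑ m ∈ Finset.Icc 1 (n - k), x m j * x (m + k) l /
        (HannanRegression.colNorm x j n * HannanRegression.colNorm x l n))
      atTop (𝓝 (ρ j l k)))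
    -- (C5)
    (hC5 : (Matrix.of fun j l => ρ j l 0).PosDef)
    -- the bandwidth
    (c : ℕ → ℕ) (hcpos : ∀ n, 0 < c n) (hc : Tendsto c atTop atTop)
    (hmoment : Tendsto
      (fun n : ℕ => (c n : ℝ) *
        ∫ ω, |ε₀ ω| ^ 2 * min 1 ((c n : ℝ) / (n : ℝ) * |ε₀ ω| ^ 2) ∂μ)
      atTop (𝓝 0)) :
    -- a continuous version of the spectral density exists, and for it (it is unique on `[-π, π]`)
    -- the estimator is consistent
    (∃ f : ℝ → ℝ, ContinuousOn f (Set.Icc (-Real.pi) Real.pi) ∧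
      HannanRegression.IsSpectralDensity μ (HannanRegression.process T.toEquiv ε₀) f) ∧
    ∀ f : ℝ → ℝ, ContinuousOn f (Set.Icc (-Real.pi) Real.pi) →
      HannanRegression.IsSpectralDensity μ (HannanRegression.process T.toEquiv ε₀) f →
      Tendsto
        (fun n : ℕ => ⨆ t ∈ Set.Icc (-Real.pi) Real.pi,
          eLpNorm (fun ω => HannanRegression.spectralEstimator x
            (HannanRegression.response x β (HannanRegression.process T.toEquiv ε₀))
            (c n) n t ω - (f t : ℂ)) 1 μ)
        atTop (𝓝 0) := by
  have hs : Summable fun l : ℤ => ‖(HannanRegression.isInnovation_proj hT hF₀ hmono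
      (HannanRegression.memLp_process hT hL2 (-l))).memLp.toLp _‖ := by
    have h := ENNReal.summable_toReal hC1.ne
    -- The innovation of `ε₀` at time `l`, moved to time `0`, is `P₀(ε₋ₗ)`, hence the change of sign
    -- of the index.
    rw [← (Equiv.neg ℤ).summable_iff] at h
    exact h.congr fun l => (Lp.norm_toLp _ _).symm
  have hD : ∀ l : ℤ, HannanRegression.IsInnovation F₀ T.toEquiv μ (HannanRegression.proj
      (HannanRegression.filt F₀ T.toEquiv) μ 0 (HannanRegression.process T.toEquiv ε₀ (-l))) :=
    fun l => HannanRegression.isInnovation_proj hT hF₀ hmono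
      (HannanRegression.memLp_process hT hL2 (-l))
  have hsum := HannanRegression.hasSum_koopman_proj hT hF₀ hmono htail hL2 hmean hmeas hs
  have hγ := (HannanRegression.summable_acov hT hF₀ hmono hD hs hL2 hsum).1
  have hdens := HannanRegression.isSpectralDensity_densityOf hT hL2 hmean hγ
  have hcont := HannanRegression.continuous_densityOf hγ
  refine ⟨⟨_, hcont.continuousOn, hdens⟩, fun f hf hfd => ?_⟩
  have heq : Set.EqOn f (HannanRegression.densityOf (HannanRegression.acov T.toEquiv μ ε₀))
      (Set.Icc (-Real.pi) Real.pi) :=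
    HannanRegression.eqOn_of_integral_exp_eq hf hcont.continuousOn fun k => by
      rw [← hfd.fourier 0 k, ← hdens.fourier 0 k]
  have hdet := HannanRegression.eventually_isUnit_det_gram x ρ hC4 hC5
  rw [ENNReal.tendsto_nhds_zero]
  intro e he
  -- A finite positive level below `e`, which may be infinite. The factor `1 / (2π) ≤ 1` is simply
  -- discarded at the end.
  obtain ⟨θ, hθ0, hθe⟩ := ENNReal.lt_iff_exists_nnreal_btwn.1 he
  have hθ : (0 : ℝ) < θ := by exact_mod_cast hθ0
  filter_upwards [hdet, eventually_gt_atTop 0,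
    HannanRegression.eventually_integral_abs_quadForm_residual_sub_density_le hT hF₀ hmono htail
      hD hs hL2 hsum β hdet hcpos hc hmoment hθ] with n hu hn hmain
  have hn' : (0 : ℝ) < n := by exact_mod_cast hn
  refine iSup₂_le fun t ht => le_trans ?_ hθe.le
  set q : Ω → ℝ := fun ω => HannanRegression.quadForm (HannanRegression.lagWindow (c n) t) n
    (fun i => HannanRegression.residual x (HannanRegression.response x β
      (HannanRegression.process T.toEquiv ε₀)) n i ω) -
    2 * Real.pi * n * HannanRegression.densityOf (HannanRegression.acov T.toEquiv μ ε₀) t with hq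
  have hqi : Integrable q μ := (HannanRegression.integrable_quadForm
    (fun i hi => HannanRegression.memLp_residual hT hL2 β hu hi) _).sub (integrable_const _)
  have hpt : ∀ ω, HannanRegression.spectralEstimator x (HannanRegression.response x β
      (HannanRegression.process T.toEquiv ε₀)) (c n) n t ω - (f t : ℂ) =
      ((1 / (2 * Real.pi * n) * q ω : ℝ) : ℂ) := by
    intro ω
    rw [HannanRegression.spectralEstimator_eq, heq ht, ← Complex.ofReal_sub]
    congr 1
    have := Real.pi_ne_zero
    simp only [hq]
    field_simp
  simp_rw [hpt]
  rw [eLpNorm_one_eq_lintegral_enorm,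
    ← ofReal_integral_norm_eq_lintegral_enorm (hqi.const_mul _).ofReal]
  refine ENNReal.ofReal_le_of_le_toReal ?_
  rw [ENNReal.coe_toReal]
  have hk : 0 < 1 / (2 * Real.pi * n) := by positivity
  simp_rw [Complex.norm_real, Real.norm_eq_abs, abs_mul]
  rw [integral_const_mul, abs_of_pos hk]
  calc _ ≤ 1 / (2 * Real.pi * n) * (θ * n) := by
        gcongr
        exact hmain t
    _ = 1 / (2 * Real.pi) * θ := by field_simp
    _ ≤ θ := by
        refine mul_le_of_le_one_left hθ.le ?_
        rw [div_le_one Real.two_pi_pos]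
        linarith [Real.pi_gt_three]
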